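/- Let $k$ be a finite field and let $Q$ be a finite quiver (finitely many vertices and arrows) without oriented cycles, with path algebra $kQ$. The Hall algebra $\mathcal H(kQ)$ is the $\mathbb Q$-algebra with basis the isomorphism classes $[M]$ of finite dimensional $kQ$-modules and multiplication $$[M][N]:=\sum_{[X]}F_{MN}^X[X],\qquad F_{MN}^X:=\left|\{Y\subset X \text{ a submodule}: X/Y\cong M,\ Y\cong N\}\right|.$$ The composition algebra $\mathcal C(kQ)$ is the subalgebra of $\mathcal H(kQ)$ generated by the classes $[S]$ of the simple modules $S$. Let $\tau=D\,\mathrm{Ext}^1_{kQ}(-,kQ)$, with $D=\mathrm{Hom}_k(-,k)$, be the Auslander--Reiten translation. An indecomposable module is called preprojective (respectively preinjective) if it is isomorphic to $\tau^{-n}P$ with $P$ indecomposable projective (respectively $\tau^{n}I$ with $I$ indecomposable injective) for some $n\geq 0$, and an arbitrary finite dimensional module is called preprojective (respectively preinjective) if it is a finite direct sum of indecomposable preprojective (respectively preinjective) modules. Let $\mathcal P(kQ)$ (respectively $\mathcal I(kQ)$) be the subalgebra of $\mathcal H(kQ)$ generated by the classes of all preprojective (respectively preinjective) modules. Then $$\mathcal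 P(kQ)\subseteq\mathcal C(kQ)\qquad\text{and}\qquad\mathcal I(kQ)\subseteq\mathcal C(kQ).$$ -/

import Mathlib

open MulOpposite

universe u v w

/-! ### Quivers and path algebras -/

/-- A quiver without oriented cycles: the only paths from a vertex to itself are the trivial
ones. -/
class Quiver.NoOrientedCycles (Q : Type v) [Quiver.{w} Q] : Prop where
  eq_nil : ∀ (i : Q) (p : Quiver.Path i i), p = Quiver.Path.nil

/-- The `k`-bilinear extension of the concatenation of paths. -/
noncomputable def Quiver.pathConcat (k : Type u) [Field k] {Q : Type v} [Quiver.{w} Q] (i j l : Q) :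
    (Quiver.Path i j →₀ k) →ₗ[k] (Quiver.Path j l →₀ k) →ₗ[k] (Quiver.Path i l →₀ k) :=
  Finsupp.lsum k fun p => LinearMap.toSpanSingleton k _
    (Finsupp.lmapDomain k k fun q => p.comp q)

/-- The path algebra `kQ` of a quiver `Q` with finitely many vertices: the space with basis the
paths of `Q`, where `x i j` is the component of `x` in the span of the paths from `i` to `j`.
The product `q * p` of two paths is "first `p`, then `q`" if `p` ends where `q` starts, and `0`
otherwise; so a left module is the same as a (covariant) representation of `Q`. -/
def PathAlgebra (k : Type u) [Field k] (Q : Type v) [Quiver.{w} Q] : Type (max u v w) :=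
  ∀ i j : Q, Quiver.Path i j →₀ k

namespace PathAlgebra

variable (k : Type u) [Field k] (Q : Type v) [Quiver.{w} Q]

noncomputable instance : AddCommGroup (PathAlgebra k Q) :=
  inferInstanceAs (AddCommGroup (∀ i j : Q, Quiver.Path i j →₀ k))

noncomputable instance : Module k (PathAlgebra k Q) :=
  inferInstanceAs (Module k (∀ i j : Q, Quiver.Path i j →₀ k))

variable {k Q}

@[ext] theorem ext {x y : PathAlgebra k Q} (h : ∀ i j, x i j = y i j) : x = y :=
  funext fun i => funext fun j => h i j

@[simp] theorem add_apply (x y : PathAlgebra k Q) (i j : Q) : (x + y) i j = x i j + y i j := rfl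
@[simp] theorem zero_apply (i j : Q) : (0 : PathAlgebra k Q) i j = 0 := rfl
@[simp] theorem smul_apply (c : k) (x : PathAlgebra k Q) (i j : Q) : (c • x) i j = c • x i j := rfl

theorem pathConcat_single {i j l : Q} (p : Quiver.Path i j) (q : Quiver.Path j l) (a b : k) :
    Quiver.pathConcat k i j l (Finsupp.single p a) (Finsupp.single q b) =
      Finsupp.single (p.comp q) (a * b) := by
  simp [Quiver.pathConcat]

theorem pathConcat_assoc {i j l m : Q} (x : Quiver.Path i j →₀ k) (y : Quiver.Path j l →₀ k)
    (z : Quiver.Path l m →₀ k) :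
    Quiver.pathConcat k i l m (Quiver.pathConcat k i j l x y) z =
      Quiver.pathConcat k i j m x (Quiver.pathConcat k j l m y z) := by
  induction x using Finsupp.induction_linear with
  | zero => simp
  | add f g hf hg => simp [hf, hg]
  | single p a =>
    induction y using Finsupp.induction_linear with
    | zero => simp
    | add f g hf hg => simp [hf, hg]
    | single q b =>
      induction z using Finsupp.induction_linear with
      | zero => simp
      | add f g hf hg => simp [hf, hg]
      | single r c => simp only [pathConcat_single, mul_assoc, Quiver.Path.comp_assoc]

theorem nil_pathConcat {i j : Q} (x : Quiver.Path i j →₀ k) :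
    Quiver.pathConcat k i i j (Finsupp.single Quiver.Path.nil 1) x = x := by
  induction x using Finsupp.induction_linear with
  | zero => simp
  | add f g hf hg => simp [hf, hg]
  | single p a => simp [pathConcat_single]

theorem pathConcat_nil {i j : Q} (x : Quiver.Path i j →₀ k) :
    Quiver.pathConcat k i j j x (Finsupp.single Quiver.Path.nil 1) = x := by
  induction x using Finsupp.induction_linear with
  | zero => simp
  | add f g hf hg => simp [hf, hg]
  | single p a => simp [pathConcat_single]

/-- The unit is the sum of the trivial paths. -/
noncomputable instance : One (PathAlgebra k Q) :=
  ⟨fun i => by classical exact Pi.single i (Finsupp.single Quiver.Path.nil 1)⟩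

theorem one_apply_self (i : Q) :
    (1 : PathAlgebra k Q) i i = Finsupp.single Quiver.Path.nil 1 := by
  classical
  exact Pi.single_eq_same (M := fun j => Quiver.Path i j →₀ k) i _

theorem one_apply_ne {i j : Q} (h : i ≠ j) : (1 : PathAlgebra k Q) i j = 0 := by
  classical
  exact Pi.single_eq_of_ne (M := fun j => Quiver.Path i j →₀ k) h.symm _

variable [Fintype Q]

noncomputable instance : Mul (PathAlgebra k Q) :=
  ⟨fun x y i l => ∑ j, Quiver.pathConcat k i j l (y i j) (x j l)⟩

theorem mul_apply (x y : PathAlgebra k Q) (i l : Q) :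
    (x * y) i l = ∑ j, Quiver.pathConcat k i j l (y i j) (x j l) := rfl

noncomputable instance : Ring (PathAlgebra k Q) :=
  { (inferInstance : AddCommGroup (PathAlgebra k Q)) with
    mul := (· * ·)
    one := 1
    left_distrib := fun x y z => by
      ext1 i l; simp [mul_apply, Finset.sum_add_distrib]
    right_distrib := fun x y z => by
      ext1 i l; simp [mul_apply, Finset.sum_add_distrib]
    zero_mul := fun x => by ext1 i l; simp [mul_apply]
    mul_zero := fun x => by ext1 i l; simp [mul_apply]
    mul_assoc := fun x y z => by
      ext1 i l
      simp only [mul_apply, map_sum, LinearMap.sum_apply]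
      rw [Finset.sum_comm]
      simp only [pathConcat_assoc]
    one_mul := fun x => by
      ext1 i l
      rw [mul_apply, Finset.sum_eq_single l]
      · rw [one_apply_self, pathConcat_nil]
      · intro j _ hj
        rw [one_apply_ne hj, map_zero]
      · simp
    mul_one := fun x => by
      ext1 i l
      rw [mul_apply, Finset.sum_eq_single i]
      · rw [one_apply_self, nil_pathConcat]
      · intro j _ hj
        rw [one_apply_ne hj.symm, map_zero, LinearMap.zero_apply]
      · simp }

noncomputable instance : Algebra k (PathAlgebra k Q) :=
  Algebra.ofModule
    (fun c x y => by ext1 i l; simp [mul_apply, Finset.smul_sum])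
    (fun c x y => by ext1 i l; simp [mul_apply, Finset.smul_sum])

end PathAlgebra

theorem Quiver.finite_path (Q : Type v) [Quiver.{w} Q] [Finite Q] [∀ i j : Q, Finite (i ⟶ j)]
    [Quiver.NoOrientedCycles Q] (i j : Q) : Finite (Quiver.Path i j) := by
  let r : Q → Q → Prop := fun a b => ∃ p : Quiver.Path a b, p.length ≠ 0
  have : IsTrans Q r := ⟨by
    rintro a b c ⟨p, hp⟩ ⟨q, hq⟩
    exact ⟨p.comp q, by rw [Quiver.Path.length_comp]; omega⟩⟩
  have : Std.Irrefl r := ⟨by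
    rintro a ⟨p, hp⟩
    rw [Quiver.NoOrientedCycles.eq_nil a p] at hp
    exact hp rfl⟩
  have hwf : WellFounded r := Finite.wellFounded_of_trans_of_irrefl r
  induction j using hwf.induction with
  | _ j ih =>
    let g : Quiver.Path i j →
        Option (Σ b : {b : Q // Nonempty (b ⟶ j)}, Quiver.Path i b.1 × (b.1 ⟶ j)) :=
      fun p => match p with
        | .nil => none
        | .cons q e => some ⟨⟨_, ⟨e⟩⟩, q, e⟩
    have : ∀ b : {b : Q // Nonempty (b ⟶ j)}, Finite (Quiver.Path i b.1) := fun b =>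
      ih b.1 ⟨b.2.some.toPath, by simp [Quiver.Hom.toPath]⟩
    refine Finite.of_injective g ?_
    intro p q h
    cases p with
    | nil =>
      cases q with
      | nil => rfl
      | cons q e => simp [g] at h
    | cons p e =>
      cases q with
      | nil => simp [g] at h
      | cons q e' =>
        simp only [g, Option.some.injEq, Sigma.mk.injEq, Subtype.mk.injEq] at h
        obtain ⟨h1, h2⟩ := h
        subst h1
        simp only [heq_eq_eq, Prod.mk.injEq] at h2
        rw [h2.1, h2.2]

instance PathAlgebra.finite (k : Type u) [Field k] (Q : Type v) [Quiver.{w} Q] [Fintype Q]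
    [∀ i j : Q, Finite (i ⟶ j)] [Quiver.NoOrientedCycles Q] :
    Module.Finite k (PathAlgebra k Q) := by
  have : ∀ i j : Q, Finite (Quiver.Path i j) := Quiver.finite_path Q
  exact inferInstanceAs (Module.Finite k (∀ i j : Q, Quiver.Path i j →₀ k))

/-! ### Finite-dimensional modules over an algebra -/

/-- Finite-dimensional left modules over a `k`-algebra `A`. The `k`-space structure is the one
that comes from `A`, by `IsScalarTower`. -/
structure FDMod (k : Type v) [Field k] (A : Type u) [Ring A] [Algebra k A] where
  carrier : Type u
  [addCommGroup : AddCommGroup carrier]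
  [module : Module A carrier]
  [vectorSpace : Module k carrier]
  [isScalarTower : IsScalarTower k A carrier]
  [finiteDimensional : Module.Finite k carrier]

namespace FDMod

variable {k : Type v} [Field k] {A : Type u} [Ring A] [Algebra k A]

instance : CoeSort (FDMod k A) (Type u) := ⟨FDMod.carrier⟩

attribute [instance] addCommGroup module vectorSpace isScalarTower finiteDimensional

instance isoSetoid : Setoid (FDMod k A) where
  r M N := Nonempty (M ≃ₗ[A] N)
  iseqv := ⟨fun M => ⟨LinearEquiv.refl A M⟩, fun ⟨e⟩ => ⟨e.symm⟩, fun ⟨e⟩ ⟨f⟩ => ⟨e.trans f⟩⟩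

/-- An indecomposable module: nonzero, and not the direct sum of two nonzero submodules. -/
def IsIndecomposable (M : FDMod k A) : Prop :=
  Nontrivial M ∧ ∀ U W : Submodule A M, IsCompl U W → U = ⊥ ∨ W = ⊥

/-- `Hom_A(f, A) : Hom_A(P₀, A) → Hom_A(P₁, A)` for `f : P₁ → P₀`, a map of right `A`-modules. -/
def homDual {P₁ P₀ : FDMod k A} (f : P₁ →ₗ[A] P₀) : (P₀ →ₗ[A] A) →ₗ[Aᵐᵒᵖ] (P₁ →ₗ[A] A) where
  toFun g := g ∘ₗ f
  map_add' _ _ := rfl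
  map_smul' _ _ := rfl

/-- The cokernel of `Hom_A(f, A)`, a right `A`-module. If `0 → P₁ → P₀ → M → 0` is a projective
resolution with first map `f`, this is `Ext¹_A(M, A)`. -/
abbrev ExtOne {P₁ P₀ : FDMod k A} (f : P₁ →ₗ[A] P₀) : Type u :=
  (P₁ →ₗ[A] A) ⧸ LinearMap.range (homDual f)

/-- `L ≅ τ M` where `τ M = D Ext¹_A(M, A)` is the Auslander-Reiten translate of a module `M` over
a hereditary algebra `A`, with `D = Hom_k(-, k)` and `Ext¹` computed from a projective resolution
`0 → P₁ → P₀ → M → 0`. The map `e` is an isomorphism of left `A`-modules from `L` to `τ M`. -/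
def IsARTranslate (L M : FDMod k A) : Prop :=
  ∃ (P₁ P₀ : FDMod k A) (f : P₁ →ₗ[A] P₀) (p : P₀ →ₗ[A] M),
    Module.Projective A P₁ ∧ Module.Projective A P₀ ∧
    Function.Injective f ∧ Function.Exact f p ∧ Function.Surjective p ∧
    ∃ e : L ≃ₗ[k] (ExtOne f →ₗ[k] k),
      ∀ (a : A) (l : L) (x : ExtOne f), e (a • l) x = e l (op a • x)

/-- The indecomposable preprojective modules over a hereditary algebra, that is, the indecomposable
modules `τ⁻ⁿ P` with `P` indecomposable projective and `n ≥ 0`. -/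
inductive IsIndecPreprojective : FDMod k A → Prop
  | projective (P : FDMod k A) (hP : P.IsIndecomposable) (hproj : Module.Projective A P) :
      IsIndecPreprojective P
  | translate (L M : FDMod k A) (hL : IsIndecPreprojective L) (hM : M.IsIndecomposable)
      (h : IsARTranslate L M) : IsIndecPreprojective M

/-- The indecomposable preinjective modules over a hereditary algebra, that is, the indecomposable
modules `τⁿ I` with `I` indecomposable injective and `n ≥ 0`. -/
inductive IsIndecPreinjective : FDMod k A → Prop
  | injective (I : FDMod k A) (hI : I.IsIndecomposable) (hinj : Module.Injective A I) :
      IsIndecPreinjective I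
  | translate (L M : FDMod k A) (hM : IsIndecPreinjective M) (hL : L.IsIndecomposable)
      (h : IsARTranslate L M) : IsIndecPreinjective L

/-- A module is preprojective if it is a finite direct sum of indecomposable preprojectives. -/
def IsPreprojective (M : FDMod k A) : Prop :=
  ∃ (n : ℕ) (N : Fin n → FDMod k A), (∀ i, IsIndecPreprojective (N i)) ∧
    Nonempty (M ≃ₗ[A] ∀ i, N i)

/-- A module is preinjective if it is a finite direct sum of indecomposable preinjectives. -/
def IsPreinjective (M : FDMod k A) : Prop :=
  ∃ (n : ℕ) (N : Fin n → FDMod k A), (∀ i, IsIndecPreinjective (N i)) ∧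
    Nonempty (M ≃ₗ[A] ∀ i, N i)

/-- The zero module. -/
def zero (k : Type v) [Field k] (A : Type u) [Ring A] [Algebra k A] : FDMod k A where
  carrier := PUnit

/-- A submodule, as a module. -/
def ofSub {X : FDMod k A} (Y : Submodule A X) : FDMod k A where
  carrier := Y
  finiteDimensional := inferInstanceAs (Module.Finite k (Y.restrictScalars k))

/-- A quotient module. -/
def quot {X : FDMod k A} (Y : Submodule A X) : FDMod k A where
  carrier := X ⧸ Y
  finiteDimensional := Module.Finite.of_surjective
    (Y.mkQ.restrictScalars k) Y.mkQ_surjective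

/-- The Hall number `F_{MN}^X`, the number of submodules `Y` of `X` with `X/Y ≅ M` and `Y ≅ N`. -/
noncomputable def hallNumber (M N X : FDMod k A) : ℕ :=
  Nat.card {Y : Submodule A X // Nonempty ((X ⧸ Y) ≃ₗ[A] M) ∧ Nonempty (Y ≃ₗ[A] N)}

theorem hallNumber_congr {M M' N N' X X' : FDMod k A} (hM : Nonempty (M ≃ₗ[A] M'))
    (hN : Nonempty (N ≃ₗ[A] N')) (hX : Nonempty (X ≃ₗ[A] X')) :
    hallNumber M N X = hallNumber M' N' X' := by
  obtain ⟨f⟩ := hM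
  obtain ⟨g⟩ := hN
  obtain ⟨e⟩ := hX
  refine Nat.card_congr (Equiv.subtypeEquiv (Submodule.orderIsoMapComap e).toEquiv fun Y => ?_)
  have e₁ : (X ⧸ Y) ≃ₗ[A] (X' ⧸ Y.map (e : X →ₗ[A] X')) :=
    Submodule.Quotient.equiv Y _ e rfl
  have e₂ : Y ≃ₗ[A] Y.map (e : X →ₗ[A] X') := e.submoduleMap Y
  exact and_congr
    ⟨fun ⟨h⟩ => ⟨(e₁.symm.trans h).trans f⟩, fun ⟨h⟩ => ⟨(e₁.trans h).trans f.symm⟩⟩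
    ⟨fun ⟨h⟩ => ⟨(e₂.symm.trans h).trans g⟩, fun ⟨h⟩ => ⟨(e₂.trans h).trans g.symm⟩⟩

end FDMod

theorem Submodule.nonempty_quot_equiv_map {R : Type*} [Ring R] {Z : Type*} [AddCommGroup Z] [Module R Z]
    {Y Y' : Submodule R Z} :
    Nonempty ((Y' ⧸ Y.submoduleOf Y') ≃ₗ[R] Y'.map Y.mkQ) := by
  let f : Y' →ₗ[R] (Z ⧸ Y) := Y.mkQ ∘ₗ Y'.subtype
  have hk : LinearMap.ker f = Y.submoduleOf Y' := by
    simp [f, LinearMap.ker_comp, Submodule.submoduleOf]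
  have hr : LinearMap.range f = Y'.map Y.mkQ := by
    simp [f, LinearMap.range_comp]
  exact ⟨(Submodule.quotEquivOfEq _ _ hk.symm).trans
    (f.quotKerEquivRange.trans (LinearEquiv.ofEq _ _ hr))⟩

set_option maxHeartbeats 1600000 in
/-- Two ways of writing a two-step filtration of `Z` with prescribed subquotients. -/
theorem Submodule.nonempty_flag_equiv {R : Type*} [Ring R] (Z M N L : Type*) [AddCommGroup Z]
    [Module R Z] [AddCommGroup M] [Module R M] [AddCommGroup N] [Module R N] [AddCommGroup L]
    [Module R L] :
    Nonempty ((Σ Y : {Y : Submodule R Z // Nonempty (Y ≃ₗ[R] L)},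
      {W : Submodule R (Z ⧸ Y.1) // Nonempty (((Z ⧸ Y.1) ⧸ W) ≃ₗ[R] M) ∧
        Nonempty (W ≃ₗ[R] N)}) ≃
      (Σ Y : {Y : Submodule R Z // Nonempty ((Z ⧸ Y) ≃ₗ[R] M)},
      {U : Submodule R Y.1 // Nonempty ((Y.1 ⧸ U) ≃ₗ[R] N) ∧ Nonempty (U ≃ₗ[R] L)})) := by
  let T := {p : Submodule R Z × Submodule R Z // p.1 ≤ p.2 ∧ Nonempty ((Z ⧸ p.2) ≃ₗ[R] M) ∧
    Nonempty ((p.2 ⧸ p.1.submoduleOf p.2) ≃ₗ[R] N) ∧ Nonempty (p.1 ≃ₗ[R] L)}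
  let a : (Σ Y : {Y : Submodule R Z // Nonempty (Y ≃ₗ[R] L)},
      {W : Submodule R (Z ⧸ Y.1) // Nonempty (((Z ⧸ Y.1) ⧸ W) ≃ₗ[R] M) ∧
        Nonempty (W ≃ₗ[R] N)}) ≃ T :=
    { toFun := fun q => ⟨(q.1.1, q.2.1.comap q.1.1.mkQ), by
        have hle : q.1.1 ≤ q.2.1.comap q.1.1.mkQ := Submodule.le_comap_mkQ _ _
        have hmap : (q.2.1.comap q.1.1.mkQ).map q.1.1.mkQ = q.2.1 :=
          Submodule.map_comap_eq_of_surjective (Submodule.mkQ_surjective _) _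
        obtain ⟨e₁⟩ := q.2.2.1
        obtain ⟨e₂⟩ := q.2.2.2
        refine ⟨hle, ⟨?_⟩, ?_, q.1.2⟩
        · exact (Submodule.quotientQuotientEquivQuotient _ _ hle).symm.trans
            ((Submodule.quotEquivOfEq _ _ hmap).trans e₁)
        · obtain ⟨e⟩ := Submodule.nonempty_quot_equiv_map (Y := q.1.1) (Y' := q.2.1.comap q.1.1.mkQ)
          exact ⟨e.trans ((LinearEquiv.ofEq _ _ hmap).trans e₂)⟩⟩
      invFun := fun p => ⟨⟨p.1.1, p.2.2.2.2⟩, ⟨p.1.2.map p.1.1.mkQ, by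
        obtain ⟨e₁⟩ := p.2.2.1
        obtain ⟨e₂⟩ := p.2.2.2.1
        obtain ⟨e⟩ := Submodule.nonempty_quot_equiv_map (Y := p.1.1) (Y' := p.1.2)
        exact ⟨⟨(Submodule.quotientQuotientEquivQuotient _ _ p.2.1).trans e₁⟩,
          ⟨e.symm.trans e₂⟩⟩⟩⟩
      left_inv := fun q => by
        refine Sigma.ext rfl (heq_of_eq (Subtype.ext ?_))
        exact Submodule.map_comap_eq_of_surjective (Submodule.mkQ_surjective _) _
      right_inv := fun p => by
        refine Subtype.ext (Prod.ext rfl ?_)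
        change (p.1.2.map p.1.1.mkQ).comap p.1.1.mkQ = p.1.2
        rw [Submodule.comap_map_mkQ]
        exact sup_eq_right.mpr p.2.1 }
  have key : ∀ (Y : Submodule R Z) (U : Submodule R Y), Nonempty ((Y ⧸ U) ≃ₗ[R] N) →
      Nonempty ((Y ⧸ (U.map Y.subtype).submoduleOf Y) ≃ₗ[R] N) := fun Y U ⟨e⟩ => by
    have hc : (U.map Y.subtype).submoduleOf Y = U :=
      Submodule.comap_map_eq_of_injective Y.subtype_injective U
    rw [hc]
    exact ⟨e⟩
  have key' : ∀ (Y : Submodule R Z) (U : Submodule R Y), Nonempty (U ≃ₗ[R] L) →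
      Nonempty (U.map Y.subtype ≃ₗ[R] L) := fun Y U ⟨e⟩ =>
    ⟨(Submodule.equivMapOfInjective Y.subtype Y.subtype_injective U).symm.trans e⟩
  let b : (Σ Y : {Y : Submodule R Z // Nonempty ((Z ⧸ Y) ≃ₗ[R] M)},
      {U : Submodule R Y.1 // Nonempty ((Y.1 ⧸ U) ≃ₗ[R] N) ∧ Nonempty (U ≃ₗ[R] L)}) ≃ T :=
    { toFun := fun q => ⟨(q.2.1.map q.1.1.subtype, q.1.1),
        Submodule.map_subtype_le _ _, q.1.2, key q.1.1 q.2.1 q.2.2.1, key' q.1.1 q.2.1 q.2.2.2⟩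
      invFun := fun p => ⟨⟨p.1.2, p.2.2.1⟩, ⟨p.1.1.submoduleOf p.1.2, by
        obtain ⟨e₂⟩ := p.2.2.2.2
        exact ⟨p.2.2.2.1, ⟨(Submodule.submoduleOfEquivOfLe p.2.1).trans e₂⟩⟩⟩⟩
      left_inv := fun q => by
        refine Sigma.ext rfl (heq_of_eq (Subtype.ext ?_))
        exact Submodule.comap_map_eq_of_injective q.1.1.subtype_injective q.2.1
      right_inv := fun p => by
        refine Subtype.ext (Prod.ext ?_ rfl)
        change (p.1.1.submoduleOf p.1.2).map p.1.2.subtype = p.1.1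
        rw [Submodule.submoduleOf, Submodule.map_comap_subtype]
        exact inf_eq_right.mpr p.2.1 }
  exact ⟨a.trans b.symm⟩

/-- Isomorphism classes of finite-dimensional `A`-modules. -/
def IsoClass (k : Type v) [Field k] (A : Type u) [Ring A] [Algebra k A] : Type (max v (u + 1)) :=
  Quotient (FDMod.isoSetoid (k := k) (A := A))

namespace IsoClass

variable {k : Type v} [Field k] {A : Type u} [Ring A] [Algebra k A]

/-- The isomorphism class of a module. -/
def mk (M : FDMod k A) : IsoClass k A := Quotient.mk _ M

theorem mk_eq_mk {M N : FDMod k A} : mk M = mk N ↔ Nonempty (M ≃ₗ[A] N) :=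
  Quotient.eq (r := FDMod.isoSetoid)

/-- The Hall number, as a function of isomorphism classes. -/
noncomputable def hallNumber (m n x : IsoClass k A) : ℕ :=
  FDMod.hallNumber (Quotient.out m) (Quotient.out n) (Quotient.out x)

theorem nonempty_out_mk (M : FDMod k A) :
    Nonempty ((Quotient.out (mk M) : FDMod k A) ≃ₗ[A] M) :=
  Quotient.exact (Quotient.out_eq (mk M))

theorem hallNumber_mk (M N X : FDMod k A) :
    hallNumber (mk M) (mk N) (mk X) = FDMod.hallNumber M N X :=
  FDMod.hallNumber_congr (nonempty_out_mk M) (nonempty_out_mk N) (nonempty_out_mk X)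

variable [Finite k] [Module.Finite k A]

theorem finite_card_eq (c : ℕ) :
    {x : IsoClass k A | Nat.card (Quotient.out x : FDMod k A) = c}.Finite := by
  have : Finite A := Module.finite_of_finite k
  have hfin : ∀ X : FDMod k A, Finite X := fun X => Module.finite_of_finite k
  have hne : ∀ x : {x : IsoClass k A | Nat.card (Quotient.out x : FDMod k A) = c},
      Nonempty ((Quotient.out x.1 : FDMod k A) ≃ Fin c) := fun x =>
    ⟨Finite.equivFinOfCardEq x.2⟩
  let e := fun x => (hne x).some
  let t : {x : IsoClass k A | Nat.card (Quotient.out x : FDMod k A) = c} →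
      (Fin c → Fin c → Fin c) × (A → Fin c → Fin c) := fun x =>
    (fun a b => e x ((e x).symm a + (e x).symm b), fun r a => e x (r • (e x).symm a))
  have ht : Function.Injective t := by
    intro x y h
    have h1 := congrArg Prod.fst h
    have h2 := congrArg Prod.snd h
    refine Subtype.ext ?_
    rw [← Quotient.out_eq x.1, ← Quotient.out_eq y.1]
    refine Quotient.sound ⟨?_⟩
    exact
      { (e x).trans (e y).symm with
        map_add' := fun a b => by
          have := congrFun (congrFun h1 (e x a)) (e x b)
          simp only [t, Equiv.symm_apply_apply] at this
          simp [this]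
        map_smul' := fun r a => by
          have := congrFun (congrFun h2 r) (e x a)
          simp only [t, Equiv.symm_apply_apply] at this
          simp [this] }
  have := Finite.of_injective t ht
  exact Set.toFinite _

theorem finite_support (m n : IsoClass k A) :
    (Function.support fun x => (hallNumber m n x : ℚ)).Finite := by
  refine (finite_card_eq (k := k) (A := A)
    (Nat.card (Quotient.out m : FDMod k A) * Nat.card (Quotient.out n : FDMod k A))).subset ?_
  intro x hx
  have hx' : hallNumber m n x ≠ 0 := by simpa using hx
  have : Nonempty _ := (Nat.card_ne_zero.mp hx').1
  obtain ⟨Y, ⟨e⟩, ⟨f⟩⟩ := this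
  have h := Submodule.card_eq_card_quotient_mul_card Y
  rw [Set.mem_ofPred_eq, h, Nat.card_congr e.toEquiv, Nat.card_congr f.toEquiv, mul_comm]

end IsoClass

/-- The Hall algebra of a finite-dimensional algebra `A` over a finite field `k`: the `ℚ`-algebra
with basis the isomorphism classes `[M]` of finite-dimensional `A`-modules and multiplication
`[M][N] = ∑ F_{MN}^X [X]`, the sum over all isomorphism classes `[X]`. -/
def HallAlgebra (k : Type v) [Field k] (A : Type u) [Ring A] [Algebra k A] : Type (max v (u + 1)) :=
  IsoClass k A →₀ ℚ

namespace HallAlgebra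

variable {k : Type v} [Field k] {A : Type u} [Ring A] [Algebra k A]

noncomputable instance : AddCommGroup (HallAlgebra k A) :=
  inferInstanceAs (AddCommGroup (IsoClass k A →₀ ℚ))

noncomputable instance : Module ℚ (HallAlgebra k A) :=
  inferInstanceAs (Module ℚ (IsoClass k A →₀ ℚ))

/-- The elements of the Hall algebra as finitely supported functions on isomorphism classes. -/
noncomputable def repr : HallAlgebra k A ≃ₗ[ℚ] (IsoClass k A →₀ ℚ) := LinearEquiv.refl ℚ _

/-- The class `[M]` of a module in the Hall algebra. -/
noncomputable def cls (M : FDMod k A) : HallAlgebra k A :=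
  repr.symm (Finsupp.single (IsoClass.mk M) 1)

/-- The coefficient of `[X]`. -/
noncomputable def coeff (X : FDMod k A) : HallAlgebra k A →ₗ[ℚ] ℚ :=
  Finsupp.lapply (IsoClass.mk X) ∘ₗ repr.toLinearMap

theorem coeff_cls (X M : FDMod k A) [Decidable (Nonempty (X ≃ₗ[A] M))] :
    coeff X (cls M) = if Nonempty (X ≃ₗ[A] M) then 1 else 0 := by
  classical
  simp only [coeff, cls, LinearMap.comp_apply, LinearEquiv.coe_coe, LinearEquiv.apply_symm_apply,
    Finsupp.lapply_apply, Finsupp.single_apply, ← IsoClass.mk_eq_mk, eq_comm]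

theorem ext_coeff {x y : HallAlgebra k A} (h : ∀ X, coeff X x = coeff X y) : x = y :=
  repr.injective <| Finsupp.ext fun m => by
    induction m using Quotient.inductionOn with
    | _ M => exact h M

theorem induction_cls {p : HallAlgebra k A → Prop} (x : HallAlgebra k A) (zero : p 0)
    (add : ∀ x y, p x → p y → p (x + y)) (smul : ∀ (c : ℚ) M, p (c • cls M)) : p x := by
  obtain ⟨x, rfl⟩ := repr.symm.surjective x
  induction x using Finsupp.induction_linear with
  | zero => simpa using zero
  | add f g hf hg => simpa using add _ _ hf hg
  | single m c =>
    induction m using Quotient.inductionOn with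
    | _ M =>
      have := smul c M
      rw [cls, ← map_smul, Finsupp.smul_single, smul_eq_mul, mul_one] at this
      exact this

theorem finite_submodule [Finite k] (Z : FDMod k A) : Finite (Submodule A Z) := by
  have : Finite Z := Module.finite_of_finite k
  exact Finite.of_injective (fun Y : Submodule A Z => (Y : Set Z)) SetLike.coe_injective

variable [Finite k] [Module.Finite k A]

/-- The product `[M][N] = ∑ F_{MN}^X [X]` of two basis elements. -/
noncomputable def hallProd (m n : IsoClass k A) : HallAlgebra k A :=
  repr.symm (Finsupp.ofSupportFinite (fun x => (IsoClass.hallNumber m n x : ℚ))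
    (IsoClass.finite_support m n))

/-- The bilinear extension of the product of basis elements. -/
noncomputable def mulHom : HallAlgebra k A →ₗ[ℚ] HallAlgebra k A →ₗ[ℚ] HallAlgebra k A :=
  (Finsupp.lsum ℚ fun m => LinearMap.toSpanSingleton ℚ (HallAlgebra k A →ₗ[ℚ] HallAlgebra k A)
    (Finsupp.linearCombination ℚ (hallProd m) ∘ₗ repr.toLinearMap)) ∘ₗ repr.toLinearMap

noncomputable instance : Mul (HallAlgebra k A) := ⟨fun x y => mulHom x y⟩

noncomputable instance : One (HallAlgebra k A) := ⟨cls (FDMod.zero k A)⟩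

theorem mul_def (x y : HallAlgebra k A) : x * y = mulHom x y := rfl

theorem coeff_cls_mul_cls (M N X : FDMod k A) :
    coeff X (cls M * cls N) = (FDMod.hallNumber M N X : ℚ) := by
  have : cls M * cls N = hallProd (IsoClass.mk M) (IsoClass.mk N) := by
    simp [mul_def, mulHom, cls]
  rw [this, ← IsoClass.hallNumber_mk]
  simp only [coeff, hallProd, LinearMap.comp_apply, LinearEquiv.coe_coe,
    LinearEquiv.apply_symm_apply]
  rfl

theorem coeff_mul_cls (Z L : FDMod k A) (y : HallAlgebra k A) :
    coeff Z (y * cls L) =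
      ∑ᶠ Y : {Y : Submodule A Z // Nonempty (Y ≃ₗ[A] L)}, coeff (FDMod.quot Y.1) y := by
  classical
  have := finite_submodule Z
  have := Fintype.ofFinite {Y : Submodule A Z // Nonempty (Y ≃ₗ[A] L)}
  rw [finsum_eq_sum_of_fintype]
  induction y using induction_cls with
  | zero => simp [mul_def]
  | add x y hx hy =>
    simp only [mul_def, map_add, LinearMap.add_apply, Finset.sum_add_distrib] at hx hy ⊢
    rw [hx, hy]
  | smul c M =>
    have : coeff Z (cls M * cls L) = ∑ Y : {Y : Submodule A Z // Nonempty (Y ≃ₗ[A] L)},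
        coeff (FDMod.quot Y.1) (cls M) := by
      simp only [coeff_cls_mul_cls, coeff_cls, Finset.sum_boole]
      rw [FDMod.hallNumber, ← Fintype.card_subtype, ← Nat.card_eq_fintype_card]
      refine congrArg Nat.cast (Nat.card_congr ?_)
      exact ((Equiv.subtypeSubtypeEquivSubtypeInter
        (fun Y : Submodule A Z => Nonempty (Y ≃ₗ[A] L))
        (fun Y : Submodule A Z => Nonempty ((Z ⧸ Y) ≃ₗ[A] M))).trans
        (Equiv.subtypeEquivRight fun Y => and_comm)).symm
    simp only [mul_def, map_smul, LinearMap.smul_apply, ← Finset.smul_sum] at this ⊢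
    rw [this]

theorem coeff_cls_mul (Z M : FDMod k A) (y : HallAlgebra k A) :
    coeff Z (cls M * y) =
      ∑ᶠ Y : {Y : Submodule A Z // Nonempty ((Z ⧸ Y) ≃ₗ[A] M)}, coeff (FDMod.ofSub Y.1) y := by
  classical
  have := finite_submodule Z
  have := Fintype.ofFinite {Y : Submodule A Z // Nonempty ((Z ⧸ Y) ≃ₗ[A] M)}
  rw [finsum_eq_sum_of_fintype]
  induction y using induction_cls with
  | zero => simp [mul_def]
  | add x y hx hy =>
    simp only [mul_def, map_add, Finset.sum_add_distrib] at hx hy ⊢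
    rw [hx, hy]
  | smul c L =>
    have : coeff Z (cls M * cls L) = ∑ Y : {Y : Submodule A Z // Nonempty ((Z ⧸ Y) ≃ₗ[A] M)},
        coeff (FDMod.ofSub Y.1) (cls L) := by
      simp only [coeff_cls_mul_cls, coeff_cls, Finset.sum_boole]
      rw [FDMod.hallNumber, ← Fintype.card_subtype, ← Nat.card_eq_fintype_card]
      refine congrArg Nat.cast (Nat.card_congr ?_)
      exact (Equiv.subtypeSubtypeEquivSubtypeInter
        (fun Y : Submodule A Z => Nonempty ((Z ⧸ Y) ≃ₗ[A] M))
        (fun Y : Submodule A Z => Nonempty (Y ≃ₗ[A] L))).symm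
    simp only [mul_def, map_smul, ← Finset.smul_sum] at this ⊢
    rw [this]

theorem cls_mul_assoc (M N L : FDMod k A) :
    cls M * cls N * cls L = cls M * (cls N * cls L) := by
  refine ext_coeff fun Z => ?_
  have := finite_submodule Z
  have := Fintype.ofFinite {Y : Submodule A Z // Nonempty (Y ≃ₗ[A] L)}
  have := Fintype.ofFinite {Y : Submodule A Z // Nonempty ((Z ⧸ Y) ≃ₗ[A] M)}
  rw [coeff_mul_cls, coeff_cls_mul, finsum_eq_sum_of_fintype, finsum_eq_sum_of_fintype]
  simp only [coeff_cls_mul_cls, FDMod.hallNumber]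
  have h1 : ∀ Y : Submodule A Z, Finite (Submodule A (FDMod.quot Y)) := fun Y =>
    finite_submodule _
  have h2 : ∀ Y : Submodule A Z, Finite (Submodule A (FDMod.ofSub Y)) := fun Y =>
    finite_submodule _
  rw [← Nat.cast_sum, ← Nat.cast_sum, ← Nat.card_sigma, ← Nat.card_sigma]
  refine congrArg Nat.cast (Nat.card_congr ?_)
  exact (Submodule.nonempty_flag_equiv Z M N L).some

theorem hall_mul_assoc (x y z : HallAlgebra k A) : x * y * z = x * (y * z) := by
  have smul_l : ∀ (c : ℚ) (x y : HallAlgebra k A), (c • x) * y = c • (x * y) := by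
    simp [mul_def]
  have smul_r : ∀ (c : ℚ) (x y : HallAlgebra k A), x * (c • y) = c • (x * y) := by
    simp [mul_def]
  induction x using induction_cls with
  | zero => simp [mul_def]
  | add f g hf hg => simp only [mul_def, map_add, LinearMap.add_apply] at hf hg ⊢; rw [hf, hg]
  | smul a M =>
    induction y using induction_cls with
    | zero => simp [mul_def]
    | add f g hf hg => simp only [mul_def, map_add, LinearMap.add_apply] at hf hg ⊢; rw [hf, hg]
    | smul b N =>
      induction z using induction_cls with
      | zero => simp [mul_def]
      | add f g hf hg => simp only [mul_def, map_add] at hf hg ⊢; rw [hf, hg]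
      | smul c L => simp only [smul_l, smul_r, cls_mul_assoc]

theorem hall_one_mul (x : HallAlgebra k A) : 1 * x = x := by
  classical
  refine ext_coeff fun Z => ?_
  have hs : ∀ Y : Submodule A Z,
      Nonempty ((Z ⧸ Y) ≃ₗ[A] (FDMod.zero k A)) ↔ Y = ⊤ := fun Y => by
    rw [← Submodule.Quotient.subsingleton_iff]
    refine ⟨fun ⟨e⟩ => ?_, fun h => ⟨?_⟩⟩
    · exact e.toEquiv.subsingleton_congr.mpr (inferInstanceAs (Subsingleton PUnit))
    · have : Subsingleton (FDMod.zero k A) := inferInstanceAs (Subsingleton PUnit)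
      exact 0
  let t : {Y : Submodule A Z // Nonempty ((Z ⧸ Y) ≃ₗ[A] (FDMod.zero k A))} := ⟨⊤, (hs ⊤).mpr rfl⟩
  change coeff Z (cls (FDMod.zero k A) * x) = _
  rw [coeff_cls_mul, finsum_eq_single _ t fun Y hY =>
    absurd (Subtype.ext ((hs Y.1).mp Y.2)) hY]
  have h : IsoClass.mk (FDMod.ofSub t.1) = IsoClass.mk Z :=
    IsoClass.mk_eq_mk.mpr ⟨Submodule.topEquiv⟩
  simp only [coeff, h]

theorem hall_mul_one (x : HallAlgebra k A) : x * 1 = x := by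
  classical
  refine ext_coeff fun Z => ?_
  have hs : ∀ Y : Submodule A Z, Nonempty (Y ≃ₗ[A] (FDMod.zero k A)) ↔ Y = ⊥ := fun Y => by
    rw [← Submodule.subsingleton_iff_eq_bot]
    refine ⟨fun ⟨e⟩ => ?_, fun h => ⟨?_⟩⟩
    · exact e.toEquiv.subsingleton_congr.mpr (inferInstanceAs (Subsingleton PUnit))
    · have : Subsingleton (FDMod.zero k A) := inferInstanceAs (Subsingleton PUnit)
      exact 0
  let t : {Y : Submodule A Z // Nonempty (Y ≃ₗ[A] (FDMod.zero k A))} := ⟨⊥, (hs ⊥).mpr rfl⟩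
  change coeff Z (x * cls (FDMod.zero k A)) = _
  rw [coeff_mul_cls, finsum_eq_single _ t fun Y hY =>
    absurd (Subtype.ext ((hs Y.1).mp Y.2)) hY]
  have h : IsoClass.mk (FDMod.quot t.1) = IsoClass.mk Z :=
    IsoClass.mk_eq_mk.mpr ⟨Submodule.quotEquivOfEqBot _ rfl⟩
  simp only [coeff, h]

noncomputable instance : Ring (HallAlgebra k A) :=
  { (inferInstance : AddCommGroup (HallAlgebra k A)) with
    mul := (· * ·)
    one := 1
    left_distrib := fun x y z => by simp [mul_def]
    right_distrib := fun x y z => by simp [mul_def]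
    zero_mul := fun x => by simp [mul_def]
    mul_zero := fun x => by simp [mul_def]
    mul_assoc := hall_mul_assoc
    one_mul := hall_one_mul
    mul_one := hall_mul_one }

noncomputable instance : Algebra ℚ (HallAlgebra k A) :=
  Algebra.ofModule (fun c x y => by simp [mul_def]) (fun c x y => by simp [mul_def])

end HallAlgebra

/-! ### The composition algebra and the subalgebras of preprojectives and preinjectives -/

section Subalgebras

variable (k : Type v) [Field k] [Finite k] (A : Type u) [Ring A] [Algebra k A] [Module.Finite k A]

/-- The composition algebra: the subalgebra of the Hall algebra generated by the classes of the
simple modules. -/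
noncomputable def compositionAlgebra : Subalgebra ℚ (HallAlgebra k A) :=
  Algebra.adjoin ℚ {x | ∃ S : FDMod k A, IsSimpleModule A S ∧ x = HallAlgebra.cls S}

/-- The subalgebra of the Hall algebra generated by the classes of all preprojective modules. -/
noncomputable def preprojectiveSubalgebra : Subalgebra ℚ (HallAlgebra k A) :=
  Algebra.adjoin ℚ {x | ∃ P : FDMod k A, P.IsPreprojective ∧ x = HallAlgebra.cls P}

/-- The subalgebra of the Hall algebra generated by the classes of all preinjective modules. -/
noncomputable def preinjectiveSubalgebra : Subalgebra ℚ (HallAlgebra k A) :=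
  Algebra.adjoin ℚ {x | ∃ I : FDMod k A, I.IsPreinjective ∧ x = HallAlgebra.cls I}

end Subalgebras

/-!
Let `P` be an indecomposable preprojective module, and order indecomposable preprojective modules by
the key `(n, dim)`, where `n` is the least number of steps `τ⁻¹` needed to reach the module from a
projective one. The modules without nonzero homomorphisms to modules of key smaller than that of `P`
are the torsion class of a torsion pair whose torsion-free modules are the direct sums of
indecomposable preprojective modules of smaller key. For a class of modules and a dimension vector
`d`, consider the sum in the Hall algebra of the isomorphism classes of dimension vector `d` in the
class. Since every module has a unique torsion submodule, the sum over all modules is `∑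
(torsion-free sum of d') * (torsion sum of d'')`, the sum ranging over `d' + d'' = d`. The sum over
all modules lies in the composition algebra, as the absence of oriented cycles gives every module a
canonical filtration by its vertex spaces; by induction so do the torsion-free sums, hence so do the
torsion sums. Finally, for `d` the dimension vector of `P` the torsion sum is `[P]` alone. Indeed
`P` is torsion, so `Ext¹(P, P) = 0` by the Auslander-Reiten formula and `⟨d, d⟩ > 0`. Hence a
torsion module `X` of dimension vector `d` has a nonzero homomorphism to `P`; some indecomposable
summand of `X` maps nontrivially to `P`, and as its key cannot be smaller than that of `P` it is
isomorphic to `P`. A direct sum of indecomposable preprojective modules, taken in the order of their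
keys, is a product of classes in the Hall algebra up to a scalar.

The statement for preinjective modules follows by `k`-duality, which exchanges preprojective and
preinjective modules and is an anti-isomorphism between the Hall algebras of an algebra and of its
opposite.
-/

theorem FDMod.exists_linearEquiv_of_algHom {k : Type v} [Field k] {A : Type u} [Ring A]
    [Algebra k A] {W : Type*} [AddCommGroup W] [Module k W] [Module.Finite k W]
    (F : A →ₐ[k] Module.End k W) {U : Type u} [AddCommGroup U] [Module k U] (c : U ≃ₗ[k] W) :
    ∃ (X : FDMod k A) (c : X ≃ₗ[k] W), ∀ a y, c (a • y) = F a (c y) := by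
  let FU : A →ₐ[k] Module.End k U := (c.symm.conjAlgEquiv k).toAlgHom.comp F
  let X : FDMod k A :=
    { carrier := U
      module := Module.compHom U FU.toRingHom
      isScalarTower := @IsScalarTower.mk _ _ _ _ (_) _ fun r a y => by
        change FU (r • a) y = r • FU a y
        rw [map_smul, LinearMap.smul_apply]
      finiteDimensional := Module.Finite.equiv c.symm }
  refine ⟨X, c, fun a y => ?_⟩
  change c (FU a y) = F a (c y)
  simp [FU]

/-! ### Algebras presented by a quiver -/

/-- Elements `e i`, `x a` of a ring satisfying the relations between the trivial paths and the
arrows in the path algebra of the quiver with vertices `V`, arrows `E`, sources `s` and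
targets `t`. -/
structure QuiverRelations {V E B : Type*} [Fintype V] [Ring B] (s t : E → V) (e : V → B)
    (x : E → B) : Prop where
  idem : ∀ i, e i * e i = e i
  orth : ∀ i j, i ≠ j → e i * e j = 0
  sum_eq_one : ∑ i, e i = 1
  tgt_mul : ∀ a, e (t a) * x a = x a
  mul_src : ∀ a, x a * e (s a) = x a

/-- A presentation of an algebra as the path algebra of a finite quiver without oriented cycles,
by its universal property. Unlike the type `PathAlgebra k Q`, this notion is stable under passage
to the opposite algebra, on which the duality between preprojectives and preinjectives rests. -/
structure QuiverPresentation (k : Type v) [Field k] (A : Type u) [Ring A] [Algebra k A]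
    (V E : Type*) [Fintype V] where
  s : E → V
  t : E → V
  e : V → A
  x : E → A
  rel : QuiverRelations s t e x
  adjoin_eq_top : Algebra.adjoin k (Set.range e ∪ Set.range x) = ⊤
  exists_lift : ∀ (B : Type u) [Ring B] [Algebra k B] (ε : V → B) (b : E → B),
    QuiverRelations s t ε b → ∃ F : A →ₐ[k] B, (∀ i, F (e i) = ε i) ∧ ∀ a, F (x a) = b a
  rank : V → ℕ
  rank_lt : ∀ a, rank (s a) < rank (t a)

namespace QuiverPresentation

variable {k : Type v} [Field k] {A : Type u} [Ring A] [Algebra k A] {V E : Type*} [Fintype V]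
  (q : QuiverPresentation k A V E)

section Relations

variable {M : Type*} [AddCommGroup M] [Module A M]

theorem e_smul_e_smul_self (i : V) (m : M) : q.e i • q.e i • m = q.e i • m := by
  rw [smul_smul, q.rel.idem]

theorem e_smul_e_smul_of_ne {i j : V} (h : i ≠ j) (m : M) : q.e i • q.e j • m = 0 := by
  rw [smul_smul, q.rel.orth i j h, zero_smul]

theorem e_tgt_smul_x_smul (a : E) (m : M) : q.e (q.t a) • q.x a • m = q.x a • m := by
  rw [smul_smul, q.rel.tgt_mul]

theorem x_smul_e_src_smul (a : E) (m : M) : q.x a • q.e (q.s a) • m = q.x a • m := by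
  rw [smul_smul, q.rel.mul_src]

theorem sum_e_smul (m : M) : ∑ i, q.e i • m = m := by
  rw [← Finset.sum_smul, q.rel.sum_eq_one, one_smul]

end Relations

@[elab_as_elim]
theorem induction_generators {p : A → Prop} (a : A) (e : ∀ i, p (q.e i)) (x : ∀ a, p (q.x a))
    (algebraMap : ∀ c, p (algebraMap k A c)) (add : ∀ a b, p a → p b → p (a + b))
    (mul : ∀ a b, p a → p b → p (a * b)) : p a := by
  have ha : a ∈ Algebra.adjoin k (Set.range q.e ∪ Set.range q.x) := q.adjoin_eq_top ▸ trivial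
  induction ha using Algebra.adjoin_induction with
  | mem y hy =>
    rcases hy with ⟨i, rfl⟩ | ⟨a, rfl⟩
    · exact e i
    · exact x a
  | algebraMap c => exact algebraMap c
  | add a b _ _ ha hb => exact add a b ha hb
  | mul a b _ _ ha hb => exact mul a b ha hb

section Representation

variable (M : Type*) {N X : Type*} [AddCommGroup M] [Module A M] [Module k M]
  [IsScalarTower k A M] [AddCommGroup N] [Module A N] [Module k N] [IsScalarTower k A N]
  [AddCommGroup X] [Module A X] [Module k X] [IsScalarTower k A X]

/-- The space at the vertex `i` of the representation of the quiver given by a module. -/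
def vertexSpace (i : V) : Submodule k M where
  carrier := {m | q.e i • m = m}
  add_mem' hm hm' := by rw [Set.mem_ofPred_eq, smul_add, hm, hm']
  zero_mem' := smul_zero _
  smul_mem' c m hm := by rw [Set.mem_ofPred_eq, smul_comm, hm]

/-- The projection of a module onto its space at the vertex `i`. -/
def vertexProj (i : V) : M →ₗ[k] q.vertexSpace M i :=
  (Algebra.lsmul k k M (q.e i)).codRestrict _ (q.e_smul_e_smul_self i)

/-- The map of the representation given by a module at the arrow `a`. -/
def arrowMap (a : E) : q.vertexSpace M (q.s a) →ₗ[k] q.vertexSpace M (q.t a) :=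
  (Algebra.lsmul k k M (q.x a)).restrict fun m _ => q.e_tgt_smul_x_smul a m

/-- The dimension vector of a module. -/
noncomputable def dimVec (i : V) : ℕ :=
  Module.finrank k (q.vertexSpace M i)

variable {M}

@[simp] theorem coe_vertexProj (i : V) (m : M) : (q.vertexProj M i m : M) = q.e i • m := rfl

@[simp] theorem coe_arrowMap (a : E) (m : q.vertexSpace M (q.s a)) :
    (q.arrowMap M a m : M) = q.x a • (m : M) := rfl

theorem e_smul_coe {i : V} (m : q.vertexSpace M i) : q.e i • (m : M) = m := m.2

@[simp] theorem vertexProj_coe {i : V} (m : q.vertexSpace M i) : q.vertexProj M i m = m :=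
  Subtype.ext m.2

theorem e_smul_coe_of_ne {i j : V} (h : j ≠ i) (m : q.vertexSpace M i) :
    q.e j • (m : M) = 0 := by
  rw [← q.e_smul_coe m, q.e_smul_e_smul_of_ne h]

theorem e_smul_sum_coe (f : ∀ i, q.vertexSpace M i) (j : V) :
    q.e j • ∑ i, (f i : M) = f j := by
  rw [Finset.smul_sum, Finset.sum_eq_single j, q.e_smul_coe]
  · exact fun i _ hi => q.e_smul_coe_of_ne hi.symm (f i)
  · simp

variable (M) in
/-- A module is the direct sum of its spaces at the vertices. -/
def decompose : M ≃ₗ[k] ∀ i, q.vertexSpace M i where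
  __ := LinearMap.pi (q.vertexProj M)
  invFun f := ∑ i, (f i : M)
  left_inv := q.sum_e_smul
  right_inv f := funext fun j => Subtype.ext (q.e_smul_sum_coe f j)

theorem sum_dimVec [Module.Finite k M] : ∑ i, q.dimVec M i = Module.finrank k M := by
  rw [(q.decompose M).finrank_eq, Module.finrank_pi_fintype]
  rfl

theorem dimVec_eq_zero_iff [Module.Finite k M] {i : V} :
    q.dimVec M i = 0 ↔ ∀ m : M, q.e i • m = 0 := by
  rw [dimVec, Submodule.finrank_eq_zero, Submodule.eq_bot_iff]
  exact ⟨fun h m => h _ (q.vertexProj M i m).2, fun h m hm => hm.symm.trans (h m)⟩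

/-- The map at the vertex `i` of the morphism of representations given by a linear map. -/
def vertexMap (f : M →ₗ[A] N) (i : V) : q.vertexSpace M i →ₗ[k] q.vertexSpace N i :=
  (f.restrictScalars k).restrict fun m hm =>
    (f.map_smul (q.e i) m).symm.trans (congrArg f hm)

@[simp] theorem coe_vertexMap (f : M →ₗ[A] N) (i : V) (m : q.vertexSpace M i) :
    (q.vertexMap f i m : N) = f m := rfl

theorem arrowMap_vertexMap (f : M →ₗ[A] N) (a : E) (m : q.vertexSpace M (q.s a)) :
    q.arrowMap N a (q.vertexMap f (q.s a) m) = q.vertexMap f (q.t a) (q.arrowMap M a m) :=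
  Subtype.ext (f.map_smul _ _).symm

theorem vertexMap_injective {f : M →ₗ[A] N} (hf : Function.Injective f) (i : V) :
    Function.Injective (q.vertexMap f i) := fun _ _ h =>
  Subtype.ext (hf (congrArg Subtype.val h))

theorem vertexMap_surjective {f : M →ₗ[A] N} (hf : Function.Surjective f) (i : V) :
    Function.Surjective (q.vertexMap f i) := fun n => by
  obtain ⟨m, hm⟩ := hf n
  refine ⟨q.vertexProj M i m, Subtype.ext ?_⟩
  rw [coe_vertexMap, coe_vertexProj, map_smul, hm, q.e_smul_coe]

theorem vertexMap_exact {ι : N →ₗ[A] X} {π : X →ₗ[A] M} (h : Function.Exact ι π) (i : V) :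
    Function.Exact (q.vertexMap ι i) (q.vertexMap π i) := fun y => by
  refine ⟨fun hy => ?_, ?_⟩
  · obtain ⟨n, hn⟩ := (h y).mp (congrArg Subtype.val hy)
    refine ⟨q.vertexProj N i n, Subtype.ext ?_⟩
    rw [coe_vertexMap, coe_vertexProj, map_smul, hn, q.e_smul_coe]
  · rintro ⟨n, rfl⟩
    exact Subtype.ext (h.apply_apply_eq_zero n)

theorem dimVec_eq_add_of_exact [Module.Finite k X] {ι : N →ₗ[A] X} {π : X →ₗ[A] M}
    (hι : Function.Injective ι) (hex : Function.Exact ι π) (hπ : Function.Surjective π) :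
    q.dimVec X = q.dimVec M + q.dimVec N := by
  funext i
  have h := LinearMap.finrank_range_add_finrank_ker (q.vertexMap π i)
  rw [LinearMap.range_eq_top.mpr (q.vertexMap_surjective hπ i), finrank_top,
    (q.vertexMap_exact hex i).linearMap_ker_eq,
    LinearMap.finrank_range_of_inj (q.vertexMap_injective hι i)] at h
  exact h.symm

theorem dimVec_congr (f : M ≃ₗ[A] N) : q.dimVec M = q.dimVec N :=
  funext fun i => (LinearEquiv.ofBijective (q.vertexMap f.toLinearMap i)
    ⟨q.vertexMap_injective f.injective i, q.vertexMap_surjective f.surjective i⟩).finrank_eq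

/-- A `k`-linear map that commutes with the generators, as an `A`-linear map. -/
def toLinearMap (f : M →ₗ[k] N) (he : ∀ i m, f (q.e i • m) = q.e i • f m)
    (hx : ∀ a m, f (q.x a • m) = q.x a • f m) : M →ₗ[A] N where
  toFun := f
  map_add' := f.map_add
  map_smul' a := by
    induction a using q.induction_generators with
    | e i => exact he i
    | x a => exact hx a
    | algebraMap c => simp
    | add a b ha hb => intro m; simp only [add_smul, map_add, ha m, hb m, RingHom.id_apply]
    | mul a b ha hb => intro m; simp only [mul_smul, ha, hb, RingHom.id_apply]

/-- The `k`-linear map given by linear maps between the spaces at the vertices. -/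
def glue (h : ∀ i, q.vertexSpace M i →ₗ[k] q.vertexSpace N i) : M →ₗ[k] N :=
  ∑ i, (q.vertexSpace N i).subtype ∘ₗ h i ∘ₗ q.vertexProj M i

theorem e_smul_glue (h : ∀ i, q.vertexSpace M i →ₗ[k] q.vertexSpace N i) (i : V) (m : M) :
    q.e i • q.glue h m = h i (q.vertexProj M i m) := by
  rw [glue, LinearMap.sum_apply]
  exact q.e_smul_sum_coe (fun i => h i (q.vertexProj M i m)) i

theorem glue_coe (h : ∀ i, q.vertexSpace M i →ₗ[k] q.vertexSpace N i) {i : V}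
    (m : q.vertexSpace M i) : q.glue h m = h i m := by
  rw [glue, LinearMap.sum_apply, Finset.sum_eq_single i]
  · simp
  · intro j _ hj
    have hm : q.vertexProj M j (m : M) = 0 := Subtype.ext (q.e_smul_coe_of_ne hj m)
    simp [hm]
  · simp

end Representation

/-! ### Extensions and the Euler form -/

section Differential

variable (M N : Type*) {X : Type*} [AddCommGroup M] [Module A M] [Module k M]
  [IsScalarTower k A M] [AddCommGroup N] [Module A N] [Module k N] [IsScalarTower k A N]
  [AddCommGroup X] [Module A X] [Module k X] [IsScalarTower k A X]

/-- The differential whose kernel is `Hom_A(M, N)` and whose cokernel is `Ext¹_A(M, N)`, obtained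
from the standard projective resolution of `M`. -/
def differential :
    (∀ i, q.vertexSpace M i →ₗ[k] q.vertexSpace N i) →ₗ[k]
      ∀ a, q.vertexSpace M (q.s a) →ₗ[k] q.vertexSpace N (q.t a) where
  toFun h a := q.arrowMap N a ∘ₗ h (q.s a) - h (q.t a) ∘ₗ q.arrowMap M a
  map_add' h h' := by
    funext a
    simp only [Pi.add_apply, LinearMap.comp_add, LinearMap.add_comp]
    abel
  map_smul' c h := by
    funext a
    simp only [Pi.smul_apply, LinearMap.comp_smul, LinearMap.smul_comp, smul_sub,
      RingHom.id_apply]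

/-- The vanishing of `Ext¹_A(M, N)`. -/
def ExtVanish : Prop := Function.Surjective (q.differential M N)

variable {M N}

theorem differential_apply (h : ∀ i, q.vertexSpace M i →ₗ[k] q.vertexSpace N i) (a : E)
    (m : q.vertexSpace M (q.s a)) :
    q.differential M N h a m =
      q.arrowMap N a (h (q.s a) m) - h (q.t a) (q.arrowMap M a m) := rfl

theorem differential_eq_zero_iff {h : ∀ i, q.vertexSpace M i →ₗ[k] q.vertexSpace N i} :
    q.differential M N h = 0 ↔
      ∀ a m, q.arrowMap N a (h (q.s a) m) = h (q.t a) (q.arrowMap M a m) := by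
  simp only [funext_iff, LinearMap.ext_iff, differential_apply, sub_eq_zero, Pi.zero_apply,
    LinearMap.zero_apply]

/-- The linear map given by a morphism of representations, that is, by linear maps between the
spaces at the vertices that commute with the maps at the arrows. -/
def ofVertexMaps (h : ∀ i, q.vertexSpace M i →ₗ[k] q.vertexSpace N i)
    (hh : q.differential M N h = 0) : M →ₗ[A] N :=
  q.toLinearMap (q.glue h)
    (fun i m => by rw [q.e_smul_glue, ← q.glue_coe h, coe_vertexProj])
    (fun a m => by
      have hs : q.x a • m = (q.arrowMap M a (q.vertexProj M (q.s a) m) : M) := by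
        rw [coe_arrowMap, coe_vertexProj, q.x_smul_e_src_smul]
      rw [hs, q.glue_coe, ← q.differential_eq_zero_iff.mp hh, coe_arrowMap, ← q.e_smul_glue,
        q.x_smul_e_src_smul])

theorem ofVertexMaps_coe {h : ∀ i, q.vertexSpace M i →ₗ[k] q.vertexSpace N i}
    (hh : q.differential M N h = 0) {i : V} (m : q.vertexSpace M i) :
    q.ofVertexMaps h hh m = h i m :=
  q.glue_coe h m

omit [Module k N] [IsScalarTower k A N] in
theorem linearMap_ext_vertexSpace {f g : M →ₗ[A] N}
    (h : ∀ i (m : q.vertexSpace M i), f m = g m) : f = g := by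
  ext m
  rw [← q.sum_e_smul m, map_sum, map_sum]
  exact Finset.sum_congr rfl fun i _ => h i (q.vertexProj M i m)

theorem differential_injective (h0 : ∀ f : M →ₗ[A] N, f = 0) :
    Function.Injective (q.differential M N) := by
  rw [injective_iff_map_eq_zero]
  intro h hh
  refine funext fun i => LinearMap.ext fun m => Subtype.ext ?_
  rw [← q.ofVertexMaps_coe hh, h0 (q.ofVertexMaps h hh)]
  rfl

variable {q} in
theorem ExtVanish.exists_section (hq : q.ExtVanish M N) {ι : N →ₗ[A] X} {π : X →ₗ[A] M}
    (hι : Function.Injective ι) (hex : Function.Exact ι π) (hπ : Function.Surjective π) :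
    ∃ σ : M →ₗ[A] X, π ∘ₗ σ = LinearMap.id := by
  choose σ hσ using fun i => (q.vertexMap π i).exists_rightInverse_of_surjective
    (LinearMap.range_eq_top.mpr (q.vertexMap_surjective hπ i))
  have hσ' : ∀ i m, q.vertexMap π i (σ i m) = m := fun i m => LinearMap.congr_fun (hσ i) m
  have hφ : ∀ a m, q.differential M X σ a m ∈ LinearMap.range (q.vertexMap ι (q.t a)) :=
    fun a m => (q.vertexMap_exact hex _ _).mp (by
      rw [differential_apply, map_sub, ← arrowMap_vertexMap, hσ', hσ', sub_self])
  obtain ⟨h, hh⟩ := hq fun a => (q.differential M X σ a).codRestrictOfInjective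
    (q.vertexMap ι (q.t a)) (q.vertexMap_injective hι _) (hφ a)
  have hιh : q.differential M X (fun i => σ i - q.vertexMap ι i ∘ₗ h i) = 0 := by
    refine q.differential_eq_zero_iff.mpr fun a m => ?_
    have := congrArg (q.vertexMap ι (q.t a)) (LinearMap.congr_fun (congrFun hh a) m)
    rw [LinearMap.codRestrictOfInjective_comp_apply, differential_apply, differential_apply,
      map_sub, ← arrowMap_vertexMap] at this
    simp only [LinearMap.sub_apply, LinearMap.comp_apply, map_sub]
    rw [sub_eq_sub_iff_sub_eq_sub, this]
  refine ⟨q.ofVertexMaps _ hιh, q.linearMap_ext_vertexSpace fun i m => ?_⟩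
  rw [LinearMap.comp_apply, q.ofVertexMaps_coe, ← coe_vertexMap, LinearMap.sub_apply, map_sub,
    hσ', LinearMap.comp_apply, (q.vertexMap_exact hex i).apply_apply_eq_zero, sub_zero]
  rfl

variable {q} in
theorem ExtVanish.of_injective (hq : q.ExtVanish M N) (f : X →ₗ[A] M)
    (hf : Function.Injective f) : q.ExtVanish X N := by
  intro φ
  choose r hr using fun i => (q.vertexMap f i).exists_leftInverse_of_injective
    (LinearMap.ker_eq_bot.mpr (q.vertexMap_injective hf i))
  obtain ⟨h, hh⟩ := hq fun a => φ a ∘ₗ r (q.s a)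
  refine ⟨fun i => h i ∘ₗ q.vertexMap f i, funext fun a => LinearMap.ext fun m => ?_⟩
  have := LinearMap.congr_fun (congrFun hh a) (q.vertexMap f _ m)
  rw [differential_apply, arrowMap_vertexMap, LinearMap.comp_apply, ← LinearMap.comp_apply (r _),
    hr, LinearMap.id_apply] at this
  exact this

/-- The Euler form of two modules, in terms of their dimension vectors. -/
def euler [Fintype E] (d d' : V → ℕ) : ℤ :=
  ∑ i, (d i * d' i : ℤ) - ∑ a, (d (q.s a) * d' (q.t a) : ℤ)

variable [Fintype E] [Module.Finite k M] [Module.Finite k N]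

theorem euler_dimVec : q.euler (q.dimVec M) (q.dimVec N) =
    (Module.finrank k (∀ i, q.vertexSpace M i →ₗ[k] q.vertexSpace N i) : ℤ) -
      Module.finrank k (∀ a, q.vertexSpace M (q.s a) →ₗ[k] q.vertexSpace N (q.t a)) := by
  simp only [euler, dimVec, Module.finrank_pi_fintype, Module.finrank_linearMap, Nat.cast_sum,
    Nat.cast_mul]

theorem euler_nonpos_of_hom_eq_zero (h0 : ∀ f : M →ₗ[A] N, f = 0) :
    q.euler (q.dimVec M) (q.dimVec N) ≤ 0 := by
  have := LinearMap.finrank_le_finrank_of_injective (q.differential_injective h0)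
  rw [euler_dimVec]
  omega

omit [Module.Finite k N] in
theorem euler_self_pos_of_extVanish [Nontrivial M] (hq : q.ExtVanish M M) :
    0 < q.euler (q.dimVec M) (q.dimVec M) := by
  have hid : q.differential M M (fun _ => LinearMap.id) = 0 :=
    q.differential_eq_zero_iff.mpr fun _ _ => rfl
  have hne : (fun i => LinearMap.id : ∀ i, q.vertexSpace M i →ₗ[k] q.vertexSpace M i) ≠ 0 := by
    intro h
    have h1 : (LinearMap.id : M →ₗ[A] M) = 0 := q.linearMap_ext_vertexSpace fun i m =>
      congrArg Subtype.val (LinearMap.congr_fun (congrFun h i) m)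
    obtain ⟨m, hm⟩ := exists_ne (0 : M)
    exact hm (LinearMap.congr_fun h1 m)
  have hker : 0 < Module.finrank k (LinearMap.ker (q.differential M M)) :=
    Submodule.one_le_finrank_iff.mpr (Submodule.ne_bot_iff _ |>.mpr ⟨_, hid, hne⟩)
  have hrank := LinearMap.finrank_range_add_finrank_ker (q.differential M M)
  rw [LinearMap.range_eq_top.mpr hq, finrank_top] at hrank
  rw [euler_dimVec]
  omega

end Differential

section Extension

variable {M N : FDMod k A}

theorem exists_fdMod_of_quiverRelations {W : Type u} [AddCommGroup W] [Module k W]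
    [Module.Finite k W] {ε : V → Module.End k W} {b : E → Module.End k W}
    (h : QuiverRelations q.s q.t ε b) :
    ∃ (X : FDMod k A) (c : X ≃ₗ[k] W),
      (∀ i y, c (q.e i • y) = ε i (c y)) ∧ ∀ a y, c (q.x a • y) = b a (c y) := by
  obtain ⟨F, hFe, hFx⟩ := q.exists_lift (Module.End k W) ε b h
  obtain ⟨X, c, hc⟩ := FDMod.exists_linearEquiv_of_algHom F (LinearEquiv.refl k W)
  exact ⟨X, c, fun i y => by rw [hc, hFe], fun a y => by rw [hc, hFx]⟩

theorem exists_extension (φ : ∀ a, q.vertexSpace M (q.s a) →ₗ[k] q.vertexSpace N (q.t a)) :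
    ∃ (X : FDMod k A) (c : X ≃ₗ[k] N × M), (∀ i y, c (q.e i • y) = q.e i • c y) ∧
      ∀ a y, c (q.x a • y) =
        q.x a • c y + ((φ a (q.vertexProj M (q.s a) (c y).2) : N), (0 : M)) := by
  refine q.exists_fdMod_of_quiverRelations (ε := fun i => Algebra.lsmul k k (N × M) (q.e i))
    (b := fun a => Algebra.lsmul k k (N × M) (q.x a) + LinearMap.inl k N M ∘ₗ
      (q.vertexSpace N (q.t a)).subtype ∘ₗ φ a ∘ₗ q.vertexProj M (q.s a) ∘ₗ LinearMap.snd k N M)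
    ⟨fun i => ?_, fun i j h => ?_, ?_, fun a => LinearMap.ext fun y => ?_,
      fun a => LinearMap.ext fun y => ?_⟩
  · rw [← map_mul, q.rel.idem]
  · rw [← map_mul, q.rel.orth i j h, map_zero]
  · rw [← map_sum, q.rel.sum_eq_one, map_one]
  · ext <;> simp [smul_add, q.e_tgt_smul_x_smul, q.e_smul_coe]
  · have hs (m : M) : q.vertexProj M (q.s a) (q.e (q.s a) • m) = q.vertexProj M (q.s a) m :=
      Subtype.ext (q.e_smul_e_smul_self _ m)
    ext <;> simp [q.x_smul_e_src_smul, hs]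

theorem extVanish_of_split
    (hs : ∀ (X : FDMod k A) (ι : N →ₗ[A] X) (π : X →ₗ[A] M), Function.Injective ι →
      Function.Exact ι π → Function.Surjective π → ∃ σ : M →ₗ[A] X, π ∘ₗ σ = LinearMap.id) :
    q.ExtVanish M N := by
  intro φ
  obtain ⟨X, c, hce, hcx⟩ := q.exists_extension φ
  let ι : N →ₗ[A] X := q.toLinearMap (c.symm.toLinearMap ∘ₗ LinearMap.inl k N M)
    (fun i n => c.injective (by simp [hce])) (fun a n => c.injective (by simp [hcx]))
  let π : X →ₗ[A] M := q.toLinearMap (LinearMap.snd k N M ∘ₗ c.toLinearMap)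
    (fun i y => by simp [hce]) (fun a y => by simp [hcx])
  have hι : Function.Injective ι := c.symm.injective.comp LinearMap.inl_injective
  have hπ : Function.Surjective π := Prod.snd_surjective.comp c.surjective
  have hex : Function.Exact ι π := fun y =>
    ⟨fun hy => ⟨(c y).1, c.symm_apply_eq.mpr (Prod.ext rfl (Eq.symm hy))⟩, by
      rintro ⟨n, rfl⟩
      exact congrArg Prod.snd (c.apply_symm_apply (n, 0))⟩
  obtain ⟨σ, hσ⟩ := hs X ι π hι hex hπ
  have hσ' (m : M) : (c (σ m)).2 = m := LinearMap.congr_fun hσ m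
  let g (i : V) : q.vertexSpace M i →ₗ[k] q.vertexSpace N i := q.vertexProj N i ∘ₗ
    LinearMap.fst k N M ∘ₗ c.toLinearMap ∘ₗ σ.restrictScalars k ∘ₗ (q.vertexSpace M i).subtype
  refine ⟨-g, funext fun a => LinearMap.ext fun m => Subtype.ext ?_⟩
  simp [differential_apply, g, hcx, hσ', q.x_smul_e_src_smul, q.e_tgt_smul_x_smul]

theorem extVanish_of_projective (M N : FDMod k A) [Module.Projective A M] : q.ExtVanish M N :=
  q.extVanish_of_split fun _ _ π _ _ hπ =>
    Module.projective_lifting_property π LinearMap.id hπ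

variable [Module.Finite k A]

theorem projective_of_extVanish (h : ∀ N : FDMod k A, q.ExtVanish M N) :
    Module.Projective A M := by
  have := Module.Finite.of_restrictScalars_finite k A M
  obtain ⟨n, f, hf⟩ := Module.Finite.exists_fin' A M
  let X : FDMod k A := { carrier := Fin n → A }
  obtain ⟨σ, hσ⟩ := (h (FDMod.ofSub (X := X) (LinearMap.ker f))).exists_section (X := X)
    (ι := (LinearMap.ker f).subtype) (π := f) Subtype.val_injective
    (LinearMap.exact_subtype_ker_map f) hf
  exact Module.Projective.of_split σ f hσ

include q in
theorem projective_of_injective {P : FDMod k A} [Module.Projective A P] (f : M →ₗ[A] P)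
    (hf : Function.Injective f) : Module.Projective A M :=
  q.projective_of_extVanish fun N => (q.extVanish_of_projective P N).of_injective f hf

end Extension

end QuiverPresentation
/-! ### Duality between left and right modules -/

/-- A perfect pairing between a module over `A` and a module over `B` for which the action of `a`
is adjoint to that of `σ a`. For `B = Aᵐᵒᵖ` this identifies each of the two modules with the
`k`-dual of the other one. -/
structure DualPair (k : Type*) [Field k] {A B : Type*} [Ring A] [Ring B] (σ : A ≃ B)
    (M N : Type*) [AddCommGroup M] [Module A M] [Module k M] [AddCommGroup N] [Module B N]
    [Module k N] where
  pair : M →ₗ[k] N →ₗ[k] k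
  perf : pair.IsPerfPair
  smul : ∀ a m n, pair (a • m) n = pair m (σ a • n)

namespace DualPair

attribute [instance] perf

variable {k : Type*} [Field k] {A B : Type*} [Ring A] [Ring B] {σ : A ≃ B}
  {M N : Type*} [AddCommGroup M] [Module A M] [Module k M] [AddCommGroup N] [Module B N]
  [Module k N]
  {M' N' : Type*} [AddCommGroup M'] [Module A M'] [Module k M'] [AddCommGroup N'] [Module B N']
  [Module k N']
  {M'' N'' : Type*} [AddCommGroup M''] [Module A M''] [Module k M''] [AddCommGroup N'']
  [Module B N''] [Module k N'']

/-- The pairing with the two sides interchanged. -/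
def symm (D : DualPair k σ M N) : DualPair k σ.symm N M where
  pair := D.pair.flip
  perf := D.perf.flip
  smul b n m := by
    rw [LinearMap.flip_apply, LinearMap.flip_apply, D.smul, Equiv.apply_symm_apply]

theorem ext_left (D : DualPair k σ M N) {m m' : M} (h : ∀ n, D.pair m n = D.pair m' n) :
    m = m' :=
  D.perf.bijective_left.1 (LinearMap.ext h)

theorem ext_right (D : DualPair k σ M N) {n n' : N} (h : ∀ m, D.pair m n = D.pair m n') :
    n = n' :=
  D.symm.ext_left h

theorem subsingleton_right (D : DualPair k σ M N) [Subsingleton M] : Subsingleton N :=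
  ⟨fun n n' => D.ext_right fun m => by rw [Subsingleton.elim m 0, map_zero]; rfl⟩

theorem nontrivial_right (D : DualPair k σ M N) [Nontrivial M] : Nontrivial N :=
  not_subsingleton_iff_nontrivial.mp fun _ =>
    have := D.symm.subsingleton_right
    false_of_nontrivial_of_subsingleton M

section Transpose

variable [Algebra k A] [IsScalarTower k A M] [IsScalarTower k A M'] [IsScalarTower k A M'']

/-- The transpose of a linear map. -/
noncomputable def transpose (D : DualPair k σ M N) (D' : DualPair k σ M' N') (f : M →ₗ[A] M') :
    N' →ₗ[B] N where
  toFun n := D.pair.flip.toPerfPair.symm (D'.pair.flip n ∘ₗ f.restrictScalars k)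
  map_add' n n' := by rw [map_add, LinearMap.add_comp, map_add]
  map_smul' b n := D.ext_right fun m => by
    obtain ⟨a, rfl⟩ := σ.surjective b
    simp [← D.smul, ← D'.smul]

variable (D : DualPair k σ M N) (D' : DualPair k σ M' N') (D'' : DualPair k σ M'' N'')

@[simp] theorem pair_transpose (f : M →ₗ[A] M') (m : M) (n : N') :
    D.pair m (D.transpose D' f n) = D'.pair (f m) n :=
  D.pair.apply_toPerfPair_flip (D'.pair.flip n ∘ₗ f.restrictScalars k) m

@[simp] theorem transpose_id : D.transpose D LinearMap.id = LinearMap.id :=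
  LinearMap.ext fun n => D.ext_right fun m => by simp

@[simp] theorem transpose_zero : D.transpose D' 0 = 0 :=
  LinearMap.ext fun n => D.ext_right fun m => by simp

theorem transpose_comp (g : M' →ₗ[A] M'') (f : M →ₗ[A] M') :
    D.transpose D'' (g ∘ₗ f) = D.transpose D' f ∘ₗ D'.transpose D'' g :=
  LinearMap.ext fun n => D.ext_right fun m => by simp

theorem transpose_bijective {f : M →ₗ[A] M'} (hf : Function.Bijective f) :
    Function.Bijective (D.transpose D' f) := by
  let e := LinearEquiv.ofBijective f hf
  refine Function.bijective_iff_has_inverse.mpr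
    ⟨D'.transpose D e.symm.toLinearMap, fun n => D'.ext_right fun m => ?_,
      fun n => D.ext_right fun m => ?_⟩
  · rw [D'.pair_transpose, D.pair_transpose]
    exact congrArg (D'.pair · n) (e.apply_symm_apply m)
  · rw [D.pair_transpose, D'.pair_transpose]
    exact congrArg (D.pair · n) (e.symm_apply_apply m)

variable [Algebra k B] [IsScalarTower k B N] [IsScalarTower k B N']

theorem transpose_symm_transpose (f : M →ₗ[A] M') :
    D'.symm.transpose D.symm (D.transpose D' f) = f :=
  LinearMap.ext fun m => D'.ext_left fun n =>
    (D'.symm.pair_transpose D.symm (D.transpose D' f) n m).trans (D.pair_transpose D' f m n)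

theorem transpose_injective : Function.Injective (D.transpose D') := fun f g h => by
  rw [← D.transpose_symm_transpose D' f, h, D.transpose_symm_transpose]

end Transpose

end DualPair

namespace FDMod

variable {k : Type v} [Field k] {A B : Type u} [Ring A] [Algebra k A] [Ring B] [Algebra k B]

theorem exists_dualPair_of_algEquiv (σ : A ≃ₐ[k] Bᵐᵒᵖ) (N : Type u) [AddCommGroup N] [Module B N]
    [Module k N] [IsScalarTower k B N] [Module.Finite k N] :
    ∃ M : FDMod k A, Nonempty (DualPair k (σ.toEquiv.trans opEquiv.symm) M N) := by
  let F : A →ₐ[k] Module.End k (Module.Dual k N) :=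
    { toFun := fun a => (Algebra.lsmul k k N (unop (σ a))).dualMap
      map_one' := by ext; simp
      map_mul' := fun a b => by ext; simp
      map_zero' := by ext; simp
      map_add' := fun a b => by ext; simp
      commutes' := fun c => by ext; simp }
  obtain ⟨M, c, hc⟩ := FDMod.exists_linearEquiv_of_algHom F
    (LinearEquiv.ofFinrankEq N (Module.Dual k N) Subspace.dual_finrank_eq.symm)
  refine ⟨M, ⟨c.toLinearMap, inferInstance, fun a m n => ?_⟩⟩
  rw [LinearEquiv.coe_coe, hc]
  rfl

theorem exists_dualPair_left (N : Type u) [AddCommGroup N] [Module Aᵐᵒᵖ N] [Module k N]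
    [IsScalarTower k Aᵐᵒᵖ N] [Module.Finite k N] :
    ∃ M : FDMod k A, Nonempty (DualPair k (opEquiv (α := A)) M N) :=
  exists_dualPair_of_algEquiv (AlgEquiv.opOp k A) N

theorem exists_dualPair_right (M : Type u) [AddCommGroup M] [Module A M] [Module k M]
    [IsScalarTower k A M] [Module.Finite k M] :
    ∃ N : FDMod k Aᵐᵒᵖ, Nonempty (DualPair k (opEquiv (α := A)) M N) :=
  have ⟨N, ⟨D⟩⟩ := exists_dualPair_of_algEquiv (AlgEquiv.refl (R := k) (A₁ := Aᵐᵒᵖ)) M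
  ⟨N, ⟨D.symm⟩⟩

end FDMod
/-! ### Maps into finitely generated projective modules -/

theorem exists_comp_eq_of_injective {A W N X : Type*} [Ring A] [AddCommGroup W] [Module A W]
    [AddCommGroup N] [Module A N] [AddCommGroup X] [Module A X] {i : N →ₗ[A] X}
    (hi : Function.Injective i) {h : W →ₗ[A] X} (hh : ∀ x, h x ∈ LinearMap.range i) :
    ∃ l : W →ₗ[A] N, i ∘ₗ l = h :=
  ⟨(LinearEquiv.ofInjective i hi).symm.toLinearMap ∘ₗ h.codRestrict (LinearMap.range i) hh,
    LinearMap.ext fun x => congrArg Subtype.val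
      ((LinearEquiv.ofInjective i hi).apply_symm_apply ⟨h x, hh x⟩)⟩

section DualBasis

variable {A P W W' : Type*} [Ring A] [AddCommGroup P] [Module A P] [AddCommGroup W] [Module A W]
  [AddCommGroup W'] [Module A W']

variable (A P) in
theorem exists_dualBasis_of_projective [Module.Finite A P] [Module.Projective A P] :
    ∃ (n : ℕ) (r : Fin n → P) (g : Fin n → P →ₗ[A] A), ∀ p, ∑ i, g i p • r i = p := by
  obtain ⟨n, f, σ, -, -, hσ⟩ := Module.Finite.exists_comp_eq_id_of_projective A P
  refine ⟨n, fun i => f (Pi.single i 1), fun i => LinearMap.proj i ∘ₗ σ, fun p => ?_⟩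
  conv_rhs => rw [← LinearMap.id_apply (R := A) p, ← hσ, LinearMap.comp_apply,
    pi_eq_sum_univ' (σ p), map_sum]
  exact Finset.sum_congr rfl fun i _ => (map_smul f _ _).symm

variable [Module.Finite A P] [Module.Projective A P]

theorem exists_comp_eq_of_forall_dual {f : W →ₗ[A] W'} {α : W →ₗ[A] P}
    (h : ∀ g : P →ₗ[A] A, ∃ w : W' →ₗ[A] A, w ∘ₗ f = g ∘ₗ α) :
    ∃ s : W' →ₗ[A] P, s ∘ₗ f = α := by
  obtain ⟨n, r, g, hg⟩ := exists_dualBasis_of_projective A P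
  choose w hw using fun i => h (g i)
  refine ⟨∑ i, (w i).smulRight (r i), LinearMap.ext fun x => ?_⟩
  rw [← hg (α x), LinearMap.comp_apply, LinearMap.sum_apply]
  exact Finset.sum_congr rfl fun i _ => congrArg (· • r i) (LinearMap.congr_fun (hw i) x)

theorem exists_dual_hom_eq_comp {T : Type*} [AddCommGroup T] [Module Aᵐᵒᵖ T]
    {π : (W →ₗ[A] A) →ₗ[Aᵐᵒᵖ] T} (hπ : Function.Surjective π) (Φ : (P →ₗ[A] A) →ₗ[Aᵐᵒᵖ] T) :
    ∃ α : W →ₗ[A] P, ∀ h, Φ h = π (h ∘ₗ α) := by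
  obtain ⟨n, r, g, hg⟩ := exists_dualBasis_of_projective A P
  choose v hv using fun i => hπ (Φ (g i))
  refine ⟨∑ i, (v i).smulRight (r i), fun h => ?_⟩
  have hΦ : h = ∑ i, op (h (r i)) • g i := LinearMap.ext fun x => by
    conv_lhs => rw [← hg x]
    simp
  have hπ : h ∘ₗ ∑ i, (v i).smulRight (r i) = ∑ i, op (h (r i)) • v i :=
    LinearMap.ext fun x => by simp
  rw [hπ, map_sum]
  conv_lhs => rw [hΦ, map_sum]
  exact Finset.sum_congr rfl fun i _ => by rw [map_smul, map_smul, hv]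

end DualBasis

/-! ### Indecomposable modules -/

namespace FDMod

variable {k : Type v} [Field k] {A : Type u} [Ring A] [Algebra k A]

theorem IsIndecomposable.eq_zero_or_eq_id {M : FDMod k A} (hM : M.IsIndecomposable)
    {f : M →ₗ[A] M} (hf : f ∘ₗ f = f) : f = 0 ∨ f = LinearMap.id := by
  have hid : IsIdempotentElem f := hf
  rcases hM.2 _ _ (LinearMap.IsIdempotentElem.isCompl hid) with h | h
  · exact Or.inl (LinearMap.range_eq_bot.mp h)
  · exact Or.inr (LinearMap.ext fun m => LinearMap.ker_eq_bot.mp h (LinearMap.congr_fun hf m))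

theorem isIndecomposable_of_idempotent {M : FDMod k A} [Nontrivial M]
    (h : ∀ f : M →ₗ[A] M, f ∘ₗ f = f → f = 0 ∨ f = LinearMap.id) : M.IsIndecomposable := by
  refine ⟨inferInstance, fun U W hUW => ?_⟩
  rcases h (U.projection W hUW) (LinearMap.ext fun m =>
    Submodule.projection_apply_of_mem_left hUW (Submodule.projection_apply_mem hUW m)) with h | h
  · exact Or.inl (by rw [← Submodule.range_projection hUW, h, LinearMap.range_zero])
  · exact Or.inr (by rw [← Submodule.ker_projection hUW, h, LinearMap.ker_id])

theorem IsIndecomposable.injective_of_section {M : FDMod k A} (hM : M.IsIndecomposable)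
    {N : Type*} [AddCommGroup N] [Module A N] [Nontrivial N] {π : M →ₗ[A] N} {σ : N →ₗ[A] M}
    (h : π ∘ₗ σ = LinearMap.id) : Function.Injective π := by
  have hid : (σ ∘ₗ π) ∘ₗ (σ ∘ₗ π) = σ ∘ₗ π := by
    rw [LinearMap.comp_assoc, ← LinearMap.comp_assoc π, h, LinearMap.id_comp]
  rcases hM.eq_zero_or_eq_id hid with h0 | h0
  · obtain ⟨n, hn⟩ := exists_ne (0 : N)
    refine absurd ?_ hn
    calc n = (π ∘ₗ (σ ∘ₗ π) ∘ₗ σ) n := by rw [LinearMap.comp_assoc, h, LinearMap.comp_id, h]; rfl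
      _ = 0 := by rw [h0, LinearMap.zero_comp, LinearMap.comp_zero, LinearMap.zero_apply]
  · exact Function.LeftInverse.injective (g := σ) fun m => LinearMap.congr_fun h0 m

theorem IsIndecomposable.congr {M N : FDMod k A} (hM : M.IsIndecomposable) (e : M ≃ₗ[A] N) :
    N.IsIndecomposable := by
  have := hM.1
  have : Nontrivial N := e.symm.toEquiv.nontrivial
  refine isIndecomposable_of_idempotent fun f hf => ?_
  have hid : (e.symm.toLinearMap ∘ₗ f ∘ₗ e.toLinearMap) ∘ₗ e.symm.toLinearMap ∘ₗ f ∘ₗ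
      e.toLinearMap = e.symm.toLinearMap ∘ₗ f ∘ₗ e.toLinearMap :=
    LinearMap.ext fun m => by simpa using LinearMap.congr_fun hf (e m)
  refine (hM.eq_zero_or_eq_id hid).imp (fun h => LinearMap.ext fun n => ?_)
    fun h => LinearMap.ext fun n => ?_ <;>
  simpa using congrArg e (LinearMap.congr_fun h (e.symm n))

theorem IsIndecomposable.injective_of_projective [Module.Finite k A] {V E : Type*} [Fintype V]
    (q : QuiverPresentation k A V E) {M P : FDMod k A} (hM : M.IsIndecomposable)
    [Module.Projective A P] {f : M →ₗ[A] P} (hf : f ≠ 0) :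
    Function.Injective f := by
  have : Module.Projective A (LinearMap.range f) :=
    q.projective_of_injective (M := FDMod.ofSub (LinearMap.range f)) (P := P)
      (LinearMap.range f).subtype Subtype.val_injective
  obtain ⟨σ, hσ⟩ := Module.projective_lifting_property f.rangeRestrict LinearMap.id
    f.surjective_rangeRestrict
  have : Nontrivial (LinearMap.range f) :=
    Submodule.nontrivial_iff_ne_bot.mpr (mt LinearMap.range_eq_bot.mp hf)
  exact fun x y h => hM.injective_of_section hσ (Subtype.ext h)

theorem IsIndecomposable.hom_projective_eq_zero [Module.Finite k A] {V E : Type*} [Fintype V]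
    (q : QuiverPresentation k A V E) {M P : FDMod k A} (hM : M.IsIndecomposable)
    (hproj : ¬ Module.Projective A M) [Module.Projective A P] (f : M →ₗ[A] P) : f = 0 :=
  by_contra fun hf => hproj (q.projective_of_injective f (hM.injective_of_projective q hf))

/-! ### Projective resolutions and the Auslander-Reiten translate -/

instance finite_dual [Module.Finite k A] (P : FDMod k A) : Module.Finite k (P →ₗ[A] A) :=
  Module.Finite.of_injective (LinearMap.restrictScalarsₗ k A P A k)
    (LinearMap.restrictScalars_injective k)

/-- A projective resolution `0 → P₁ → P₀ → M → 0` by finite-dimensional modules. -/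
structure Resolution (M : FDMod k A) where
  P₁ : FDMod k A
  P₀ : FDMod k A
  f : P₁ →ₗ[A] P₀
  p : P₀ →ₗ[A] M
  proj₁ : Module.Projective A P₁
  proj₀ : Module.Projective A P₀
  inj : Function.Injective f
  exact : Function.Exact f p
  surj : Function.Surjective p

attribute [instance] Resolution.proj₁ Resolution.proj₀

theorem nonempty_resolution [Module.Finite k A] {V E : Type*} [Fintype V]
    (q : QuiverPresentation k A V E) (M : FDMod k A) : Nonempty M.Resolution := by
  have := Module.Finite.of_restrictScalars_finite k A M
  obtain ⟨n, f, hf⟩ := Module.Finite.exists_fin' A M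
  let X : FDMod k A := { carrier := Fin n → A }
  have hX : Module.Projective A X := inferInstanceAs (Module.Projective A (Fin n → A))
  let K : FDMod k A := FDMod.ofSub (X := X) (LinearMap.ker f)
  let ι : K →ₗ[A] X := (LinearMap.ker f).subtype
  exact ⟨⟨K, X, ι, f, q.projective_of_injective ι Subtype.val_injective, hX,
    Subtype.val_injective, LinearMap.exact_subtype_ker_map f, hf⟩⟩

namespace Resolution

variable {X M Z : FDMod k A} (R : X.Resolution) (R' : M.Resolution) {R'' : Z.Resolution}

/-- A perfect pairing between `T` and `Ext¹(X, A)`, exhibiting `T` as the Auslander-Reiten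
translate of `X`. -/
abbrev TranslatePairing (T : FDMod k A) :=
  DualPair k (opEquiv (α := A)) T (ExtOne R.f)

/-- The class in `Ext¹(X, A)` of a map `P₁ → A`. -/
def extMk : (R.P₁ →ₗ[A] A) →ₗ[Aᵐᵒᵖ] ExtOne R.f := (LinearMap.range (homDual R.f)).mkQ

theorem extMk_surjective : Function.Surjective R.extMk := Submodule.mkQ_surjective _

theorem extMk_eq_zero {g : R.P₁ →ₗ[A] A} : R.extMk g = 0 ↔ ∃ h : R.P₀ →ₗ[A] A, h ∘ₗ R.f = g :=
  Submodule.Quotient.mk_eq_zero _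

@[simp] theorem p_f (x : R.P₁) : R.p (R.f x) = 0 := R.exact.apply_apply_eq_zero x

theorem exists_lift {W : Type*} [AddCommGroup W] [Module A W] (h : W →ₗ[A] R.P₀)
    (hh : ∀ x, R.p (h x) = 0) : ∃ l : W →ₗ[A] R.P₁, ∀ x, R.f (l x) = h x := by
  obtain ⟨l, rfl⟩ := exists_comp_eq_of_injective R.inj fun x => (R.exact (h x)).mp (hh x)
  exact ⟨l, fun x => rfl⟩

theorem exists_desc {W : Type*} [AddCommGroup W] [Module A W] (h : R.P₀ →ₗ[A] W)
    (hh : ∀ x, h (R.f x) = 0) : ∃ l : X →ₗ[A] W, ∀ x, l (R.p x) = h x := by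
  have hk : LinearMap.ker R.p ≤ LinearMap.ker h := fun y hy => by
    obtain ⟨x, rfl⟩ := (R.exact y).mp hy
    exact hh x
  exact ⟨(LinearMap.ker R.p).liftQ h hk ∘ₗ
    (R.p.quotKerEquivOfSurjective R.surj).symm.toLinearMap, fun x => by simp⟩

/-- `φ` is the map `Ext¹(β, A)`. -/
def Induces (β : X →ₗ[A] M) (φ : ExtOne R'.f →ₗ[Aᵐᵒᵖ] ExtOne R.f) : Prop :=
  ∃ (α₁ : R.P₁ →ₗ[A] R'.P₁) (α₀ : R.P₀ →ₗ[A] R'.P₀), (∀ x, α₀ (R.f x) = R'.f (α₁ x)) ∧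
    (∀ x, R'.p (α₀ x) = β (R.p x)) ∧ ∀ g, φ (R'.extMk g) = R.extMk (g ∘ₗ α₁)

theorem exists_induces (β : X →ₗ[A] M) : ∃ φ, R.Induces R' β φ := by
  obtain ⟨α₀, hα₀⟩ := Module.projective_lifting_property R'.p (β ∘ₗ R.p) R'.surj
  have hα₀' : ∀ x, R'.p (α₀ x) = β (R.p x) := fun x => LinearMap.congr_fun hα₀ x
  obtain ⟨α₁, hα₁⟩ := R'.exists_lift (α₀ ∘ₗ R.f) fun x => by simp [hα₀']
  refine ⟨Submodule.mapQ _ _ (homDual α₁) ?_, α₁, α₀, fun x => (hα₁ x).symm, hα₀', fun g => rfl⟩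
  rintro _ ⟨g, rfl⟩
  exact ⟨g ∘ₗ α₀, LinearMap.ext fun x => congrArg g (hα₁ x).symm⟩

theorem exists_induces_of_ext (φ : ExtOne R'.f →ₗ[Aᵐᵒᵖ] ExtOne R.f) :
    ∃ β, R.Induces R' β φ := by
  have := Module.Finite.of_restrictScalars_finite k A R'.P₁
  have := Module.Finite.of_restrictScalars_finite k A R'.P₀
  obtain ⟨α₁, hα₁⟩ := exists_dual_hom_eq_comp R.extMk_surjective (φ ∘ₗ R'.extMk)
  obtain ⟨α₀, hα₀⟩ : ∃ α₀, α₀ ∘ₗ R.f = R'.f ∘ₗ α₁ := by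
    refine exists_comp_eq_of_forall_dual fun g => R.extMk_eq_zero.mp ?_
    rw [← LinearMap.comp_assoc, ← hα₁, LinearMap.comp_apply, R'.extMk_eq_zero.mpr ⟨g, rfl⟩,
      map_zero]
  have hα₀' : ∀ x, α₀ (R.f x) = R'.f (α₁ x) := LinearMap.congr_fun hα₀
  obtain ⟨β, hβ⟩ := R.exists_desc (R'.p ∘ₗ α₀) fun x => by simp [hα₀']
  exact ⟨β, α₁, α₀, hα₀', fun x => (hβ x).symm, hα₁⟩

variable {R R'}

theorem Induces.eq_zero {β : X →ₗ[A] M} (h : R.Induces R' β 0)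
    (hX : ∀ f : X →ₗ[A] R'.P₀, f = 0) : β = 0 := by
  have := Module.Finite.of_restrictScalars_finite k A R'.P₁
  obtain ⟨α₁, α₀, h1, h2, h3⟩ := h
  obtain ⟨s, hs⟩ : ∃ s, s ∘ₗ R.f = α₁ :=
    exists_comp_eq_of_forall_dual fun g => R.extMk_eq_zero.mp (h3 g).symm
  obtain ⟨γ, hγ⟩ := R.exists_desc (α₀ - R'.f ∘ₗ s) fun x => by simp [h1, ← hs]
  refine LinearMap.ext fun y => ?_
  obtain ⟨x, rfl⟩ := R.surj y
  have hα₀ : α₀ x = R'.f (s x) := sub_eq_zero.mp ((hγ x).symm.trans (by rw [hX γ]; rfl))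
  rw [← h2, hα₀, R'.p_f, LinearMap.zero_apply]

theorem Induces.ext_eq_zero {φ : ExtOne R'.f →ₗ[Aᵐᵒᵖ] ExtOne R.f} (h : R.Induces R' 0 φ) :
    φ = 0 := by
  obtain ⟨α₁, α₀, h1, h2, h3⟩ := h
  obtain ⟨l, hl⟩ := R'.exists_lift α₀ fun x => by simp [h2]
  refine LinearMap.ext fun z => ?_
  obtain ⟨g, rfl⟩ := R'.extMk_surjective z
  rw [h3, LinearMap.zero_apply, R.extMk_eq_zero]
  refine ⟨g ∘ₗ l, LinearMap.ext fun x => congrArg g (R'.inj ?_)⟩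
  rw [hl, h1]

theorem Induces.comp {β : X →ₗ[A] M} {φ : ExtOne R'.f →ₗ[Aᵐᵒᵖ] ExtOne R.f}
    {γ : M →ₗ[A] Z} {ψ : ExtOne R''.f →ₗ[Aᵐᵒᵖ] ExtOne R'.f}
    (h : R.Induces R' β φ) (h' : R'.Induces R'' γ ψ) : R.Induces R'' (γ ∘ₗ β) (φ ∘ₗ ψ) := by
  obtain ⟨α₁, α₀, h1, h2, h3⟩ := h
  obtain ⟨α₁', α₀', h1', h2', h3'⟩ := h'
  exact ⟨α₁' ∘ₗ α₁, α₀' ∘ₗ α₀, fun x => by simp [h1, h1'], fun x => by simp [h2, h2'],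
    fun g => by simp [h3, h3', LinearMap.comp_assoc]⟩

theorem Induces.sub {β β' : X →ₗ[A] M} {φ φ' : ExtOne R'.f →ₗ[Aᵐᵒᵖ] ExtOne R.f}
    (h : R.Induces R' β φ) (h' : R.Induces R' β' φ') : R.Induces R' (β - β') (φ - φ') := by
  obtain ⟨α₁, α₀, h1, h2, h3⟩ := h
  obtain ⟨α₁', α₀', h1', h2', h3'⟩ := h'
  exact ⟨α₁ - α₁', α₀ - α₀', fun x => by simp [h1, h1'], fun x => by simp [h2, h2'],
    fun g => by simp [h3, h3', LinearMap.comp_sub]⟩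

theorem induces_id : R.Induces R LinearMap.id LinearMap.id :=
  ⟨LinearMap.id, LinearMap.id, fun _ => rfl, fun _ => rfl, fun _ => rfl⟩

theorem Induces.bijective {β : X →ₗ[A] M}
    {φ : ExtOne R'.f →ₗ[Aᵐᵒᵖ] ExtOne R.f} (h : R.Induces R' β φ) (hφ : Function.Bijective φ)
    (hX : ∀ f : X →ₗ[A] R.P₀, f = 0) (hM : ∀ f : M →ₗ[A] R'.P₀, f = 0) :
    Function.Bijective β := by
  let e := LinearEquiv.ofBijective φ hφ
  obtain ⟨γ, hγ⟩ := R'.exists_induces_of_ext R e.symm.toLinearMap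
  have hγβ : γ ∘ₗ β = LinearMap.id := by
    have hsub := (h.comp hγ).sub R.induces_id
    rw [show φ ∘ₗ e.symm.toLinearMap = LinearMap.id from LinearMap.ext e.apply_symm_apply,
      sub_self] at hsub
    exact sub_eq_zero.mp (hsub.eq_zero hX)
  have hβγ : β ∘ₗ γ = LinearMap.id := by
    have hsub := (hγ.comp h).sub R'.induces_id
    rw [show e.symm.toLinearMap ∘ₗ φ = LinearMap.id from LinearMap.ext e.symm_apply_apply,
      sub_self] at hsub
    exact sub_eq_zero.mp (hsub.eq_zero hM)
  exact Function.bijective_iff_has_inverse.mpr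
    ⟨γ, fun x => LinearMap.congr_fun hγβ x, fun x => LinearMap.congr_fun hβγ x⟩

theorem TranslatePairing.not_projective {T : FDMod k A} [Nontrivial T]
    (D : R.TranslatePairing T) : ¬ Module.Projective A X := by
  intro hX
  obtain ⟨σ, hσ⟩ := Module.projective_lifting_property R.p LinearMap.id R.surj
  have hσ' : ∀ m, R.p (σ m) = m := fun m => LinearMap.congr_fun hσ m
  obtain ⟨l, hl⟩ := R.exists_lift (LinearMap.id - σ ∘ₗ R.p) fun x => by simp [hσ']
  have : Subsingleton (ExtOne R.f) := by
    refine subsingleton_of_forall_eq 0 fun z => ?_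
    obtain ⟨g, rfl⟩ := R.extMk_surjective z
    rw [R.extMk_eq_zero]
    refine ⟨g ∘ₗ l, LinearMap.ext fun x => congrArg g (R.inj ?_)⟩
    simp [hl]
  exact not_subsingleton T D.symm.subsingleton_right

theorem TranslatePairing.isIndecomposable {T : FDMod k A}
    (D : R.TranslatePairing T) (hX : X.IsIndecomposable) (h0 : ∀ f : X →ₗ[A] R.P₀, f = 0) :
    T.IsIndecomposable := by
  have := hX.1
  have : Nontrivial T := by
    rw [← not_subsingleton_iff_nontrivial]
    intro _
    have := D.subsingleton_right
    have hid : R.Induces R LinearMap.id 0 := by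
      convert R.induces_id
      exact Subsingleton.elim _ _
    obtain ⟨x, hx⟩ := exists_ne (0 : X)
    exact hx (LinearMap.congr_fun (hid.eq_zero h0) x)
  refine isIndecomposable_of_idempotent fun f hf => ?_
  let φ := D.transpose D f
  have hφ : φ ∘ₗ φ = φ := by rw [← DualPair.transpose_comp, hf]
  obtain ⟨β, hβ⟩ := R.exists_induces_of_ext R φ
  have hββ : β ∘ₗ β = β := by
    have := (hβ.comp hβ).sub hβ
    rw [hφ, sub_self] at this
    exact sub_eq_zero.mp (this.eq_zero h0)
  rcases hX.eq_zero_or_eq_id hββ with rfl | rfl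
  · exact Or.inl (D.transpose_injective D (hβ.ext_eq_zero.trans (D.transpose_zero D).symm))
  · have h := hβ.sub R.induces_id
    rw [sub_self] at h
    exact Or.inr (D.transpose_injective D
      ((sub_eq_zero.mp h.ext_eq_zero).trans D.transpose_id.symm))

theorem TranslatePairing.exists_hom_of_ne_zero {T L : FDMod k A}
    (D : R.TranslatePairing T) (D' : R'.TranslatePairing L) {f : X →ₗ[A] M} (hf : f ≠ 0)
    (hX : ∀ (P : FDMod k A) [Module.Projective A P] (g : X →ₗ[A] P), g = 0)
    (hM : ∀ g : M →ₗ[A] R'.P₀, g = 0) :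
    ∃ g : T →ₗ[A] L, g ≠ 0 ∧ (Function.Bijective g → Function.Bijective f) := by
  obtain ⟨φ, hφ⟩ := R.exists_induces R' f
  obtain ⟨g, rfl⟩ : ∃ g, D.transpose D' g = φ :=
    ⟨D'.symm.transpose D.symm φ, D'.symm.transpose_symm_transpose D.symm φ⟩
  refine ⟨g, ?_, fun hg => hφ.bijective (D.transpose_bijective D' hg) (hX _) hM⟩
  rintro rfl
  rw [D.transpose_zero] at hφ
  exact hf (hφ.eq_zero (hX _))

theorem extVanish {V E : Type*} [Fintype V] (q : QuiverPresentation k A V E)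
    {Y : FDMod k A} (h : ∀ g : R.P₁ →ₗ[A] Y, ∃ g' : R.P₀ →ₗ[A] Y, g' ∘ₗ R.f = g) :
    q.ExtVanish X Y := by
  refine q.extVanish_of_split fun W ι π hι hex hπ => ?_
  obtain ⟨s, hs⟩ := Module.projective_lifting_property π R.p hπ
  have hs' : ∀ x, π (s x) = R.p x := fun x => LinearMap.congr_fun hs x
  obtain ⟨g₁, hg₁⟩ := exists_comp_eq_of_injective hι (h := s ∘ₗ R.f)
    fun x => (hex _).mp (by simp [hs'])
  obtain ⟨g, rfl⟩ := h g₁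
  obtain ⟨σ, hσ⟩ := R.exists_desc (s - ι ∘ₗ g) fun x =>
    sub_eq_zero.mpr (LinearMap.congr_fun hg₁ x).symm
  refine ⟨σ, LinearMap.ext fun y => ?_⟩
  obtain ⟨x, rfl⟩ := R.surj y
  simp [hσ, hs', hex.apply_apply_eq_zero]

variable {T Y : FDMod k A}

theorem TranslatePairing.exists_hom (D : R.TranslatePairing T) (l : (R.P₁ →ₗ[A] Y) →ₗ[k] k)
    (hl : ∀ g : R.P₀ →ₗ[A] Y, l (g ∘ₗ R.f) = 0) :
    ∃ φ : Y →ₗ[A] T, ∀ y g, D.pair (φ y) (R.extMk g) = l (g.smulRight y) := by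
  let B (y : Y) : (R.P₁ →ₗ[A] A) →ₗ[k] k := l ∘ₗ
    { toFun := fun g => g.smulRight y
      map_add' := fun g g' => LinearMap.ext fun x => by simp [add_smul]
      map_smul' := fun c g => LinearMap.ext fun x => by simp }
  have hB (y : Y) : (LinearMap.range (homDual R.f)).restrictScalars k ≤ LinearMap.ker (B y) := by
    rintro _ ⟨g, rfl⟩
    exact hl (g.smulRight y)
  let t (y : Y) : T := D.pair.toPerfPair.symm
    (((LinearMap.range (homDual R.f)).restrictScalars k).liftQ (B y) (hB y))
  have ht (y : Y) (g : R.P₁ →ₗ[A] A) : D.pair (t y) (R.extMk g) = l (g.smulRight y) :=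
    LinearMap.congr_fun (D.pair.apply_symm_toPerfPair_self _) (R.extMk g)
  refine ⟨{ toFun := t, map_add' := fun y y' => D.ext_left fun z => ?_,
            map_smul' := fun a y => D.ext_left fun z => ?_ }, ht⟩ <;>
    obtain ⟨g, rfl⟩ := R.extMk_surjective z
  · rw [map_add, LinearMap.add_apply, ht, ht, ht, ← map_add]
    congr 1
    exact LinearMap.ext fun x => by simp
  · rw [RingHom.id_apply, D.smul, ht, opEquiv_apply, ← map_smul, ht]
    congr 1
    exact LinearMap.ext fun x => by simp [mul_smul]

/-- The part of the Auslander-Reiten formula `Ext¹(X, Y) ≅ D Hom(Y, τ X)` that is needed here. -/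
theorem TranslatePairing.extVanish {V E : Type*} [Fintype V]
    (q : QuiverPresentation k A V E) (D : R.TranslatePairing T) (h0 : ∀ f : Y →ₗ[A] T, f = 0) :
    q.ExtVanish X Y := by
  have := Module.Finite.of_restrictScalars_finite k A R.P₁
  let res : (R.P₀ →ₗ[A] Y) →ₗ[k] (R.P₁ →ₗ[A] Y) :=
    { toFun := fun g => g ∘ₗ R.f
      map_add' := fun _ _ => rfl
      map_smul' := fun _ _ => rfl }
  refine R.extVanish q (LinearMap.range_eq_top.mp (?_ : LinearMap.range res = ⊤))
  by_contra hne
  obtain ⟨l, hl, hle⟩ := Submodule.exists_le_ker_of_lt_top _ (lt_top_iff_ne_top.mpr hne)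
  obtain ⟨φ, hφ⟩ := D.exists_hom l fun g => hle ⟨g, rfl⟩
  obtain ⟨n, r, g, hg⟩ := exists_dualBasis_of_projective A R.P₁
  refine hl (LinearMap.ext fun h => ?_)
  have hsum : h = ∑ i, (g i).smulRight (h (r i)) := LinearMap.ext fun x => by
    conv_lhs => rw [← hg x]
    simp
  rw [hsum, map_sum, LinearMap.zero_apply]
  refine Finset.sum_eq_zero fun i _ => ?_
  rw [← hφ, h0 φ, LinearMap.zero_apply, map_zero, LinearMap.zero_apply]

end Resolution

theorem isARTranslate_iff [Module.Finite k A] {L M : FDMod k A} :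
    IsARTranslate L M ↔ ∃ R : M.Resolution, Nonempty (R.TranslatePairing L) := by
  constructor
  · rintro ⟨P₁, P₀, f, p, h1, h0, hf, hex, hp, e, he⟩
    exact ⟨⟨P₁, P₀, f, p, h1, h0, hf, hex, hp⟩, ⟨e.toLinearMap, inferInstance, he⟩⟩
  · rintro ⟨R, ⟨D⟩⟩
    exact ⟨R.P₁, R.P₀, R.f, R.p, R.proj₁, R.proj₀, R.inj, R.exact, R.surj,
      D.pair.toPerfPair, D.smul⟩

theorem exists_translatePairing [Module.Finite k A] {V E : Type*} [Fintype V]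
    (q : QuiverPresentation k A V E) (X : FDMod k A) :
    ∃ (R : X.Resolution) (T : FDMod k A), Nonempty (R.TranslatePairing T) := by
  obtain ⟨R⟩ := X.nonempty_resolution q
  exact ⟨R, exists_dualPair_left (k := k) (A := A) (ExtOne R.f)⟩

end FDMod
namespace FDMod

/-! ### Direct sums -/

section DirectSum

variable {k : Type v} [Field k] {A : Type u} [Ring A] [Algebra k A]

/-- The direct sum of two modules. -/
def prod (M N : FDMod k A) : FDMod k A where
  carrier := M × N

/-- The finite direct sums of modules with property `p`. -/
inductive SumOf (p : FDMod k A → Prop) : FDMod k A → Prop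
  | zero (M : FDMod k A) (h : Subsingleton M) : SumOf p M
  | cons (P M X : FDMod k A) (hP : p P) (hM : SumOf p M) (e : X ≃ₗ[A] P × M) : SumOf p X

theorem nonempty_equiv_prod_of_subsingleton_left (M N : FDMod k A) [Subsingleton M] :
    Nonempty (N ≃ₗ[A] M × N) :=
  have : Unique M := uniqueOfSubsingleton 0
  ⟨LinearEquiv.uniqueProd.symm⟩

theorem nonempty_equiv_prod_of_subsingleton_right (M N : FDMod k A) [Subsingleton N] :
    Nonempty (M ≃ₗ[A] M × N) :=
  have : Unique N := uniqueOfSubsingleton 0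
  ⟨LinearEquiv.prodUnique.symm⟩

theorem SumOf.congr {p : FDMod k A → Prop} {M N : FDMod k A} (hM : SumOf p M)
    (e : M ≃ₗ[A] N) : SumOf p N := by
  cases hM with
  | zero M h => exact .zero N e.symm.toEquiv.subsingleton
  | cons P M' X hP hM' e₁ => exact .cons P M' N hP hM' (e.symm.trans e₁)

theorem SumOf.of_mem {p : FDMod k A → Prop} {M : FDMod k A} (hM : p M) : SumOf p M :=
  have : Subsingleton (FDMod.zero k A) := inferInstanceAs (Subsingleton PUnit)
  have ⟨e⟩ := nonempty_equiv_prod_of_subsingleton_right M (FDMod.zero k A)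
  .cons M _ M hM (.zero _ this) e

theorem SumOf.prod {p : FDMod k A → Prop} {M N : FDMod k A} (hM : SumOf p M) (hN : SumOf p N) :
    SumOf p (M.prod N) := by
  induction hM with
  | zero M h =>
    obtain ⟨e⟩ := nonempty_equiv_prod_of_subsingleton_left M N
    exact hN.congr e
  | cons P M X hP _ e ih =>
    exact .cons P (M.prod N) _ hP ih
      ((e.prodCongr (LinearEquiv.refl A N)).trans (LinearEquiv.prodAssoc A P M N))

theorem sumOf_of_equiv_pi {p : FDMod k A → Prop} {n : ℕ} {N : Fin n → FDMod k A}
    (hN : ∀ i, p (N i)) {M : FDMod k A} (e : M ≃ₗ[A] ∀ i, N i) : SumOf p M := by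
  induction n generalizing M with
  | zero => exact .zero M e.toEquiv.subsingleton
  | succ n ih =>
    let N' : FDMod k A := { carrier := ∀ i : Fin n, N i.succ }
    exact .cons (N 0) N' M (hN 0) (ih (fun i => hN i.succ) (LinearEquiv.refl A N'))
      (e.trans (Fin.consLinearEquiv A fun i => (N i : Type u)).symm)

theorem sumOf_isIndecomposable (M : FDMod k A) : SumOf IsIndecomposable M := by
  induction hd : Module.finrank k M using Nat.strong_induction_on generalizing M with
  | _ d ih =>
    subst hd
    by_cases h : M.IsIndecomposable
    · exact .of_mem h
    rcases subsingleton_or_nontrivial M with hs | hs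
    · exact .zero M hs
    rw [IsIndecomposable] at h
    push Not at h
    obtain ⟨U, W, hUW, hU, hW⟩ := h hs
    let e := Submodule.prodEquivOfIsCompl U W hUW
    have hadd : Module.finrank k (ofSub U) + Module.finrank k (ofSub W) = Module.finrank k M := by
      rw [← Module.finrank_prod, ← (e.restrictScalars k).finrank_eq]
      rfl
    have hpos {Y : Submodule A M} (hY : Y ≠ ⊥) : 0 < Module.finrank k (ofSub Y) :=
      have : Nontrivial (ofSub Y) := Submodule.nontrivial_iff_ne_bot.mpr hY
      Module.finrank_pos
    have := hpos hU
    have := hpos hW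
    exact ((ih _ (by omega) (ofSub U) rfl).prod (ih _ (by omega) (ofSub W) rfl)).congr e

theorem exists_indecomposable_summand {P X : FDMod k A} {f : X →ₗ[A] P} (hf : f ≠ 0) :
    ∃ Y Z : FDMod k A, Y.IsIndecomposable ∧ (∃ g : Y →ₗ[A] P, g ≠ 0) ∧
      Nonempty (X ≃ₗ[A] Y × Z) := by
  induction sumOf_isIndecomposable X with
  | zero M _ =>
    exact absurd (LinearMap.ext fun x => by rw [Subsingleton.elim x 0, map_zero, map_zero]) hf
  | cons Y M X hY _ e ih =>
    let f' : Y × M →ₗ[A] P := f ∘ₗ e.symm.toLinearMap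
    have hf' : f' ≠ 0 := fun h => hf (LinearMap.ext fun x => by
      simpa [f'] using LinearMap.congr_fun h (e x))
    by_cases hinl : f' ∘ₗ LinearMap.inl A Y M = 0
    · have hinr : f' ∘ₗ LinearMap.inr A Y M ≠ 0 := fun hinr => hf'
        (LinearMap.prod_ext (hinl.trans (LinearMap.zero_comp _).symm)
          (hinr.trans (LinearMap.zero_comp _).symm))
      obtain ⟨Y', Z, hY', hg, ⟨e'⟩⟩ := ih hinr
      exact ⟨Y', Z.prod Y, hY', hg, ⟨(e.trans (LinearEquiv.prodComm A Y M)).trans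
        ((e'.prodCongr (LinearEquiv.refl A Y)).trans (LinearEquiv.prodAssoc A Y' Z Y))⟩⟩
    · exact ⟨Y, M, hY, ⟨_, hinl⟩, ⟨e⟩⟩

end DirectSum

/-! ### The order on the indecomposable preprojective modules -/

section Key

variable {k : Type v} [Field k] {A : Type u} [Ring A] [Algebra k A]

/-- `HasKey (n, d) M` if `M` is indecomposable and `τⁿ M` is projective of dimension `d`. -/
inductive HasKey : ℕ ×ₗ ℕ → FDMod k A → Prop
  | projective (P : FDMod k A) (hP : P.IsIndecomposable) (hproj : Module.Projective A P) :
      HasKey (toLex (0, Module.finrank k P)) P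
  | translate (n d : ℕ) (L M : FDMod k A) (hL : HasKey (toLex (n, d)) L)
      (hM : M.IsIndecomposable) (h : IsARTranslate L M) : HasKey (toLex (n + 1, d)) M

/-- The torsion modules of the torsion pair given by `κ`: there is no nonzero map from `X` to a
module of key less than `κ`. -/
def IsTorsion (κ : ℕ ×ₗ ℕ) (X : FDMod k A) : Prop :=
  ∀ κ' < κ, ∀ L : FDMod k A, HasKey κ' L → ∀ f : X →ₗ[A] L, f = 0

/-- `κ` is the smallest key of `P`. -/
def IsMinKey (κ : ℕ ×ₗ ℕ) (P : FDMod k A) : Prop := HasKey κ P ∧ IsTorsion κ P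

/-- The torsion-free modules of the torsion pair given by `κ`: the direct sums of modules of minimal
key less than `κ`. -/
def IsTorsionFree (κ : ℕ ×ₗ ℕ) : FDMod k A → Prop := SumOf fun P => ∃ κ' < κ, IsMinKey κ' P

theorem HasKey.isIndecomposable {κ : ℕ ×ₗ ℕ} {M : FDMod k A} (h : HasKey κ M) :
    M.IsIndecomposable := by
  cases h <;> assumption

theorem IsIndecPreprojective.exists_hasKey {M : FDMod k A} (h : IsIndecPreprojective M) :
    ∃ κ, HasKey κ M := by
  induction h with
  | projective P hP hproj => exact ⟨_, .projective P hP hproj⟩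
  | translate L M _ hM h ih =>
    obtain ⟨κ, hκ⟩ := ih
    exact ⟨_, .translate (ofLex κ).1 (ofLex κ).2 L M hκ hM h⟩

theorem HasKey.congr {κ : ℕ ×ₗ ℕ} {M N : FDMod k A} (h : HasKey κ M) (e : M ≃ₗ[A] N) :
    HasKey κ N := by
  cases h with
  | projective _ hP hproj =>
    rw [(e.restrictScalars k).finrank_eq]
    exact .projective N (hP.congr e) (Module.Projective.of_equiv e)
  | translate n d L _ hL hM h =>
    refine .translate n d L N hL (hM.congr e) ?_
    obtain ⟨P₁, P₀, f, p, h₁, h₀, hf, hex, hp, hD⟩ := h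
    refine ⟨P₁, P₀, f, e.toLinearMap ∘ₗ p, h₁, h₀, hf, fun x => ?_, e.surjective.comp hp, hD⟩
    rw [← hex x]
    simp

theorem IsTorsion.mono {κ κ' : ℕ ×ₗ ℕ} (h : κ' ≤ κ) {X : FDMod k A} (hX : IsTorsion κ X) :
    IsTorsion κ' X := fun κ'' h' => hX κ'' (h'.trans_le h)

theorem IsTorsion.of_subsingleton (κ : ℕ ×ₗ ℕ) (X : FDMod k A) [Subsingleton X] : IsTorsion κ X :=
  fun _ _ _ _ f => LinearMap.ext fun x => by rw [Subsingleton.elim x 0, map_zero, map_zero]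

theorem IsTorsion.congr {κ : ℕ ×ₗ ℕ} {X Y : FDMod k A} (hX : IsTorsion κ X) (e : X ≃ₗ[A] Y) :
    IsTorsion κ Y := fun κ' h L hL f => LinearMap.ext fun y => by
  simpa using LinearMap.congr_fun (hX κ' h L hL (f ∘ₗ e.toLinearMap)) (e.symm y)

theorem IsTorsion.prod {κ : ℕ ×ₗ ℕ} {X Y : FDMod k A} (hX : IsTorsion κ X) (hY : IsTorsion κ Y) :
    IsTorsion κ (X.prod Y) := fun κ' h L hL (f : X × Y →ₗ[A] L) =>
  LinearMap.prod_ext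
    ((hX κ' h L hL (f ∘ₗ LinearMap.inl A X Y)).trans (LinearMap.zero_comp _).symm)
    ((hY κ' h L hL (f ∘ₗ LinearMap.inr A X Y)).trans (LinearMap.zero_comp _).symm)

theorem SumOf.exists_min {p : FDMod k A → Prop} (hp : ∀ P, p P → ∃ κ, IsMinKey κ P)
    {F : FDMod k A} (hF : SumOf p F) (hFn : Nontrivial F) :
    ∃ (P F' : FDMod k A) (κ : ℕ ×ₗ ℕ), p P ∧ IsMinKey κ P ∧ SumOf p F' ∧ IsTorsion κ F' ∧
      Nonempty (F ≃ₗ[A] P × F') := by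
  induction hF with
  | zero M h => exact absurd h (not_subsingleton M)
  | cons P M X hP hM e ih =>
    obtain ⟨κ, hκ⟩ := hp P hP
    rcases subsingleton_or_nontrivial M with hs | hs
    · exact ⟨P, M, κ, hP, hκ, hM, .of_subsingleton κ M, ⟨e⟩⟩
    obtain ⟨P₁, M', κ₁, hP₁, hκ₁, hM', hf, ⟨e'⟩⟩ := ih hs
    rcases le_total κ κ₁ with h | h
    · exact ⟨P, M, κ, hP, hκ, hM,
        IsTorsion.congr (X := P₁.prod M') ((hκ₁.2.prod hf).mono h) e'.symm, ⟨e⟩⟩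
    · refine ⟨P₁, P.prod M', κ₁, hP₁, hκ₁, .cons P M' _ hP hM' (LinearEquiv.refl A _),
        (hκ.2.mono h).prod hf, ⟨?_⟩⟩
      exact (e.trans ((LinearEquiv.refl A P).prodCongr e')).trans
        ((LinearEquiv.prodAssoc A P P₁ M').symm.trans
          (((LinearEquiv.prodComm A P P₁).prodCongr (LinearEquiv.refl A M')).trans
            (LinearEquiv.prodAssoc A P₁ P _)))

theorem IsTorsionFree.hom_eq_zero {κ : ℕ ×ₗ ℕ} {T F : FDMod k A}
    (hF : IsTorsionFree κ F) (hT : IsTorsion κ T) (f : T →ₗ[A] F) : f = 0 := by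
  induction hF with
  | zero F _ => exact LinearMap.ext fun x => Subsingleton.elim _ _
  | cons P M X hP _ e ih =>
    obtain ⟨κ', hκ', hP⟩ := hP
    have hfst := hT κ' hκ' P hP.1 (LinearMap.fst A P M ∘ₗ e.toLinearMap ∘ₗ f)
    have hsnd := ih (LinearMap.snd A P M ∘ₗ e.toLinearMap ∘ₗ f)
    exact LinearMap.ext fun x => e.map_eq_zero_iff.mp
      (Prod.ext (LinearMap.congr_fun hfst x) (LinearMap.congr_fun hsnd x))

variable [Module.Finite k A] {V E : Type*} [Fintype V] (q : QuiverPresentation k A V E)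
include q

theorem HasKey.of_hom_ne_zero {κ : ℕ ×ₗ ℕ} {M X : FDMod k A} (hM : HasKey κ M)
    (hX : X.IsIndecomposable) {f : X →ₗ[A] M} (hf : f ≠ 0) :
    (∃ κ' < κ, HasKey κ' X) ∨ Function.Bijective f := by
  induction hM generalizing X with
  | projective P _ _ =>
    have hinj := hX.injective_of_projective q hf
    have hXp := q.projective_of_injective f hinj
    rcases (LinearMap.finrank_le_finrank_of_injective (f := f.restrictScalars k) hinj).lt_or_eq
      with h | h
    · exact Or.inl ⟨_, Prod.Lex.right _ h, .projective X hX hXp⟩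
    · exact Or.inr ⟨hinj, (LinearMap.injective_iff_surjective_of_finrank_eq_finrank
        (f := f.restrictScalars k) h).mp hinj⟩
  | translate n d L M hL hM hLM ih =>
    by_cases hXp : Module.Projective A X
    · exact Or.inl ⟨_, Prod.Lex.left _ _ n.succ_pos, .projective X hX hXp⟩
    obtain ⟨R', ⟨D'⟩⟩ := isARTranslate_iff.mp hLM
    obtain ⟨R, T, ⟨D⟩⟩ := exists_translatePairing q X
    have := hL.isIndecomposable.1
    have hX₀ (P : FDMod k A) [Module.Projective A P] (g : X →ₗ[A] P) : g = 0 :=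
      hX.hom_projective_eq_zero q hXp g
    obtain ⟨g, hg, hgf⟩ := D.exists_hom_of_ne_zero D' hf hX₀
      fun g => hM.hom_projective_eq_zero q D'.not_projective g
    refine (ih (D.isIndecomposable hX (hX₀ _)) hg).imp (fun ⟨κ', hκ', hT⟩ => ?_) hgf
    refine ⟨toLex ((ofLex κ').1 + 1, (ofLex κ').2), ?_,
      .translate _ _ T X hT hX (isARTranslate_iff.mpr ⟨R, ⟨D⟩⟩)⟩
    rcases Prod.Lex.lt_iff.mp hκ' with h | ⟨h, h'⟩
    · exact Prod.Lex.left _ _ (Nat.succ_lt_succ h)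
    · exact Prod.Lex.lt_iff.mpr (Or.inr ⟨congrArg Nat.succ h, h'⟩)

theorem IsIndecomposable.isTorsion {κ : ℕ ×ₗ ℕ} {X : FDMod k A} (hX : X.IsIndecomposable)
    (h : ∀ κ' < κ, ¬ HasKey κ' X) : IsTorsion κ X := by
  intro κ' hκ' L hL f
  by_contra hf
  rcases hL.of_hom_ne_zero q hX hf with ⟨κ'', hlt, hκ''⟩ | hb
  · exact h κ'' (hlt.trans hκ') hκ''
  · exact h κ' hκ' (hL.congr (LinearEquiv.ofBijective f hb).symm)

theorem HasKey.extVanish {κ : ℕ ×ₗ ℕ} {M Y : FDMod k A} (hM : HasKey κ M) (hY : IsTorsion κ Y) :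
    q.ExtVanish M Y := by
  cases hM with
  | projective _ _ _ => exact q.extVanish_of_projective M Y
  | translate n d L _ hL _ hLM =>
    obtain ⟨R, ⟨D⟩⟩ := isARTranslate_iff.mp hLM
    exact D.extVanish q fun f => hY _ (Prod.Lex.left _ _ n.lt_succ_self) L hL f

theorem HasKey.exists_isMinKey {κ : ℕ ×ₗ ℕ} {P : FDMod k A} (h : HasKey κ P) :
    ∃ κ' ≤ κ, IsMinKey κ' P := by
  obtain ⟨κ', hκ', hmin⟩ := WellFounded.has_min (wellFounded_lt (α := ℕ ×ₗ ℕ))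
    {κ | HasKey κ P} ⟨κ, h⟩
  exact ⟨κ', not_lt.mp (hmin κ h), hκ',
    h.isIndecomposable.isTorsion q fun κ₁ hlt hκ₁ => hmin κ₁ hκ₁ hlt⟩

theorem exists_isTorsionFree_prod_isTorsion (κ : ℕ ×ₗ ℕ) (X : FDMod k A) :
    ∃ F T : FDMod k A, IsTorsionFree κ F ∧ IsTorsion κ T ∧ Nonempty (X ≃ₗ[A] F × T) := by
  induction sumOf_isIndecomposable X with
  | zero M h => exact ⟨M, M, .zero M h, .of_subsingleton κ M,
      nonempty_equiv_prod_of_subsingleton_left M M⟩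
  | cons P M X hP _ e ih =>
    obtain ⟨F, T, hF, hT, ⟨e'⟩⟩ := ih
    have e'' := e.trans ((LinearEquiv.refl A P).prodCongr e')
    by_cases h : ∃ κ' < κ, HasKey κ' P
    · obtain ⟨κ', hκ', h⟩ := h
      obtain ⟨κ'', hκ'', h⟩ := h.exists_isMinKey q
      exact ⟨P.prod F, T, .cons P F _ ⟨κ'', hκ''.trans_lt hκ', h⟩ hF (LinearEquiv.refl A _), hT,
        ⟨e''.trans (LinearEquiv.prodAssoc A P F T).symm⟩⟩
    · push Not at h
      exact ⟨F, P.prod T, hF, (hP.isTorsion q h).prod hT, ⟨e''.trans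
        (((LinearEquiv.prodAssoc A P F T).symm.trans
          ((LinearEquiv.prodComm A P F).prodCongr (LinearEquiv.refl A T))).trans
            (LinearEquiv.prodAssoc A F P T))⟩⟩

end Key

end FDMod
/-! ### Sums of classes in the Hall algebra -/

namespace HallAlgebra

variable {k : Type v} [Field k] {A : Type u} [Ring A] [Algebra k A]

theorem cls_congr {M N : FDMod k A} (e : M ≃ₗ[A] N) : cls M = cls N := by
  rw [cls, cls, IsoClass.mk_eq_mk.mpr ⟨e⟩]

theorem coeff_congr {M N : FDMod k A} (e : M ≃ₗ[A] N) : coeff M = coeff N := by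
  rw [coeff, coeff, IsoClass.mk_eq_mk.mpr ⟨e⟩]

theorem nonempty_equiv_out_iff {M : FDMod k A} {x : IsoClass k A} :
    Nonempty (M ≃ₗ[A] (Quotient.out x : FDMod k A)) ↔ IsoClass.mk M = x := by
  rw [← IsoClass.mk_eq_mk, show IsoClass.mk (Quotient.out x) = x from Quotient.out_eq x]

theorem cls_mem_of_coeff_ne_zero {S : Submodule ℚ (HallAlgebra k A)} {y : HallAlgebra k A}
    (hy : y ∈ S) {X : FDMod k A} (hX : coeff X y ≠ 0)
    (h : ∀ Z, coeff Z y ≠ 0 → Nonempty (Z ≃ₗ[A] X)) : cls X ∈ S := by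
  classical
  have hyX : y = coeff X y • cls X := ext_coeff fun Z => by
    rw [map_smul, coeff_cls, smul_eq_mul, mul_ite, mul_one, mul_zero]
    split_ifs with hZ
    · obtain ⟨e⟩ := hZ
      rw [coeff_congr e]
    · exact not_not.mp (mt (h Z) hZ)
  rwa [hyX, S.smul_mem_iff hX] at hy

theorem cls_eq_one_of_subsingleton (M : FDMod k A) [Subsingleton M] : cls M = 1 :=
  have : Subsingleton (FDMod.zero k A) := inferInstanceAs (Subsingleton PUnit)
  cls_congr (0 : M ≃ₗ[A] FDMod.zero k A)

variable [Finite k] [Module.Finite k A]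

open Classical in
theorem coeff_mul_sum_cls (Z : FDMod k A) (y : HallAlgebra k A) (s : Finset (IsoClass k A))
    [Fintype (Submodule A Z)] :
    coeff Z (y * ∑ x ∈ s, cls (Quotient.out x)) =
      ∑ Y : Submodule A Z with IsoClass.mk (FDMod.ofSub Y) ∈ s, coeff (FDMod.quot Y) y := by
  have hcls (x : IsoClass k A) : coeff Z (y * cls (Quotient.out x)) =
      ∑ Y : Submodule A Z with IsoClass.mk (FDMod.ofSub Y) = x, coeff (FDMod.quot Y) y := by
    rw [coeff_mul_cls, finsum_eq_sum_of_fintype]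
    refine (Finset.sum_subtype _ (fun Y => ?_) fun Y => coeff (FDMod.quot Y) y).symm
    rw [Finset.mem_filter_univ, ← nonempty_equiv_out_iff]
    rfl
  simp only [Finset.mul_sum, map_sum, hcls, Finset.sum_filter]
  rw [Finset.sum_comm]
  simp only [Finset.sum_ite_eq]

end HallAlgebra

/-- A property of modules that only depends on the isomorphism class. -/
def IsoInvariant {k : Type v} [Field k] {A : Type u} [Ring A] [Algebra k A]
    (p : FDMod k A → Prop) : Prop :=
  ∀ ⦃M N : FDMod k A⦄, (M ≃ₗ[A] N) → p M → p N

namespace IsoInvariant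

variable {k : Type v} [Field k] {A : Type u} [Ring A] [Algebra k A]

theorem iff {p : FDMod k A → Prop} (hp : IsoInvariant p) {M N : FDMod k A} (e : M ≃ₗ[A] N) :
    p M ↔ p N := ⟨hp e, hp e.symm⟩

theorem true : IsoInvariant fun _ : FDMod k A => True := fun _ _ _ h => h

theorem isTorsion (κ : ℕ ×ₗ ℕ) : IsoInvariant (FDMod.IsTorsion (k := k) (A := A) κ) :=
  fun _ _ e h => h.congr e

theorem isTorsionFree (κ : ℕ ×ₗ ℕ) : IsoInvariant (FDMod.IsTorsionFree (k := k) (A := A) κ) :=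
  fun _ _ e h => FDMod.SumOf.congr h e

end IsoInvariant

theorem single_add_update_zero {V : Type*} [DecidableEq V] (d : V → ℕ) (i : V) :
    Pi.single i (d i) + Function.update d i 0 = d := by
  funext j
  obtain rfl | hj := eq_or_ne j i
  · simp
  · simp [hj]

namespace QuiverPresentation

open HallAlgebra

variable {k : Type v} [Field k] {A : Type u} [Ring A] [Algebra k A] {V E : Type*} [Fintype V]
  (q : QuiverPresentation k A V E)

theorem dimVec_quot_add (X : FDMod k A) (Y : Submodule A X) :
    q.dimVec (FDMod.quot Y) + q.dimVec (FDMod.ofSub Y) = q.dimVec X := by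
  have h : q.dimVec X = q.dimVec (FDMod.quot Y) + q.dimVec (FDMod.ofSub Y) :=
    q.dimVec_eq_add_of_exact (M := FDMod.quot Y) (N := FDMod.ofSub Y) (ι := Y.subtype)
      (π := Y.mkQ) Subtype.val_injective (LinearMap.exact_subtype_mkQ Y) Y.mkQ_surjective
  exact h.symm

theorem dimVec_prod (M N : FDMod k A) : q.dimVec (M.prod N) = q.dimVec M + q.dimVec N :=
  q.dimVec_eq_add_of_exact (X := M × N) (ι := LinearMap.inr A M N) (π := LinearMap.fst A M N)
    LinearMap.inr_injective .inr_fst LinearMap.fst_surjective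

theorem dimVec_eq_zero_iff_subsingleton {M : FDMod k A} :
    q.dimVec M = 0 ↔ Subsingleton M := by
  rw [← Module.finrank_zero_iff (R := k), ← q.sum_dimVec, funext_iff]
  simp

section ClassSum

variable [Finite k] [Module.Finite k A]

theorem finite_setOf_dimVec_out_eq (d : V → ℕ) :
    {x : IsoClass k A | q.dimVec (Quotient.out x : FDMod k A) = d}.Finite := by
  refine (IsoClass.finite_card_eq (Nat.card k ^ ∑ i, d i)).subset fun x (hx : q.dimVec _ = d) => ?_
  rw [Set.mem_ofPred_eq, Module.natCard_eq_pow_finrank (K := k), ← q.sum_dimVec, hx]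

/-- The isomorphism classes of the modules with dimension vector `d` and property `p`. -/
noncomputable def isoClasses (d : V → ℕ) (p : FDMod k A → Prop) : Finset (IsoClass k A) :=
  ((q.finite_setOf_dimVec_out_eq d).sep fun x => p (Quotient.out x)).toFinset

/-- The sum of the classes of the modules with dimension vector `d` and property `p`. -/
noncomputable def classSum (d : V → ℕ) (p : FDMod k A → Prop) : HallAlgebra k A :=
  ∑ x ∈ q.isoClasses d p, cls (Quotient.out x)

theorem mem_isoClasses {d : V → ℕ} {p : FDMod k A → Prop} {x : IsoClass k A} :
    x ∈ q.isoClasses d p ↔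
      q.dimVec (Quotient.out x : FDMod k A) = d ∧ p (Quotient.out x : FDMod k A) :=
  Set.Finite.mem_toFinset _

theorem mk_mem_isoClasses {d : V → ℕ} {p : FDMod k A → Prop} (hp : IsoInvariant p)
    {X : FDMod k A} : IsoClass.mk X ∈ q.isoClasses d p ↔ q.dimVec X = d ∧ p X := by
  obtain ⟨e⟩ := IsoClass.nonempty_out_mk X
  rw [mem_isoClasses, q.dimVec_congr e, hp.iff e]

open Classical in
theorem coeff_classSum (d : V → ℕ) {p : FDMod k A → Prop} (hp : IsoInvariant p) (X : FDMod k A) :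
    coeff X (q.classSum d p) = if q.dimVec X = d ∧ p X then 1 else 0 := by
  simp only [classSum, map_sum, coeff_cls, nonempty_equiv_out_iff, Finset.sum_ite_eq,
    q.mk_mem_isoClasses hp]

theorem coeff_classSum_mul (d d' : V → ℕ) {p p' : FDMod k A → Prop} (hp : IsoInvariant p)
    (hp' : IsoInvariant p') (Z : FDMod k A) :
    coeff Z (q.classSum d p * q.classSum d' p') =
      Nat.card {Y : Submodule A Z // (q.dimVec (FDMod.quot Y) = d ∧ p (FDMod.quot Y)) ∧
        q.dimVec (FDMod.ofSub Y) = d' ∧ p' (FDMod.ofSub Y)} := by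
  classical
  have := finite_submodule Z
  have := Fintype.ofFinite (Submodule A Z)
  rw [classSum.eq_def q d' p', coeff_mul_sum_cls]
  simp only [q.mk_mem_isoClasses hp', q.coeff_classSum d hp]
  rw [Finset.sum_boole, Finset.filter_filter, Nat.card_eq_fintype_card, Fintype.card_subtype]
  simp only [and_comm]

theorem coeff_classSum_mul_ne_zero_iff {d d' : V → ℕ} {p p' : FDMod k A → Prop}
    (hp : IsoInvariant p) (hp' : IsoInvariant p') {Z : FDMod k A} :
    coeff Z (q.classSum d p * q.classSum d' p') ≠ 0 ↔
      ∃ Y : Submodule A Z, (q.dimVec (FDMod.quot Y) = d ∧ p (FDMod.quot Y)) ∧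
        q.dimVec (FDMod.ofSub Y) = d' ∧ p' (FDMod.ofSub Y) := by
  have := finite_submodule Z
  rw [q.coeff_classSum_mul d d' hp hp', Nat.cast_ne_zero, Nat.card_ne_zero, nonempty_subtype]
  exact and_iff_left inferInstance

theorem coeff_classSum_mul_of_unique {d d' : V → ℕ} {p p' : FDMod k A → Prop}
    (hp : IsoInvariant p) (hp' : IsoInvariant p') {Z : FDMod k A} {Y : Submodule A Z}
    (hY : (q.dimVec (FDMod.quot Y) = d ∧ p (FDMod.quot Y)) ∧
      q.dimVec (FDMod.ofSub Y) = d' ∧ p' (FDMod.ofSub Y))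
    (huniq : ∀ Y' : Submodule A Z, p (FDMod.quot Y') →
      q.dimVec (FDMod.ofSub Y') = d' → p' (FDMod.ofSub Y') → Y' = Y) :
    coeff Z (q.classSum d p * q.classSum d' p') = 1 := by
  rw [q.coeff_classSum_mul d d' hp hp', Nat.cast_eq_one, Nat.card_eq_one_iff_exists]
  exact ⟨⟨Y, hY⟩, fun Y' => Subtype.ext (huniq Y' Y'.2.1.2 Y'.2.2.1 Y'.2.2.2)⟩

theorem classSum_mem {C : Subalgebra ℚ (HallAlgebra k A)} (d : V → ℕ) {p : FDMod k A → Prop}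
    (h : ∀ X, p X → q.dimVec X = d → cls X ∈ C) : q.classSum d p ∈ C :=
  Subalgebra.sum_mem _ fun _ hx =>
    have ⟨hd, hp⟩ := q.mem_isoClasses.mp hx
    h _ hp hd

theorem classSum_eq_cls {p : FDMod k A → Prop} (hp : IsoInvariant p) {P : FDMod k A} (hP : p P)
    (h : ∀ X : FDMod k A, q.dimVec X = q.dimVec P → p X → Nonempty (X ≃ₗ[A] P)) :
    q.classSum (q.dimVec P) p = cls P := by
  classical
  refine ext_coeff fun X => ?_
  rw [q.coeff_classSum _ hp, coeff_cls]
  exact if_congr ⟨fun ⟨hd, hX⟩ => h X hd hX, fun ⟨e⟩ => ⟨q.dimVec_congr e, hp e.symm hP⟩⟩ rfl rfl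

theorem classSum_zero {p : FDMod k A → Prop} (hp : IsoInvariant p) (h : p (FDMod.zero k A)) :
    q.classSum 0 p = 1 := by
  have : Subsingleton (FDMod.zero k A) := inferInstanceAs (Subsingleton PUnit)
  have hd : q.dimVec (FDMod.zero k A) = 0 := q.dimVec_eq_zero_iff_subsingleton.mpr this
  rw [← hd, q.classSum_eq_cls hp h, cls_eq_one_of_subsingleton]
  intro X hX _
  have := q.dimVec_eq_zero_iff_subsingleton.mp (hX.trans hd)
  exact ⟨0⟩

end ClassSum

/-! ### The sum of all classes of a dimension vector -/

section Semisimple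

variable [DecidableEq V] {i : V} {m : ℕ} {X X' : FDMod k A}

theorem e_smul_eq_zero_of_dimVec_eq_single (hX : q.dimVec X = Pi.single i m) {j : V} (hj : j ≠ i)
    (y : X) : q.e j • y = 0 :=
  q.dimVec_eq_zero_iff.mp (by rw [hX, Pi.single_eq_of_ne hj]) y

theorem e_smul_eq_self_of_dimVec_eq_single (hX : q.dimVec X = Pi.single i m) (y : X) :
    q.e i • y = y := by
  conv_rhs => rw [← q.sum_e_smul y]
  exact (Fintype.sum_eq_single i fun j hj =>
    q.e_smul_eq_zero_of_dimVec_eq_single hX hj y).symm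

theorem x_smul_eq_zero_of_dimVec_eq_single (hX : q.dimVec X = Pi.single i m) (a : E) (y : X) :
    q.x a • y = 0 := by
  by_cases hs : q.s a = i
  · have ht : q.t a ≠ i := fun ht => (q.rank_lt a).ne (congrArg q.rank (hs.trans ht.symm))
    rw [← q.e_tgt_smul_x_smul, q.e_smul_eq_zero_of_dimVec_eq_single hX ht]
  · rw [← q.x_smul_e_src_smul, q.e_smul_eq_zero_of_dimVec_eq_single hX hs, smul_zero]

theorem finrank_of_dimVec_eq_single (hX : q.dimVec X = Pi.single i m) :
    Module.finrank k X = m := by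
  rw [← q.sum_dimVec, hX, Finset.sum_pi_single', if_pos (Finset.mem_univ i)]

theorem nonempty_equiv_of_dimVec_eq_single (hX : q.dimVec X = Pi.single i m)
    (hX' : q.dimVec X' = Pi.single i m) : Nonempty (X ≃ₗ[A] X') := by
  let f := LinearEquiv.ofFinrankEq (R := k) X X'
    ((q.finrank_of_dimVec_eq_single hX).trans (q.finrank_of_dimVec_eq_single hX').symm)
  refine ⟨LinearEquiv.ofBijective (q.toLinearMap f.toLinearMap (fun j y => ?_) fun a y => ?_)
    f.bijective⟩
  · obtain rfl | hj := eq_or_ne j i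
    · rw [q.e_smul_eq_self_of_dimVec_eq_single hX, q.e_smul_eq_self_of_dimVec_eq_single hX']
    · rw [q.e_smul_eq_zero_of_dimVec_eq_single hX hj,
        q.e_smul_eq_zero_of_dimVec_eq_single hX' hj, map_zero]
  · rw [q.x_smul_eq_zero_of_dimVec_eq_single hX, q.x_smul_eq_zero_of_dimVec_eq_single hX',
      map_zero]

theorem exists_smul_eq_of_dimVec_eq_single (hX : q.dimVec X = Pi.single i m) (a : A) :
    ∃ c : k, ∀ y : X, a • y = c • y := by
  induction a using q.induction_generators with
  | e j =>
    obtain rfl | hj := eq_or_ne j i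
    · exact ⟨1, fun y => by rw [q.e_smul_eq_self_of_dimVec_eq_single hX, one_smul]⟩
    · exact ⟨0, fun y => by rw [q.e_smul_eq_zero_of_dimVec_eq_single hX hj, zero_smul]⟩
  | x a => exact ⟨0, fun y => by rw [q.x_smul_eq_zero_of_dimVec_eq_single hX, zero_smul]⟩
  | algebraMap c => exact ⟨c, fun y => algebraMap_smul A c y⟩
  | add a b ha hb =>
    obtain ⟨⟨c, hc⟩, c', hc'⟩ := And.intro ha hb
    exact ⟨c + c', fun y => by rw [add_smul, add_smul, hc, hc']⟩
  | mul a b ha hb =>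
    obtain ⟨⟨c, hc⟩, c', hc'⟩ := And.intro ha hb
    exact ⟨c * c', fun y => by rw [mul_smul, mul_smul, hc, hc']⟩

theorem isSimpleModule_of_dimVec_eq_single (hX : q.dimVec X = Pi.single i 1) :
    IsSimpleModule A X := by
  have : IsSimpleModule k X := isSimpleModule_iff_finrank_eq_one.mpr
    (q.finrank_of_dimVec_eq_single hX)
  have := IsSimpleModule.nontrivial k X
  refine (isSimpleModule_iff A X).mpr { eq_bot_or_eq_top := fun Y => ?_ }
  exact (eq_bot_or_eq_top (Y.restrictScalars k)).imp
    (Submodule.restrictScalars_eq_bot_iff _ _ _).mp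
    (Submodule.restrictScalars_eq_top_iff _ _ _).mp

theorem exists_submodule_of_dimVec_eq_single (hX : q.dimVec X = Pi.single i (m + 1)) :
    ∃ Y : Submodule A X, q.dimVec (FDMod.quot Y) = Pi.single i m ∧
      q.dimVec (FDMod.ofSub Y) = Pi.single i 1 := by
  have : Nontrivial X := Module.nontrivial_of_finrank_pos (R := k) <| by
    rw [q.finrank_of_dimVec_eq_single hX]
    exact m.succ_pos
  obtain ⟨y, hy⟩ := exists_ne (0 : X)
  let Y : Submodule A X :=
    { Submodule.span k {y} with
      smul_mem' := fun a z hz => by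
        obtain ⟨c, hc⟩ := q.exists_smul_eq_of_dimVec_eq_single hX a
        rw [hc]
        exact (Submodule.span k {y}).smul_mem c hz }
  have hrank : ∑ j, q.dimVec (FDMod.ofSub Y) j = 1 :=
    q.sum_dimVec.trans (finrank_span_singleton (K := k) hy)
  have hzero (j : V) (hj : j ≠ i) : q.dimVec (FDMod.ofSub Y) j = 0 :=
    q.dimVec_eq_zero_iff.mpr fun z =>
      Subtype.ext (q.e_smul_eq_zero_of_dimVec_eq_single hX hj (z : Y).1)
  have hY : q.dimVec (FDMod.ofSub Y) = Pi.single i 1 := by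
    rw [Fintype.sum_eq_single i hzero] at hrank
    funext j
    obtain rfl | hj := eq_or_ne j i
    · rw [hrank, Pi.single_eq_same]
    · rw [hzero j hj, Pi.single_eq_of_ne hj]
  have hadd := q.dimVec_quot_add X Y
  rw [hX, hY, Pi.single_add] at hadd
  exact ⟨Y, add_right_cancel hadd, hY⟩

theorem classSum_single_mem [Finite k] [Module.Finite k A] (i : V) (m : ℕ) :
    q.classSum (Pi.single i m) (fun _ => True) ∈ compositionAlgebra k A := by
  have hsimple : q.classSum (Pi.single i 1) (fun _ => True) ∈ compositionAlgebra k A :=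
    q.classSum_mem _ fun X _ hX =>
      Algebra.subset_adjoin ⟨X, q.isSimpleModule_of_dimVec_eq_single hX, rfl⟩
  induction m with
  | zero =>
    rw [Pi.single_zero, q.classSum_zero .true trivial]
    exact one_mem _
  | succ m ih =>
    refine q.classSum_mem _ fun X _ hX => cls_mem_of_coeff_ne_zero
      (S := (compositionAlgebra k A).toSubmodule) (Subalgebra.mul_mem _ ih hsimple) ?_
      fun Z hZ => ?_
    · obtain ⟨Y, hquot, hsub⟩ := q.exists_submodule_of_dimVec_eq_single hX
      exact (q.coeff_classSum_mul_ne_zero_iff .true .true).mpr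
        ⟨Y, ⟨hquot, trivial⟩, hsub, trivial⟩
    · obtain ⟨Y, ⟨hquot, _⟩, hsub, _⟩ := (q.coeff_classSum_mul_ne_zero_iff .true .true).mp hZ
      refine q.nonempty_equiv_of_dimVec_eq_single ?_ hX
      rw [← q.dimVec_quot_add Z Y, hquot, hsub, Pi.single_add]

end Semisimple

section KerVertex

/-- The submodule of the elements killed by `e i`, if no arrow with target `i` acts on `Z`. -/
def kerVertex (Z : FDMod k A) (i : V) (h : ∀ a, q.t a = i → ∀ z : Z, q.x a • z = 0) :
    Submodule A Z where
  carrier := {z | q.e i • z = 0}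
  add_mem' hy hz := by rw [Set.mem_ofPred_eq, smul_add, hy, hz, add_zero]
  zero_mem' := smul_zero _
  smul_mem' a := by
    induction a using q.induction_generators with
    | e j =>
      intro z hz
      obtain rfl | hj := eq_or_ne i j
      · rwa [Set.mem_ofPred_eq, q.e_smul_e_smul_self]
      · exact q.e_smul_e_smul_of_ne hj z
    | x a =>
      intro z _
      by_cases ht : q.t a = i
      · rw [Set.mem_ofPred_eq, h a ht, smul_zero]
      · rw [Set.mem_ofPred_eq, ← q.e_tgt_smul_x_smul, q.e_smul_e_smul_of_ne (Ne.symm ht)]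
    | algebraMap c =>
      intro z hz
      rw [Set.mem_ofPred_eq, algebraMap_smul, smul_comm, hz, smul_zero]
    | add a b ha hb =>
      intro z hz
      rw [Set.mem_ofPred_eq, add_smul, smul_add, ha hz, hb hz, add_zero]
    | mul a b ha hb =>
      intro z hz
      rw [Set.mem_ofPred_eq, mul_smul]
      exact ha (hb hz)

variable {Z : FDMod k A} {i : V} (h : ∀ a, q.t a = i → ∀ z : Z, q.x a • z = 0) [DecidableEq V]

theorem dimVec_quot_kerVertex :
    q.dimVec (FDMod.quot (q.kerVertex Z i h)) = Pi.single i (q.dimVec Z i) := by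
  funext j
  obtain rfl | hj := eq_or_ne j i
  · have hsub : q.dimVec (FDMod.ofSub (q.kerVertex Z j h)) j = 0 :=
      q.dimVec_eq_zero_iff.mpr fun z => Subtype.ext (z : q.kerVertex Z j h).2
    rw [Pi.single_eq_same, ← q.dimVec_quot_add Z (q.kerVertex Z j h), Pi.add_apply, hsub, add_zero]
  · rw [Pi.single_eq_of_ne hj]
    refine q.dimVec_eq_zero_iff.mpr fun z => ?_
    obtain ⟨z, rfl⟩ := (q.kerVertex Z i h).mkQ_surjective z
    exact (Submodule.Quotient.mk_eq_zero _).mpr (q.e_smul_e_smul_of_ne hj.symm z)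

theorem dimVec_ofSub_kerVertex :
    q.dimVec (FDMod.ofSub (q.kerVertex Z i h)) = Function.update (q.dimVec Z) i 0 := by
  have hadd := q.dimVec_quot_add Z (q.kerVertex Z i h)
  rw [dimVec_quot_kerVertex] at hadd
  exact add_left_cancel (hadd.trans (single_add_update_zero _ i).symm)

theorem eq_kerVertex_of_dimVec_eq {Y : Submodule A Z}
    (hY : q.dimVec (FDMod.ofSub Y) = Function.update (q.dimVec Z) i 0) :
    Y = q.kerVertex Z i h := by
  have hle : Y ≤ q.kerVertex Z i h := fun z hz => by
    have hi : q.dimVec (FDMod.ofSub Y) i = 0 := by rw [hY, Function.update_self]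
    exact congrArg Subtype.val (q.dimVec_eq_zero_iff.mp hi (⟨z, hz⟩ : Y))
  have hrank : Module.finrank k (FDMod.ofSub Y) =
      Module.finrank k (FDMod.ofSub (q.kerVertex Z i h)) := by
    rw [← q.sum_dimVec, ← q.sum_dimVec, hY, q.dimVec_ofSub_kerVertex]
  exact Submodule.restrictScalars_injective k A Z (Submodule.eq_of_le_of_finrank_eq
    (S₁ := Y.restrictScalars k) (S₂ := (q.kerVertex Z i h).restrictScalars k) hle hrank)

end KerVertex

section AllClasses

variable [Finite k] [Module.Finite k A]

theorem classSum_single_mul_classSum_update [DecidableEq V] {d : V → ℕ} {i : V}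
    (hmin : ∀ j, q.rank j < q.rank i → d j = 0) :
    q.classSum (Pi.single i (d i)) (fun _ => True) *
      q.classSum (Function.update d i 0) (fun _ => True) = q.classSum d fun _ => True := by
  classical
  refine ext_coeff fun Z => ?_
  rw [q.coeff_classSum _ .true]
  split_ifs with hZ
  · obtain ⟨rfl, -⟩ := hZ
    have hx (a : E) (ha : q.t a = i) (z : Z) : q.x a • z = 0 := by
      have hs : q.dimVec Z (q.s a) = 0 := hmin _ (ha ▸ q.rank_lt a)
      rw [← q.x_smul_e_src_smul, q.dimVec_eq_zero_iff.mp hs, smul_zero]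
    exact q.coeff_classSum_mul_of_unique .true .true (Y := q.kerVertex Z i hx)
      ⟨⟨q.dimVec_quot_kerVertex hx, trivial⟩, q.dimVec_ofSub_kerVertex hx, trivial⟩
      fun Y _ hY _ => q.eq_kerVertex_of_dimVec_eq hx hY
  · by_contra hne
    obtain ⟨Y, ⟨hquot, _⟩, hsub, _⟩ := (q.coeff_classSum_mul_ne_zero_iff .true .true).mp hne
    refine hZ ⟨?_, trivial⟩
    rw [← q.dimVec_quot_add Z Y, hquot, hsub, single_add_update_zero]

theorem classSum_true_mem (d : V → ℕ) :
    q.classSum d (fun _ => True) ∈ compositionAlgebra k A := by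
  classical
  induction d using WellFoundedLT.induction with
  | _ d ih =>
    obtain rfl | hd := eq_or_ne d 0
    · rw [q.classSum_zero .true trivial]
      exact one_mem _
    obtain ⟨i, hi, hmin⟩ := Finset.exists_min_image {i | d i ≠ 0} q.rank
      (by simpa [Finset.Nonempty] using Function.ne_iff.mp hd)
    rw [Finset.mem_filter_univ] at hi
    rw [← q.classSum_single_mul_classSum_update (d := d) (i := i) fun j hj => ?_]
    · exact mul_mem (q.classSum_single_mem i _)
        (ih _ (update_lt_self_iff.mpr (Nat.pos_of_ne_zero hi)))
    · by_contra hdj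
      exact hj.not_ge (hmin j ((Finset.mem_filter_univ j).mpr hdj))

end AllClasses

/-! ### Preprojective modules in the composition algebra -/

section ExtVanish

variable {q}

theorem ExtVanish.nonempty_equiv_prod {P M X : FDMod k A}
    (h : q.ExtVanish P M) {Y : Submodule A X} (e₁ : (X ⧸ Y) ≃ₗ[A] P) (e₂ : Y ≃ₗ[A] M) :
    Nonempty (X ≃ₗ[A] P × M) := by
  let ι : M →ₗ[A] X := Y.subtype ∘ₗ e₂.symm.toLinearMap
  let π : X →ₗ[A] P := e₁.toLinearMap ∘ₗ Y.mkQ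
  have hι : Function.Injective ι := Subtype.val_injective.comp e₂.symm.injective
  have hπ : Function.Surjective π := e₁.surjective.comp Y.mkQ_surjective
  have hex : Function.Exact ι π := by
    rw [LinearMap.exact_iff, LinearEquiv.ker_comp, Submodule.ker_mkQ, LinearEquiv.range_comp,
      Submodule.range_subtype]
  obtain ⟨σ, hσ⟩ := h.exists_section hι hex hπ
  exact ⟨(hex.splitSurjectiveEquiv hι ⟨σ, hσ⟩).1.trans (LinearEquiv.prodComm A M P)⟩

variable [Finite k] [Module.Finite k A]

theorem ExtVanish.cls_prod_mem {C : Subalgebra ℚ (HallAlgebra k A)} {P M : FDMod k A}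
    (h : q.ExtVanish P M) (hP : cls P ∈ C) (hM : cls M ∈ C) : cls (P.prod M) ∈ C := by
  have hcoeff (Z : FDMod k A) : coeff Z (cls P * cls M) ≠ 0 ↔
      ∃ Y : Submodule A Z, Nonempty ((Z ⧸ Y) ≃ₗ[A] P) ∧ Nonempty (Y ≃ₗ[A] M) := by
    have := finite_submodule Z
    rw [coeff_cls_mul_cls, Nat.cast_ne_zero, FDMod.hallNumber, Nat.card_ne_zero, nonempty_subtype]
    exact and_iff_left inferInstance
  refine cls_mem_of_coeff_ne_zero (S := C.toSubmodule) (C.mul_mem hP hM)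
    ((hcoeff _).mpr ?_) fun Z hZ => ?_
  · let f : P × M →ₗ[A] P := LinearMap.fst A P M
    exact ⟨LinearMap.ker f, ⟨f.quotKerEquivOfSurjective LinearMap.fst_surjective⟩,
      ⟨(LinearEquiv.ofEq _ _ (LinearMap.range_inr A P M).symm).trans
        (LinearEquiv.ofInjective (LinearMap.inr A P M) LinearMap.inr_injective).symm⟩⟩
  · obtain ⟨Y, ⟨e₁⟩, ⟨e₂⟩⟩ := (hcoeff Z).mp hZ
    exact h.nonempty_equiv_prod e₁ e₂

end ExtVanish

section Preprojective

theorem _root_.FDMod.IsTorsion.le {κ : ℕ ×ₗ ℕ} {Z : FDMod k A} {Y Y' : Submodule A Z}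
    (hY : (FDMod.ofSub Y).IsTorsion κ) (hY' : (FDMod.quot Y').IsTorsionFree κ) : Y ≤ Y' :=
  fun z hz => (Submodule.Quotient.mk_eq_zero Y').mp
    (LinearMap.congr_fun (hY'.hom_eq_zero hY (Y'.mkQ ∘ₗ Y.subtype)) ⟨z, hz⟩)

variable [Module.Finite k A]

include q in
theorem exists_submodule_isTorsion (κ : ℕ ×ₗ ℕ) (Z : FDMod k A) :
    ∃ Y : Submodule A Z, (FDMod.quot Y).IsTorsionFree κ ∧ (FDMod.ofSub Y).IsTorsion κ := by
  obtain ⟨F, T, hF, hT, ⟨e⟩⟩ := FDMod.exists_isTorsionFree_prod_isTorsion q κ Z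
  let f : Z →ₗ[A] F := LinearMap.fst A F T ∘ₗ e.toLinearMap
  let g : T →ₗ[A] Z := e.symm.toLinearMap ∘ₗ LinearMap.inr A F T
  have hf : Function.Surjective f := (LinearMap.fst_surjective (R := A)).comp e.surjective
  have hg : Function.Injective g := e.symm.injective.comp (LinearMap.inr_injective (R := A))
  have hrange : LinearMap.range g = LinearMap.ker f := by
    rw [LinearMap.range_comp, LinearMap.range_inr, LinearMap.ker_comp]
    exact Submodule.map_equiv_eq_comap_symm e.symm _
  exact ⟨LinearMap.ker f, FDMod.SumOf.congr hF (f.quotKerEquivOfSurjective hf).symm,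
    hT.congr ((LinearEquiv.ofInjective g hg).trans (LinearEquiv.ofEq _ _ hrange))⟩

theorem nonempty_equiv_of_isTorsion [Finite E] {κ : ℕ ×ₗ ℕ} {P X : FDMod k A}
    (hP : FDMod.HasKey κ P) (hPT : P.IsTorsion κ) (hX : X.IsTorsion κ)
    (hd : q.dimVec X = q.dimVec P) : Nonempty (X ≃ₗ[A] P) := by
  have := Fintype.ofFinite E
  have := hP.isIndecomposable.1
  obtain ⟨f, hf⟩ : ∃ f : X →ₗ[A] P, f ≠ 0 := by
    by_contra! h
    have hle := q.euler_nonpos_of_hom_eq_zero h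
    rw [hd] at hle
    exact (q.euler_self_pos_of_extVanish (hP.extVanish q hPT)).not_ge hle
  obtain ⟨Y, Z, hY, ⟨g, hg⟩, ⟨e⟩⟩ := FDMod.exists_indecomposable_summand hf
  rcases hP.of_hom_ne_zero q hY hg with ⟨κ', hκ', hYκ⟩ | hb
  · have := hY.1
    obtain ⟨y, hy⟩ := exists_ne (0 : Y)
    have hfst := hX κ' hκ' Y hYκ (LinearMap.fst A Y Z ∘ₗ e.toLinearMap)
    exact absurd (by simpa using LinearMap.congr_fun hfst (e.symm (y, 0))) hy
  · let e' := LinearEquiv.ofBijective g hb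
    have hdim := q.dimVec_congr (N := Y.prod Z) e
    rw [hd, q.dimVec_prod, q.dimVec_congr e'] at hdim
    have : Subsingleton Z := q.dimVec_eq_zero_iff_subsingleton.mp (by simpa using hdim)
    obtain ⟨e''⟩ := FDMod.nonempty_equiv_prod_of_subsingleton_right Y Z
    exact ⟨(e.trans e''.symm).trans e'⟩

include q

variable [Finite k]

include q in
theorem cls_mem_of_sumOf {C : Subalgebra ℚ (HallAlgebra k A)} {p : FDMod k A → Prop}
    (hp : ∀ P, p P → ∃ κ, FDMod.IsMinKey κ P) (hC : ∀ P, p P → cls P ∈ C) {F : FDMod k A}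
    (hF : FDMod.SumOf p F) : cls F ∈ C := by
  induction hd : Module.finrank k F using Nat.strong_induction_on generalizing F with
  | _ d ih =>
    subst hd
    rcases subsingleton_or_nontrivial F with hs | hs
    · rw [cls_eq_one_of_subsingleton]
      exact one_mem _
    obtain ⟨P, F', κ, hP, hκ, hF', hT, ⟨e⟩⟩ := hF.exists_min hp hs
    have := hκ.1.isIndecomposable.1
    have hlt : Module.finrank k F' < Module.finrank k F := by
      rw [(e.restrictScalars k).finrank_eq, Module.finrank_prod]
      exact Nat.lt_add_of_pos_left Module.finrank_pos
    rw [cls_congr (N := P.prod F') e]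
    exact (hκ.1.extVanish q hT).cls_prod_mem (hC P hP) (ih _ hlt hF' rfl)

theorem sum_classSum_mul_classSum [DecidableEq V] (κ : ℕ ×ₗ ℕ) (d : V → ℕ) :
    ∑ d' ∈ Finset.Iic d, q.classSum d' (FDMod.IsTorsionFree κ) *
      q.classSum (d - d') (FDMod.IsTorsion κ) = q.classSum d fun _ => True := by
  classical
  refine ext_coeff fun Z => ?_
  obtain ⟨Y, hF, hT⟩ := q.exists_submodule_isTorsion κ Z
  have huniq (Y' : Submodule A Z) (hF' : (FDMod.quot Y').IsTorsionFree κ)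
      (hT' : (FDMod.ofSub Y').IsTorsion κ) : Y' = Y := le_antisymm (hT'.le hF) (hT.le hF')
  have hcoeff (d' d'' : V → ℕ) : coeff Z
      (q.classSum d' (FDMod.IsTorsionFree κ) * q.classSum d'' (FDMod.IsTorsion κ)) =
      if q.dimVec (FDMod.quot Y) = d' ∧ q.dimVec (FDMod.ofSub Y) = d'' then 1 else 0 := by
    split_ifs with h
    · exact q.coeff_classSum_mul_of_unique (.isTorsionFree κ) (.isTorsion κ)
        ⟨⟨h.1, hF⟩, h.2, hT⟩ fun Y' hF' _ hT' => huniq Y' hF' hT'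
    · by_contra hne
      obtain ⟨Y', ⟨hquot, hF'⟩, hsub, hT'⟩ :=
        (q.coeff_classSum_mul_ne_zero_iff (.isTorsionFree κ) (.isTorsion κ)).mp hne
      obtain rfl := huniq Y' hF' hT'
      exact h ⟨hquot, hsub⟩
  rw [map_sum, q.coeff_classSum _ .true]
  simp only [hcoeff, and_true]
  split_ifs with hd
  · rw [← hd, ← q.dimVec_quot_add Z Y, Finset.sum_eq_single (q.dimVec (FDMod.quot Y)), if_pos]
    · exact ⟨rfl, (add_tsub_cancel_left _ _).symm⟩
    · exact fun d' _ hd' => if_neg fun h => hd' h.1.symm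
    · exact fun h => absurd (Finset.mem_Iic.mpr le_self_add) h
  · refine Finset.sum_eq_zero fun d' hd' => if_neg fun h => hd ?_
    rw [← q.dimVec_quot_add Z Y, h.1, h.2, add_tsub_cancel_of_le (Finset.mem_Iic.mp hd')]

theorem classSum_isTorsion_mem (κ : ℕ ×ₗ ℕ)
    (h : ∀ κ' < κ, ∀ P : FDMod k A, FDMod.HasKey κ' P → cls P ∈ compositionAlgebra k A)
    (d : V → ℕ) : q.classSum d (FDMod.IsTorsion κ) ∈ compositionAlgebra k A := by
  classical
  have hF (d : V → ℕ) : q.classSum d (FDMod.IsTorsionFree κ) ∈ compositionAlgebra k A :=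
    q.classSum_mem d fun X hX _ => q.cls_mem_of_sumOf (fun P ⟨κ', _, hP⟩ => ⟨κ', hP⟩)
      (fun P ⟨κ', hκ', hP⟩ => h κ' hκ' P hP.1) hX
  have hzero : FDMod.IsTorsionFree κ (FDMod.zero k A) :=
    .zero _ (inferInstanceAs (Subsingleton PUnit))
  induction d using WellFoundedLT.induction with
  | _ d ih =>
    have hsum := q.sum_classSum_mul_classSum κ d
    rw [← Finset.add_sum_erase _ _ (Finset.mem_Iic.mpr (zero_le (a := d))),
      q.classSum_zero (.isTorsionFree κ) hzero, one_mul, tsub_zero] at hsum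
    rw [eq_sub_of_add_eq hsum]
    refine sub_mem (q.classSum_true_mem d) (sum_mem fun d' hd' => ?_)
    obtain ⟨hne, hle⟩ := Finset.mem_erase.mp hd'
    obtain ⟨i, hi⟩ := Function.ne_iff.mp hne
    refine mul_mem (hF d') (ih _ (lt_of_le_of_ne tsub_le_self fun heq => hi ?_))
    have hi' : d i - d' i = d i := congrFun heq i
    have hle' : d' i ≤ d i := Finset.mem_Iic.mp hle i
    change d' i = 0
    omega

theorem cls_mem_of_hasKey [Finite E] {κ : ℕ ×ₗ ℕ} {P : FDMod k A} (hP : FDMod.HasKey κ P) :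
    cls P ∈ compositionAlgebra k A := by
  induction κ using WellFoundedLT.induction generalizing P with
  | _ κ ih =>
    by_cases hlow : ∃ κ' < κ, FDMod.HasKey κ' P
    · obtain ⟨κ', hκ', hP'⟩ := hlow
      exact ih κ' hκ' hP'
    push Not at hlow
    have hT : P.IsTorsion κ := hP.isIndecomposable.isTorsion q hlow
    rw [← q.classSum_eq_cls (.isTorsion κ) hT fun X hd hX =>
      q.nonempty_equiv_of_isTorsion hP hT hX hd]
    exact q.classSum_isTorsion_mem κ (fun κ' h P hP => ih κ' h hP) _

theorem cls_mem_of_isPreprojective [Finite E] {M : FDMod k A} (hM : M.IsPreprojective) :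
    cls M ∈ compositionAlgebra k A := by
  obtain ⟨n, N, hN, ⟨e⟩⟩ := hM
  have hmin (i : Fin n) : ∃ κ, FDMod.IsMinKey κ (N i) := by
    obtain ⟨κ, hκ⟩ := (hN i).exists_hasKey
    obtain ⟨κ', _, hκ'⟩ := hκ.exists_isMinKey q
    exact ⟨κ', hκ'⟩
  exact q.cls_mem_of_sumOf (fun _ h => h) (fun _ ⟨_, h⟩ => q.cls_mem_of_hasKey h.1)
    (FDMod.sumOf_of_equiv_pi hmin e)

theorem preprojectiveSubalgebra_le [Finite E] :
    preprojectiveSubalgebra k A ≤ compositionAlgebra k A := by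
  refine Algebra.adjoin_le ?_
  rintro _ ⟨M, hM, rfl⟩
  exact q.cls_mem_of_isPreprojective hM

end Preprojective

end QuiverPresentation

/-! ### Duality and submodules -/

namespace DualPair

variable {k : Type*} [Field k] {A B : Type*} [Ring A] [Ring B] {σ : A ≃ B}

theorem nonempty_pi {ι : Type*} [Finite ι] {M N : ι → Type*} [∀ i, AddCommGroup (M i)]
    [∀ i, Module A (M i)] [∀ i, Module k (M i)] [∀ i, Module.Finite k (M i)]
    [∀ i, AddCommGroup (N i)] [∀ i, Module B (N i)] [∀ i, Module k (N i)]
    (D : ∀ i, DualPair k σ (M i) (N i)) : Nonempty (DualPair k σ (∀ i, M i) (∀ i, N i)) := by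
  classical
  have := Fintype.ofFinite ι
  let β : (∀ i, M i) →ₗ[k] (∀ i, N i) →ₗ[k] k :=
    ∑ i, (D i).pair.compl₁₂ (LinearMap.proj i) (LinearMap.proj i)
  have hβ (m n) : β m n = ∑ i, (D i).pair (m i) (n i) := by simp [β]
  have hsingle_right (m) (i : ι) (n : N i) : β m (Pi.single i n) = (D i).pair (m i) n := by
    rw [hβ, Fintype.sum_eq_single i fun j hj => by rw [Pi.single_eq_of_ne hj, map_zero],
      Pi.single_eq_same]
  have hsingle_left (n) (i : ι) (m : M i) : β (Pi.single i m) n = (D i).pair m (n i) := by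
    rw [hβ, Fintype.sum_eq_single i fun j hj => by
      rw [Pi.single_eq_of_ne hj, map_zero, LinearMap.zero_apply], Pi.single_eq_same]
  refine ⟨⟨β, LinearMap.IsPerfPair.of_injective ?_ ?_, fun a m n => ?_⟩⟩
  · rw [injective_iff_map_eq_zero]
    refine fun m hm => funext fun i => (D i).ext_left fun n => ?_
    rw [← hsingle_right, hm]
    simp
  · rw [injective_iff_map_eq_zero]
    refine fun n hn => funext fun i => (D i).ext_right fun m => ?_
    rw [← hsingle_left, ← LinearMap.flip_apply, hn]
    simp
  · rw [hβ, hβ]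
    exact Finset.sum_congr rfl fun i _ => (D i).smul a _ _

variable {M N : Type*} [AddCommGroup M] [Module A M] [Module k M] [AddCommGroup N] [Module B N]
  [Module k N]

/-- The annihilator of a submodule under the pairing. -/
def ann (D : DualPair k σ M N) (Y : Submodule A M) : Submodule B N where
  carrier := {n | ∀ y ∈ Y, D.pair y n = 0}
  add_mem' {n n'} hn hn' y hy := by rw [map_add, hn y hy, hn' y hy, add_zero]
  zero_mem' _ _ := map_zero _
  smul_mem' b n hn y hy := by
    obtain ⟨a, rfl⟩ := σ.surjective b
    rw [← D.smul]
    exact hn _ (Y.smul_mem a hy)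

theorem ann_bot (D : DualPair k σ M N) : D.ann ⊥ = ⊤ :=
  eq_top_iff.mpr fun n _ y hy => by
    rw [(Submodule.mem_bot A).mp hy, map_zero, LinearMap.zero_apply]

theorem ann_top (D : DualPair k σ M N) : D.ann ⊤ = ⊥ :=
  eq_bot_iff.mpr fun n hn => (Submodule.mem_bot B).mpr <| D.ext_right fun m => by
    rw [hn m trivial, map_zero]

variable [Algebra k A] [IsScalarTower k A M]

theorem ann_ann (D : DualPair k σ M N) (Y : Submodule A M) : D.symm.ann (D.ann Y) = Y := by
  refine le_antisymm (fun m hm => ?_) fun m hm n hn => hn m hm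
  by_contra hmY
  obtain ⟨g, hg, hgY⟩ := Submodule.exists_le_ker_of_notMem (p := Y.restrictScalars k) (v := m) hmY
  obtain ⟨n, rfl⟩ := D.pair.flip.toPerfPair.surjective g
  exact hg (hm n fun y hy => hgY hy)

theorem isSimpleModule_left (D : DualPair k σ M N) [IsSimpleModule B N] : IsSimpleModule A M := by
  have := IsSimpleModule.nontrivial B N
  have := D.symm.nontrivial_right
  refine (isSimpleModule_iff A M).mpr { eq_bot_or_eq_top := fun Y => ?_ }
  rw [← D.ann_ann Y]
  exact (eq_bot_or_eq_top (D.ann Y)).symm.imp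
    (fun h => (congrArg D.symm.ann h).trans D.symm.ann_top)
    (fun h => (congrArg D.symm.ann h).trans D.symm.ann_bot)

variable [Algebra k B] [IsScalarTower k B N]

section Equiv

variable {M' N' : Type*} [AddCommGroup M'] [Module A M'] [Module k M'] [IsScalarTower k A M']
  [AddCommGroup N'] [Module B N'] [Module k N'] [IsScalarTower k B N']

theorem nonempty_equiv_iff (D : DualPair k σ M N) (D' : DualPair k σ M' N') :
    Nonempty (M ≃ₗ[A] M') ↔ Nonempty (N ≃ₗ[B] N') where
  mp := fun ⟨e⟩ => ⟨.ofBijective _ (D'.transpose_bijective D e.symm.bijective)⟩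
  mpr := fun ⟨e⟩ => ⟨.ofBijective _ (D'.symm.transpose_bijective D.symm e.symm.bijective)⟩

/-- Replace the left module of a dual pair by an isomorphic one. -/
def congrLeft (D : DualPair k σ M N) (e : M' ≃ₗ[A] M) : DualPair k σ M' N where
  pair := D.pair ∘ₗ (e.restrictScalars k).toLinearMap
  perf := LinearMap.IsPerfPair.compl₁₂ D.pair (e.restrictScalars k) (LinearEquiv.refl k N)
  smul a m n := by
    change D.pair (e (a • m)) n = D.pair (e m) (σ a • n)
    rw [map_smul e, D.smul]

end Equiv

/-- Passage to the annihilator as a bijection between the submodules of the two modules. -/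
def annEquiv (D : DualPair k σ M N) : Submodule A M ≃ Submodule B N where
  toFun := D.ann
  invFun := D.symm.ann
  left_inv := D.ann_ann
  right_inv := D.symm.ann_ann

/-- The pairing between a quotient and the annihilator. -/
def quotient [Module.Finite k M] (D : DualPair k σ M N) (Y : Submodule A M) :
    DualPair k σ (M ⧸ Y) (D.ann Y) where
  pair := ((Y.restrictScalars k).liftQ
      ((((D.ann Y).restrictScalars k).subtype).lcomp k k ∘ₗ D.pair) fun y hy =>
        LinearMap.ext fun n => n.2 y hy) ∘ₗ
    (Submodule.Quotient.restrictScalarsEquiv k Y).symm.toLinearMap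
  perf := by
    have : Module.Finite k (M ⧸ Y) := Module.Finite.of_surjective
      (Y.mkQ.restrictScalars k) Y.mkQ_surjective
    refine LinearMap.IsPerfPair.of_injective ?_ ?_ <;> rw [injective_iff_map_eq_zero]
    · intro z hz
      obtain ⟨m, rfl⟩ := Y.mkQ_surjective z
      refine (Submodule.Quotient.mk_eq_zero Y).mpr ?_
      rw [← D.ann_ann Y]
      exact fun n hn => LinearMap.congr_fun hz ⟨n, hn⟩
    · intro n hn
      refine Subtype.ext (D.ext_right fun m => ?_)
      rw [ZeroMemClass.coe_zero, map_zero]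
      exact LinearMap.congr_fun hn (Y.mkQ m)
  smul a z n := by
    obtain ⟨m, rfl⟩ := Y.mkQ_surjective z
    exact D.smul a m n

/-- The pairing between a submodule and the quotient by its annihilator. -/
def sub [Module.Finite k N] (D : DualPair k σ M N) (Y : Submodule A M) :
    DualPair k σ Y (N ⧸ D.ann Y) :=
  (D.symm.quotient (D.ann Y)).symm.congrLeft (LinearEquiv.ofEq _ _ (D.ann_ann Y).symm)

end DualPair

namespace FDMod

variable {k : Type v} [Field k] {A : Type u} [Ring A] [Algebra k A]

theorem IsIndecomposable.dual {M : FDMod k A} {N : FDMod k Aᵐᵒᵖ} (hM : M.IsIndecomposable)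
    (D : DualPair k (opEquiv (α := A)) M N) : N.IsIndecomposable := by
  have := hM.1
  have := D.nontrivial_right
  refine isIndecomposable_of_idempotent fun f hf => ?_
  let g : M →ₗ[A] M := D.symm.transpose D.symm f
  have hg : g ∘ₗ g = g := by rw [← DualPair.transpose_comp, hf]
  have hinj := D.symm.transpose_injective D.symm
  exact (hM.eq_zero_or_eq_id hg).imp (fun h => hinj (h.trans (D.symm.transpose_zero D.symm).symm))
    fun h => hinj (h.trans D.symm.transpose_id.symm)

theorem hallNumber_dual {M₁ M₂ X : FDMod k A} {N₁ N₂ Z : FDMod k Aᵐᵒᵖ}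
    (D₁ : DualPair k (opEquiv (α := A)) M₁ N₁) (D₂ : DualPair k (opEquiv (α := A)) M₂ N₂)
    (D : DualPair k (opEquiv (α := A)) X Z) :
    hallNumber N₂ N₁ Z = hallNumber M₁ M₂ X :=
  (Nat.card_congr (D.annEquiv.subtypeEquiv fun Y =>
    (and_congr ((D.quotient Y).nonempty_equiv_iff D₁) ((D.sub Y).nonempty_equiv_iff D₂)).trans
      and_comm)).symm

/-! ### Duality and the Auslander-Reiten translate -/

theorem projective_dual [Module.Finite k A] {M : FDMod k A} {N : FDMod k Aᵐᵒᵖ}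
    [Module.Injective A M] (D : DualPair k (opEquiv (α := A)) M N) :
    Module.Projective Aᵐᵒᵖ N := by
  have := Module.Finite.of_restrictScalars_finite k Aᵐᵒᵖ N
  obtain ⟨n, f, hf⟩ := Module.Finite.exists_fin' Aᵐᵒᵖ N
  obtain ⟨X, ⟨D'⟩⟩ := exists_dualPair_left (k := k) (A := A) (Fin n → Aᵐᵒᵖ)
  let ι : M →ₗ[A] X := D'.symm.transpose D.symm f
  have hpair (x m) : D'.pair (ι m) x = D.pair m (f x) := D'.symm.pair_transpose D.symm f x m
  have hι : Function.Injective ι := fun m m' h => D.ext_left fun y => by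
    obtain ⟨x, rfl⟩ := hf y
    rw [← hpair, h, hpair]
  obtain ⟨r, hr⟩ := Module.Injective.out ι hι LinearMap.id
  refine Module.Projective.of_split (D'.transpose D r) f ?_
  have hf' : D.transpose D' ι = f := D'.symm.transpose_symm_transpose D.symm f
  rw [← hf', ← DualPair.transpose_comp, ← D.transpose_id]
  exact congrArg _ (LinearMap.ext hr)

section Bidual

variable [Module.Finite k A]

/-- The right module `Hom_A(P, A)`. -/
def homMod (P : FDMod k A) : FDMod k Aᵐᵒᵖ where
  carrier := P →ₗ[A] A

/-- The evaluation map from a module to its bidual `Hom_{Aᵐᵒᵖ}(Hom_A(P, A), Aᵐᵒᵖ)`. -/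
def evalHom (P : FDMod k A) : P →ₗ[k] (homMod P →ₗ[Aᵐᵒᵖ] Aᵐᵒᵖ) where
  toFun x :=
    { toFun := fun g : P →ₗ[A] A => op (g x)
      map_add' := fun _ _ => rfl
      map_smul' := fun _ _ => rfl }
  map_add' x y := LinearMap.ext fun g : P →ₗ[A] A => congrArg op (g.map_add x y)
  map_smul' c x := LinearMap.ext fun g : P →ₗ[A] A => congrArg op (g.map_smul_of_tower c x)

theorem evalHom_smul (P : FDMod k A) (a : A) (x : P) :
    evalHom P (a • x) = op (op a) • evalHom P x :=
  LinearMap.ext fun g : P →ₗ[A] A => congrArg op (g.map_smul a x)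

variable (P : FDMod k A) [Module.Projective A P]

instance projective_homMod : Module.Projective Aᵐᵒᵖ (homMod P) := by
  have := Module.Finite.of_restrictScalars_finite k A P
  obtain ⟨n, r, g, hg⟩ := exists_dualBasis_of_projective A P
  let i : (P →ₗ[A] A) →ₗ[Aᵐᵒᵖ] (Fin n → Aᵐᵒᵖ) :=
    { toFun := fun h j => op (h (r j))
      map_add' := fun _ _ => rfl
      map_smul' := fun _ _ => rfl }
  let s : (Fin n → Aᵐᵒᵖ) →ₗ[Aᵐᵒᵖ] (P →ₗ[A] A) := Fintype.linearCombination Aᵐᵒᵖ g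
  refine Module.Projective.of_split (M := Fin n → Aᵐᵒᵖ) i s
    (LinearMap.ext fun h : P →ₗ[A] A => LinearMap.ext fun x => ?_)
  change s (i h) x = h x
  conv_rhs => rw [← hg x]
  simp [s, i, Fintype.linearCombination_apply]

theorem evalHom_bijective : Function.Bijective (evalHom P) := by
  have := Module.Finite.of_restrictScalars_finite k A P
  obtain ⟨n, r, g, hg⟩ := exists_dualBasis_of_projective A P
  constructor
  · rw [injective_iff_map_eq_zero]
    intro x hx
    rw [← hg x]
    refine Finset.sum_eq_zero fun i _ => ?_
    have hi : op (g i x) = 0 := LinearMap.congr_fun hx (g i)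
    rw [(op_eq_zero_iff _).mp hi, zero_smul]
  · intro (θ : (P →ₗ[A] A) →ₗ[Aᵐᵒᵖ] Aᵐᵒᵖ)
    refine ⟨∑ i, unop (θ (g i)) • r i, LinearMap.ext fun h : P →ₗ[A] A => ?_⟩
    change op (h (∑ i, unop (θ (g i)) • r i)) = θ h
    have hsum : h = ∑ i, op (h (r i)) • g i := LinearMap.ext fun x => by
      conv_lhs => rw [← hg x]
      simp
    conv_rhs => rw [hsum]
    simp

/-- A projective module is isomorphic to its bidual. -/
noncomputable def evalEquiv : P ≃ₗ[k] (homMod P →ₗ[Aᵐᵒᵖ] Aᵐᵒᵖ) :=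
  LinearEquiv.ofBijective (evalHom P) (evalHom_bijective P)

end Bidual

namespace Resolution

variable [Module.Finite k A] {L M : FDMod k A} (R : M.Resolution)

/-- The map `Hom_A(f, A)` between the right modules `Hom_A(P₀, A)` and `Hom_A(P₁, A)`. -/
def homModMap : homMod R.P₀ →ₗ[Aᵐᵒᵖ] homMod R.P₁ := homDual R.f

theorem homModMap_injective (hM : ∀ f : M →ₗ[A] A, f = 0) :
    Function.Injective R.homModMap := by
  rw [injective_iff_map_eq_zero]
  intro (g : R.P₀ →ₗ[A] A) hg
  obtain ⟨l, hl⟩ := R.exists_desc g fun x => LinearMap.congr_fun hg x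
  refine LinearMap.ext fun x => ?_
  change g x = 0
  rw [← hl, hM l, LinearMap.zero_apply]

theorem evalEquiv_mem_range_homDual_iff {x : R.P₀} :
    evalEquiv R.P₀ x ∈ LinearMap.range (homDual R.homModMap) ↔ R.p x = 0 := by
  have hev (y : R.P₁) : homDual R.homModMap (evalEquiv R.P₁ y) = evalEquiv R.P₀ (R.f y) := rfl
  constructor
  · rintro ⟨ψ, hψ⟩
    obtain ⟨y, rfl⟩ := (evalEquiv R.P₁).surjective ψ
    rw [← (evalEquiv R.P₀).injective ((hev y).symm.trans hψ), R.p_f]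
  · intro hx
    obtain ⟨y, rfl⟩ := (R.exact x).mp hx
    exact ⟨evalEquiv R.P₁ y, hev y⟩

theorem exists_extOne_homModMap_equiv :
    ∃ θ : ExtOne R.homModMap ≃ₗ[k] M,
      ∀ (a : A) (z : ExtOne R.homModMap), θ (op (op a) • z) = a • θ z := by
  let θ₀ : (homMod R.P₀ →ₗ[Aᵐᵒᵖ] Aᵐᵒᵖ) →ₗ[k] M :=
    R.p.restrictScalars k ∘ₗ (evalEquiv R.P₀).symm.toLinearMap
  have hθ₀ (x) : θ₀ (evalEquiv R.P₀ x) = R.p x :=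
    congrArg R.p ((evalEquiv R.P₀).symm_apply_apply x)
  have hker : (LinearMap.range (homDual R.homModMap)).restrictScalars k = LinearMap.ker θ₀ := by
    ext ω
    obtain ⟨x, rfl⟩ := (evalEquiv R.P₀).surjective ω
    rw [LinearMap.mem_ker, hθ₀]
    exact R.evalEquiv_mem_range_homDual_iff
  let θ : ExtOne R.homModMap ≃ₗ[k] M :=
    (Submodule.Quotient.restrictScalarsEquiv k (LinearMap.range (homDual R.homModMap))).symm.trans
      ((Submodule.quotEquivOfEq _ _ hker).trans
        (θ₀.quotKerEquivOfSurjective (R.surj.comp (evalEquiv R.P₀).symm.surjective)))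
  have hθ (x) : θ (Submodule.Quotient.mk (evalEquiv R.P₀ x)) = R.p x := hθ₀ x
  refine ⟨θ, fun a z => ?_⟩
  obtain ⟨ω, rfl⟩ := Submodule.mkQ_surjective _ z
  obtain ⟨x, rfl⟩ := (evalEquiv R.P₀).surjective ω
  have hx : θ (Submodule.Quotient.mk (evalEquiv R.P₀ (a • x))) =
      a • θ (Submodule.Quotient.mk (evalEquiv R.P₀ x)) := by rw [hθ, hθ, map_smul]
  refine Eq.trans ?_ hx
  exact congrArg (θ ∘ Submodule.Quotient.mk) (evalHom_smul R.P₀ a x).symm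

variable {R}

theorem TranslatePairing.isARTranslate_dual {N N' : FDMod k Aᵐᵒᵖ} (D : R.TranslatePairing L)
    (hM : ∀ f : M →ₗ[A] A, f = 0) (DL : DualPair k (opEquiv (α := A)) L N)
    (DM : DualPair k (opEquiv (α := A)) M N') : IsARTranslate N' N := by
  obtain ⟨e⟩ := (D.nonempty_equiv_iff DL).mp ⟨LinearEquiv.refl A L⟩
  obtain ⟨θ, hθ⟩ := R.exists_extOne_homModMap_equiv
  let S : N.Resolution :=
    { P₁ := homMod R.P₀
      P₀ := homMod R.P₁
      f := R.homModMap
      p := e.toLinearMap ∘ₗ R.extMk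
      proj₁ := projective_homMod R.P₀
      proj₀ := projective_homMod R.P₁
      inj := R.homModMap_injective hM
      exact := fun g => (LinearEquiv.map_eq_zero_iff e (x := R.extMk g)).trans R.extMk_eq_zero
      surj := e.surjective.comp R.extMk_surjective }
  refine isARTranslate_iff.mpr ⟨S, ⟨DM.pair.flip.compl₁₂ (LinearEquiv.refl k N') θ,
    inferInstance, fun a n z => ?_⟩⟩
  change DM.pair (θ z) (a • n) = DM.pair (θ (op a • z)) n
  obtain ⟨a, rfl⟩ := op_surjective a
  rw [hθ, DM.smul]
  rfl

end Resolution

theorem IsIndecPreinjective.isIndecomposable {M : FDMod k A} (h : IsIndecPreinjective M) :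
    M.IsIndecomposable := by
  cases h <;> assumption

variable [Module.Finite k A] {V E : Type*} [Fintype V]

theorem IsIndecPreinjective.dual (q : QuiverPresentation k A V E) {M : FDMod k A}
    (hM : IsIndecPreinjective M) {N : FDMod k Aᵐᵒᵖ} (D : DualPair k (opEquiv (α := A)) M N) :
    IsIndecPreprojective N := by
  induction hM generalizing N with
  | injective I hI hinj => exact .projective N (hI.dual D) (projective_dual D)
  | translate L M hM hL h ih =>
    obtain ⟨N₁, ⟨D₁⟩⟩ := exists_dualPair_right (k := k) (A := A) M
    obtain ⟨R, ⟨DR⟩⟩ := isARTranslate_iff.mp h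
    have := hL.1
    let regular : FDMod k A := { carrier := A }
    have : Module.Projective A regular := inferInstanceAs (Module.Projective A A)
    have hMA := hM.isIndecomposable.hom_projective_eq_zero q (P := regular) DR.not_projective
    exact .translate N₁ N (ih D₁) (hL.dual D) (DR.isARTranslate_dual hMA D D₁)

theorem IsPreinjective.dual (q : QuiverPresentation k A V E) {M : FDMod k A}
    (hM : M.IsPreinjective) {N : FDMod k Aᵐᵒᵖ} (D : DualPair k (opEquiv (α := A)) M N) :
    N.IsPreprojective := by
  obtain ⟨n, M', hM', he⟩ := hM
  choose N' D' using fun i => exists_dualPair_right (k := k) (A := A) (M' i)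
  obtain ⟨Dpi⟩ := DualPair.nonempty_pi fun i => (D' i).some
  exact ⟨n, N', fun i => (hM' i).dual q (D' i).some, (D.nonempty_equiv_iff Dpi).mp he⟩

end FDMod

/-! ### Duality of Hall algebras -/

namespace HallAlgebra

variable {k : Type v} [Field k] {A : Type u} [Ring A] [Algebra k A]

/-- The isomorphism class of the `k`-dual of a right module. -/
noncomputable def dualClass (x : IsoClass k Aᵐᵒᵖ) : IsoClass k A :=
  IsoClass.mk (FDMod.exists_dualPair_left (k := k) (A := A) (Quotient.out x : FDMod k Aᵐᵒᵖ)).choose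

theorem dualClass_mk {M : FDMod k A} {N : FDMod k Aᵐᵒᵖ}
    (D : DualPair k (opEquiv (α := A)) M N) : dualClass (IsoClass.mk N) = IsoClass.mk M := by
  obtain ⟨D'⟩ := (FDMod.exists_dualPair_left (k := k) (A := A)
    (Quotient.out (IsoClass.mk N) : FDMod k Aᵐᵒᵖ)).choose_spec
  exact IsoClass.mk_eq_mk.mpr ((D'.nonempty_equiv_iff D).mpr (IsoClass.nonempty_out_mk N))

theorem dualClass_injective : Function.Injective (dualClass (k := k) (A := A)) := by
  rintro ⟨N⟩ ⟨N'⟩ h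
  obtain ⟨M, ⟨D⟩⟩ := FDMod.exists_dualPair_left (k := k) (A := A) N
  obtain ⟨M', ⟨D'⟩⟩ := FDMod.exists_dualPair_left (k := k) (A := A) N'
  have hM : IsoClass.mk M = IsoClass.mk M' :=
    (dualClass_mk D).symm.trans (h.trans (dualClass_mk D'))
  exact IsoClass.mk_eq_mk.mpr ((D.nonempty_equiv_iff D').mp (IsoClass.mk_eq_mk.mp hM))

/-- The linear map `[N] ↦ [D N]` from the Hall algebra of `Aᵐᵒᵖ` to that of `A`. -/
noncomputable def dualMap : HallAlgebra k Aᵐᵒᵖ →ₗ[ℚ] HallAlgebra k A :=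
  repr.symm.toLinearMap ∘ₗ Finsupp.lmapDomain ℚ ℚ dualClass ∘ₗ repr.toLinearMap

theorem dualMap_cls {M : FDMod k A} {N : FDMod k Aᵐᵒᵖ}
    (D : DualPair k (opEquiv (α := A)) M N) : dualMap (cls N) = cls M := by
  simp only [dualMap, cls, LinearMap.comp_apply, LinearEquiv.coe_coe,
    LinearEquiv.apply_symm_apply, Finsupp.lmapDomain_apply, Finsupp.mapDomain_single,
    dualClass_mk D]

theorem coeff_dualMap {M : FDMod k A} {N : FDMod k Aᵐᵒᵖ}
    (D : DualPair k (opEquiv (α := A)) M N) (h : HallAlgebra k Aᵐᵒᵖ) :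
    coeff M (dualMap h) = coeff N h := by
  simp only [dualMap, coeff, LinearMap.comp_apply, LinearEquiv.coe_coe,
    LinearEquiv.apply_symm_apply, Finsupp.lmapDomain_apply, Finsupp.lapply_apply,
    ← dualClass_mk D]
  exact Finsupp.mapDomain_apply dualClass_injective _ _

theorem dualMap_one : dualMap (1 : HallAlgebra k Aᵐᵒᵖ) = 1 := by
  obtain ⟨M, ⟨D⟩⟩ := FDMod.exists_dualPair_left (k := k) (A := A) (FDMod.zero k Aᵐᵒᵖ)
  have : Subsingleton (FDMod.zero k Aᵐᵒᵖ) := inferInstanceAs (Subsingleton PUnit)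
  have := D.symm.subsingleton_right
  rw [← cls_eq_one_of_subsingleton M]
  exact dualMap_cls D

variable [Finite k] [Module.Finite k A]

theorem dualMap_cls_mul_cls (N₁ N₂ : FDMod k Aᵐᵒᵖ) :
    dualMap (cls N₁ * cls N₂) = dualMap (cls N₂) * dualMap (cls N₁) := by
  obtain ⟨M₁, ⟨D₁⟩⟩ := FDMod.exists_dualPair_left (k := k) (A := A) N₁
  obtain ⟨M₂, ⟨D₂⟩⟩ := FDMod.exists_dualPair_left (k := k) (A := A) N₂
  rw [dualMap_cls D₁, dualMap_cls D₂]
  refine ext_coeff fun X => ?_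
  obtain ⟨Z, ⟨D⟩⟩ := FDMod.exists_dualPair_right (k := k) (A := A) X
  rw [coeff_dualMap D, coeff_cls_mul_cls, coeff_cls_mul_cls, FDMod.hallNumber_dual D₂ D₁ D]

theorem dualMap_mul (x y : HallAlgebra k Aᵐᵒᵖ) : dualMap (x * y) = dualMap y * dualMap x := by
  induction x using induction_cls with
  | zero => simp
  | add f g hf hg => rw [add_mul, map_add, hf, hg, map_add, mul_add]
  | smul a N₁ =>
    induction y using induction_cls with
    | zero => simp
    | add f g hf hg => rw [mul_add, map_add, hf, hg, map_add, add_mul]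
    | smul b N₂ =>
      rw [smul_mul_smul_comm, map_smul, map_smul, map_smul, smul_mul_smul_comm, mul_comm b a,
        dualMap_cls_mul_cls]

theorem dualMap_mem_compositionAlgebra {x : HallAlgebra k Aᵐᵒᵖ}
    (hx : x ∈ compositionAlgebra k Aᵐᵒᵖ) : dualMap x ∈ compositionAlgebra k A := by
  induction hx using Algebra.adjoin_induction with
  | mem x hx =>
    obtain ⟨S, hS, rfl⟩ := hx
    obtain ⟨M, ⟨D⟩⟩ := FDMod.exists_dualPair_left (k := k) (A := A) S
    rw [dualMap_cls D]
    exact Algebra.subset_adjoin ⟨M, D.isSimpleModule_left, rfl⟩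
  | algebraMap r =>
    rw [Algebra.algebraMap_eq_smul_one, map_smul, dualMap_one]
    exact Subalgebra.smul_mem _ (one_mem _) r
  | add x y _ _ hx hy =>
    rw [map_add]
    exact add_mem hx hy
  | mul x y _ _ hx hy =>
    rw [dualMap_mul]
    exact mul_mem hy hx

end HallAlgebra

/-! ### Preinjective modules in the composition algebra -/

theorem QuiverRelations.op {B V E : Type*} [Fintype V] [Ring B] {s t : E → V} {e : V → B}
    {x : E → B} (h : QuiverRelations s t e x) :
    QuiverRelations t s (fun i => MulOpposite.op (e i)) (fun a => MulOpposite.op (x a)) where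
  idem i := by rw [← op_mul, h.idem]
  orth i j hij := by rw [← op_mul, h.orth j i hij.symm, op_zero]
  sum_eq_one := by rw [← Finset.op_sum, h.sum_eq_one, op_one]
  tgt_mul a := by rw [← op_mul, h.mul_src]
  mul_src a := by rw [← op_mul, h.tgt_mul]

namespace QuiverPresentation

variable {k : Type v} [Field k] {A : Type u} [Ring A] [Algebra k A] {V E : Type*} [Fintype V]
  (q : QuiverPresentation k A V E)

/-- The opposite algebra is presented by the opposite quiver. -/
def op : QuiverPresentation k Aᵐᵒᵖ V E where
  s := q.t
  t := q.s
  e i := MulOpposite.op (q.e i)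
  x a := MulOpposite.op (q.x a)
  rel := q.rel.op
  adjoin_eq_top := by
    refine eq_top_iff.mpr fun y _ => ?_
    obtain ⟨a, rfl⟩ := op_surjective y
    induction a using q.induction_generators with
    | e i => exact Algebra.subset_adjoin (.inl ⟨i, rfl⟩)
    | x a => exact Algebra.subset_adjoin (.inr ⟨a, rfl⟩)
    | algebraMap r => exact Subalgebra.algebraMap_mem _ r
    | add y z hy hz => exact add_mem (hy trivial) (hz trivial)
    | mul y z hy hz => exact mul_mem (hz trivial) (hy trivial)
  exists_lift B _ _ ε b h := by
    obtain ⟨F, hFe, hFx⟩ := q.exists_lift Bᵐᵒᵖ _ _ h.op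
    exact ⟨AlgHom.opComm F, fun i => congrArg unop (hFe i), fun a => congrArg unop (hFx a)⟩
  rank i := Finset.univ.sup q.rank - q.rank i
  rank_lt a := by
    have hlt := q.rank_lt a
    have hle : q.rank (q.t a) ≤ Finset.univ.sup q.rank := Finset.le_sup (Finset.mem_univ _)
    omega

include q in
theorem preinjectiveSubalgebra_le [Finite E] [Finite k] [Module.Finite k A] :
    preinjectiveSubalgebra k A ≤ compositionAlgebra k A := by
  refine Algebra.adjoin_le ?_
  rintro _ ⟨M, hM, rfl⟩
  obtain ⟨N, ⟨D⟩⟩ := FDMod.exists_dualPair_right (k := k) (A := A) M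
  rw [← HallAlgebra.dualMap_cls D]
  exact HallAlgebra.dualMap_mem_compositionAlgebra
    (q.op.cls_mem_of_isPreprojective (hM.dual q D))

end QuiverPresentation

/-! ### The presentation of the path algebra -/

namespace PathAlgebra

variable {k : Type u} [Field k] {Q : Type v} [Quiver.{w} Q]

open Classical in
/-- A path, as an element of the path algebra. -/
noncomputable def ofPath {i j : Q} (p : Quiver.Path i j) : PathAlgebra k Q :=
  fun i' j' => if h : i = i' ∧ j = j' then Finsupp.single (p.cast h.1 h.2) 1 else 0

theorem ofPath_self {i j : Q} (p : Quiver.Path i j) :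
    (ofPath p : PathAlgebra k Q) i j = Finsupp.single p 1 := by
  simp [ofPath]

theorem ofPath_of_ne {i j i' j' : Q} (p : Quiver.Path i j) (h : ¬ (i = i' ∧ j = j')) :
    (ofPath p : PathAlgebra k Q) i' j' = 0 :=
  dif_neg h

theorem sum_apply {ι : Type*} (s : Finset ι) (f : ι → PathAlgebra k Q) (i j : Q) :
    (∑ a ∈ s, f a) i j = ∑ a ∈ s, f a i j :=
  map_sum (⟨⟨fun x => x i j, rfl⟩, fun _ _ => rfl⟩ : PathAlgebra k Q →+ (Quiver.Path i j →₀ k)) f s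

/-- The arrows of the quiver, with source first and target second. -/
abbrev Arrow (Q : Type v) [Quiver.{w} Q] : Type (max v w) := Σ i j : Q, (i ⟶ j)

variable (Q) in
theorem exists_rank [Finite Q] [Quiver.NoOrientedCycles Q] :
    ∃ rank : Q → ℕ, ∀ a : Arrow Q, rank a.1 < rank a.2.1 := by
  let predecessors (j : Q) : Set Q := {i | ∃ p : Quiver.Path i j, p.length ≠ 0}
  refine ⟨fun j => (predecessors j).ncard, ?_⟩
  rintro ⟨i, j, a⟩
  refine Set.ncard_lt_ncard ((Set.ssubset_iff_of_subset ?_).mpr ⟨i, ⟨a.toPath, ?_⟩, ?_⟩)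
  · rintro l ⟨p, -⟩
    exact ⟨p.cons a, by simp⟩
  · simp [Quiver.Hom.toPath]
  · rintro ⟨p, hp⟩
    rw [Quiver.NoOrientedCycles.eq_nil i p] at hp
    exact hp rfl

variable [Fintype Q]

theorem ofPath_mul {i j l : Q} (p : Quiver.Path i j) (r : Quiver.Path j l) :
    (ofPath r * ofPath p : PathAlgebra k Q) = ofPath (p.comp r) := by
  ext1 i' l'
  rw [mul_apply]
  by_cases h : i = i' ∧ l = l'
  · obtain ⟨rfl, rfl⟩ := h
    rw [Fintype.sum_eq_single j fun j' hj => ?_]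
    · rw [ofPath_self, ofPath_self, ofPath_self, pathConcat_single, one_mul]
    · rw [ofPath_of_ne p fun h => hj h.2.symm, map_zero, LinearMap.zero_apply]
  · rw [ofPath_of_ne _ h]
    refine Finset.sum_eq_zero fun j' _ => ?_
    by_cases hi : i = i'
    · rw [ofPath_of_ne r fun h' => h ⟨hi, h'.2⟩, map_zero]
    · rw [ofPath_of_ne p fun h' => hi h'.1, map_zero, LinearMap.zero_apply]

theorem ofPath_mul_of_ne {i j j' l : Q} (h : j ≠ j') (p : Quiver.Path i j)
    (r : Quiver.Path j' l) : (ofPath r * ofPath p : PathAlgebra k Q) = 0 := by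
  ext1 i' l'
  rw [mul_apply, zero_apply]
  refine Finset.sum_eq_zero fun m _ => ?_
  by_cases hm : j = m
  · rw [ofPath_of_ne r fun h' => h (hm.trans h'.1.symm), map_zero]
  · rw [ofPath_of_ne p fun h' => hm h'.2, map_zero, LinearMap.zero_apply]

theorem sum_ofPath_nil : ∑ i : Q, ofPath (.nil : Quiver.Path i i) = (1 : PathAlgebra k Q) := by
  ext1 i j
  rw [sum_apply]
  by_cases h : i = j
  · subst h
    rw [one_apply_self, Fintype.sum_eq_single i fun l hl => ofPath_of_ne _ fun h => hl h.1,
      ofPath_self]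
  · rw [one_apply_ne h]
    exact Finset.sum_eq_zero fun l _ => ofPath_of_ne _ fun hl => h (hl.1.symm.trans hl.2)

theorem quiverRelations : QuiverRelations (fun a : Arrow Q => a.1) (fun a => a.2.1)
    (fun i => (ofPath (.nil : Quiver.Path i i) : PathAlgebra k Q))
    (fun a => ofPath a.2.2.toPath) where
  idem _ := ofPath_mul _ _
  orth _ _ h := ofPath_mul_of_ne h.symm _ _
  sum_eq_one := sum_ofPath_nil
  tgt_mul _ := ofPath_mul _ _
  mul_src a := by rw [ofPath_mul, Quiver.Path.nil_comp]

theorem sum_smul_ofPath (x : PathAlgebra k Q) :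
    ∑ i : Q, ∑ j : Q, ∑ r ∈ (x i j).support, x i j r • (ofPath r : PathAlgebra k Q) = x := by
  ext1 i j
  have hne {i' j' : Q} (h : ¬ (i' = i ∧ j' = j)) :
      (∑ r ∈ (x i' j').support, x i' j' r • (ofPath r : PathAlgebra k Q)) i j = 0 := by
    rw [sum_apply]
    exact Finset.sum_eq_zero fun r _ => by rw [smul_apply, ofPath_of_ne r h, smul_zero]
  rw [sum_apply, Fintype.sum_eq_single i fun i' hi => ?_, sum_apply,
    Fintype.sum_eq_single j fun j' hj => hne fun h => hj h.2, sum_apply]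
  · simp only [smul_apply, ofPath_self, Finsupp.smul_single, smul_eq_mul, mul_one]
    exact (x i j).sum_single
  · rw [sum_apply]
    exact Finset.sum_eq_zero fun j' _ => hne fun h => hi h.1

theorem induction_ofPath {p : PathAlgebra k Q → Prop} (x : PathAlgebra k Q)
    (zero : p 0) (add : ∀ x y, p x → p y → p (x + y))
    (smul : ∀ (c : k) (i j : Q) (r : Quiver.Path i j), p (c • ofPath r)) : p x := by
  rw [← sum_smul_ofPath x]
  exact Finset.sum_induction _ p add zero fun i _ =>
    Finset.sum_induction _ p add zero fun j _ =>
      Finset.sum_induction _ p add zero fun r _ => smul _ i j r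

theorem adjoin_ofPath_eq_top : Algebra.adjoin k
    (Set.range (fun i => (ofPath (.nil : Quiver.Path i i) : PathAlgebra k Q)) ∪
      Set.range (fun a : Arrow Q => ofPath a.2.2.toPath)) = ⊤ := by
  refine eq_top_iff.mpr fun x _ => ?_
  induction x using induction_ofPath with
  | zero => exact Subalgebra.zero_mem _
  | add x y hx hy => exact Subalgebra.add_mem _ (hx trivial) (hy trivial)
  | smul c i j r =>
    refine Subalgebra.smul_mem _ ?_ c
    induction r with
    | nil => exact Algebra.subset_adjoin (Or.inl ⟨i, rfl⟩)
    | cons r a ih =>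
      have h : (ofPath (r.cons a) : PathAlgebra k Q) = ofPath a.toPath * ofPath r :=
        (ofPath_mul r a.toPath).symm
      rw [h]
      exact Subalgebra.mul_mem _ (Algebra.subset_adjoin (Or.inr ⟨⟨_, _, a⟩, rfl⟩)) (ih trivial)

section Lift

variable {B : Type*} [Ring B] (ε : Q → B) (b : Arrow Q → B)

/-- The product of the elements of `B` assigned to the arrows of a path, the last arrow leftmost;
the trivial path at `i` is sent to `ε i`. -/
def pathLift {i : Q} : ∀ {j : Q}, Quiver.Path i j → B
  | _, .nil => ε i
  | _, .cons r a => b ⟨_, _, a⟩ * pathLift r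

variable {ε b}

section Relations

variable (h : QuiverRelations (fun a : Arrow Q => a.1) (fun a => a.2.1) ε b)
include h

theorem tgt_mul_pathLift {i j : Q} (r : Quiver.Path i j) :
    ε j * pathLift ε b r = pathLift ε b r := by
  cases r with
  | nil => exact h.idem i
  | cons r a => rw [pathLift, ← mul_assoc, h.tgt_mul ⟨_, _, a⟩]

theorem pathLift_mul_src {i j : Q} (r : Quiver.Path i j) :
    pathLift ε b r * ε i = pathLift ε b r := by
  induction r with
  | nil => exact h.idem i
  | cons r a ih => rw [pathLift, mul_assoc, ih]

theorem pathLift_comp {i j l : Q} (p : Quiver.Path i j) (r : Quiver.Path j l) :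
    pathLift ε b (p.comp r) = pathLift ε b r * pathLift ε b p := by
  induction r with
  | nil => exact (tgt_mul_pathLift h p).symm
  | cons r a ih => rw [Quiver.Path.comp_cons, pathLift, pathLift, ih, mul_assoc]

theorem pathLift_mul_of_ne {i j j' l : Q} (hj : j ≠ j') (p : Quiver.Path i j)
    (r : Quiver.Path j' l) : pathLift ε b r * pathLift ε b p = 0 := by
  rw [← pathLift_mul_src h r, ← tgt_mul_pathLift h p, mul_assoc, ← mul_assoc (ε j'),
    h.orth j' j hj.symm, zero_mul, mul_zero]

end Relations

variable [Algebra k B]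

variable (ε b) in
/-- The linear map out of the path algebra given by `pathLift` on paths. -/
noncomputable def linearLift : PathAlgebra k Q →ₗ[k] B :=
  ∑ i : Q, ∑ j : Q, (Finsupp.lsum k fun r : Quiver.Path i j =>
    LinearMap.toSpanSingleton k B (pathLift ε b r)) ∘ₗ
      ((LinearMap.proj j : (∀ j, Quiver.Path i j →₀ k) →ₗ[k] _) ∘ₗ
        (LinearMap.proj i : (∀ i j, Quiver.Path i j →₀ k) →ₗ[k] _))

variable (ε b) in
theorem linearLift_ofPath {i j : Q} (r : Quiver.Path i j) :
    linearLift ε b (ofPath r : PathAlgebra k Q) = pathLift ε b r := by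
  have h (x : PathAlgebra k Q) : linearLift ε b x = ∑ i : Q, ∑ j : Q,
      (Finsupp.lsum k fun r : Quiver.Path i j =>
        LinearMap.toSpanSingleton k B (pathLift ε b r)) (x i j) := by
    simp only [linearLift, LinearMap.sum_apply]
    rfl
  rw [h, Fintype.sum_eq_single i fun i' hi => Finset.sum_eq_zero fun j' _ => by
      rw [ofPath_of_ne r fun h => hi h.1.symm, map_zero],
    Fintype.sum_eq_single j fun j' hj => by rw [ofPath_of_ne r fun h => hj h.2.symm, map_zero],
    ofPath_self]
  simp

variable (h : QuiverRelations (fun a : Arrow Q => a.1) (fun a => a.2.1) ε b)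
include h

theorem linearLift_mul (x y : PathAlgebra k Q) :
    linearLift ε b (x * y) = linearLift ε b x * linearLift ε b y := by
  induction x using induction_ofPath with
  | zero => simp
  | add x x' hx hx' => rw [add_mul, map_add, hx, hx', map_add, add_mul]
  | smul c j' l r =>
    induction y using induction_ofPath with
    | zero => simp
    | add y y' hy hy' => rw [mul_add, map_add, hy, hy', map_add, mul_add]
    | smul c' i j p =>
      rw [smul_mul_smul_comm, map_smul, map_smul, map_smul, smul_mul_smul_comm,
        linearLift_ofPath, linearLift_ofPath]
      congr 1
      by_cases hj : j = j'
      · subst hj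
        rw [ofPath_mul, linearLift_ofPath, pathLift_comp h]
      · rw [ofPath_mul_of_ne hj, map_zero, pathLift_mul_of_ne h hj]

theorem exists_lift : ∃ F : PathAlgebra k Q →ₐ[k] B,
    (∀ i, F (ofPath (.nil : Quiver.Path i i)) = ε i) ∧
      ∀ a : Arrow Q, F (ofPath a.2.2.toPath) = b a := by
  refine ⟨AlgHom.ofLinearMap (linearLift ε b) ?_ (linearLift_mul h), fun i => ?_, fun a => ?_⟩
  · rw [← sum_ofPath_nil, map_sum, ← h.sum_eq_one]
    exact Finset.sum_congr rfl fun i _ => linearLift_ofPath ε b _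
  · exact linearLift_ofPath ε b _
  · exact (linearLift_ofPath ε b _).trans (h.mul_src a)

end Lift

variable (k Q) in
/-- The path algebra of a finite quiver without oriented cycles is presented by the quiver. -/
noncomputable def presentation [Quiver.NoOrientedCycles Q] :
    QuiverPresentation k (PathAlgebra k Q) Q (Arrow Q) where
  s a := a.1
  t a := a.2.1
  e i := ofPath (.nil : Quiver.Path i i)
  x a := ofPath a.2.2.toPath
  rel := quiverRelations
  adjoin_eq_top := adjoin_ofPath_eq_top
  exists_lift _ _ _ _ _ h := exists_lift h
  rank := (exists_rank Q).choose
  rank_lt := (exists_rank Q).choose_spec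

end PathAlgebra

theorem mainTheorem5 (k : Type u) [Field k] [Finite k] (Q : Type v) [Quiver.{w} Q] [Fintype Q]
    [∀ i j : Q, Finite (i ⟶ j)] [Quiver.NoOrientedCycles Q] :
    preprojectiveSubalgebra k (PathAlgebra k Q) ≤ compositionAlgebra k (PathAlgebra k Q) ∧
      preinjectiveSubalgebra k (PathAlgebra k Q) ≤ compositionAlgebra k (PathAlgebra k Q) :=
  ⟨(PathAlgebra.presentation k Q).preprojectiveSubalgebra_le,
    (PathAlgebra.presentation k Q).preinjectiveSubalgebra_le⟩
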